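/- Let $\Omega=(a,b)\times(c,d)$, $T>0$, $\epsilon_0,\epsilon_\infty,\mu_0,\tau_0>0$, $\epsilon_s>\epsilon_\infty$, $\alpha\in(0,1)$ and $\theta\in[\frac{\alpha}{2},\frac12]$. For scalar $H$ and vector valued $\boldsymbol E=(E_1,E_2)$ write $\nabla\times H=(\partial_yH,-\partial_xH)$ and $\nabla\times\boldsymbol E=\partial_xE_2-\partial_yE_1$ (weak derivatives). $H(\mathrm{curl};\Omega)$ is the space of $L^2$ fields (vector or scalar) whose curl is in $L^2$, with the graph norm, and $H_0(\mathrm{curl};\Omega)$ is the space of vector fields $\boldsymbol v\in H(\mathrm{curl};\Omega)$ with $\boldsymbol n\times\boldsymbol v=0$ on $\partial\Omega$. $(\cdot,\cdot)$ and $\|\cdot\|$ are the inner product and norm of $L^2(\Omega)$ or $(L^2(\Omega))^2$, and $\partial_t^\alpha u(t)=\frac{1}{\Gamma(1-\alpha)}\int_0^t (t-s)^{-\alpha}u'(s)\,ds$ is the Caputo derivative. Let $\boldsymbol E\in C([0,T];H_0(\mathrm{curl};\Omega))\cap C^3([0,T];(L^2(\Omega))^2)$, $\boldsymbol P\in C^3([0,T];(L^2(\Omega))^2)$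 and $H\in C^3([0,T];H(\mathrm{curl};\Omega))$ satisfy $\boldsymbol P(0)=\boldsymbol 0$ and, for $0<t<T$, the Cole–Cole system with source terms $$\epsilon_0\epsilon_\infty\,\partial_t\boldsymbol E=\nabla\times H-\partial_t\boldsymbol P+\boldsymbol f_1,\qquad \mu_0\,\partial_tH=-\nabla\times\boldsymbol E+f_2,\qquad \tau_0^\alpha\,\partial_t^\alpha\boldsymbol P+\boldsymbol P=\epsilon_0(\epsilon_s-\epsilon_\infty)\boldsymbol E+\boldsymbol f_3 .$$ In the case $\theta=\frac12$ assume moreover that $\boldsymbol f_3\in C^1([0,T];(L^2(\Omega))^2)$ (this holds in particular if $\boldsymbol f_3=\boldsymbol 0$). For $N\ge1$ let $\tau=T/N$, $t_n=n\tau$, $t_{n-\theta}=(n-\theta)\tau$, and for sequences put $$\partial_\tau^{n-\theta}u=\frac{u^n-u^{n-1}}{\tau},\qquad \overline u^{\,n-\theta}=(1-\theta)u^n+\theta u^{n-1},\qquad \partial_\tau^\alpha u^{n-\theta}=\tau^{-\alpha}\sum_{k=1}^n\omega_{n-k}(u^k-u^0),$$ where $\displaystyle\sum_{k\ge0}\omega_k\zeta^k=\Big[\frac{1-\zeta}{\frac12(1+\zeta)+\frac\theta\alpha(1-\zeta)}\Big]^\alpha$.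 The semi-discrete SFTR-$\theta$ scheme asks for $\boldsymbol E_\tau^n\in H_0(\mathrm{curl};\Omega)$, $H_\tau^n\in L^2(\Omega)$, $\boldsymbol P_\tau^n\in(L^2(\Omega))^2$ with $\boldsymbol E_\tau^0=\boldsymbol E(0)$, $H_\tau^0=H(0)$, $\boldsymbol P_\tau^0=\boldsymbol P(0)$ such that for $1\le n\le N$ $$\epsilon_0\epsilon_\infty(\partial_\tau^{n-\theta}\boldsymbol E_\tau,\boldsymbol\chi)+(\partial_\tau^{n-\theta}\boldsymbol P_\tau,\boldsymbol\chi)-(\overline H_\tau^{\,n-\theta},\nabla\times\boldsymbol\chi)=(\boldsymbol f_1(t_{n-\theta}),\boldsymbol\chi)\quad\forall\boldsymbol\chi\in H_0(\mathrm{curl};\Omega),$$ $$\mu_0(\partial_\tau^{n-\theta}H_\tau,\phi)+(\nabla\times\overline{\boldsymbol E}_\tau^{\,n-\theta},\phi)=(f_2(t_{n-\theta}),\phi)\quad\forall\phi\in L^2(\Omega),$$ $$\tau_0^\alpha(\partial_\tau^\alpha\boldsymbol P_\tau^{n-\theta},\boldsymbol\psi)+(\overline{\boldsymbol P}_\tau^{\,n-\theta},\boldsymbol\psi)-\epsilon_0(\epsilon_s-\epsilon_\infty)(\overline{\boldsymbol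 E}_\tau^{\,n-\theta},\boldsymbol\psi)=(\boldsymbol f_3(t_{n-\theta}),\boldsymbol\psi)\quad\forall\boldsymbol\psi\in(L^2(\Omega))^2 .$$ Then there are constants $C>0$ and $\tau_{\max}>0$, independent of $\tau$, such that for every $N\ge1$ with $\tau=T/N\le\tau_{\max}$ and every solution of the scheme $$\max_{1\le n\le N}\big(\|\boldsymbol E(t_n)-\boldsymbol E_\tau^n\|+\|\boldsymbol P(t_n)-\boldsymbol P_\tau^n\|+\|H(t_n)-H_\tau^n\|\big)\le C\tau^s,\qquad s=\begin{cases}1,&\theta\in[\frac\alpha2,\frac12),\\2,&\theta=\frac12.\end{cases}$$ -/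

import Mathlib

open MeasureTheory Set
open scoped ContDiff RealInnerProductSpace

noncomputable section

namespace ColeCole

/-- Points and vectors of the plane, with the Euclidean norm. -/
abbrev Plane : Type := EuclideanSpace ℝ (Fin 2)

/-- The open rectangle `(a, b) × (c, d)`. -/
def rect (a b c d : ℝ) : Set Plane :=
  {x | (a < x 0 ∧ x 0 < b) ∧ (c < x 1 ∧ x 1 < d)}

/-- `L²(Ω)`. -/
abbrev L2S (Ω : Set Plane) : Type := Lp ℝ 2 (volume.restrict Ω)

/-- `(L²(Ω))²`, as the space of square integrable plane-valued fields. -/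
abbrev L2V (Ω : Set Plane) : Type := Lp Plane 2 (volume.restrict Ω)

/-- `∂φ/∂xᵢ` for a function on the plane. -/
def pderiv {F : Type*} [NormedAddCommGroup F] [NormedSpace ℝ F]
    (i : Fin 2) (φ : Plane → F) (x : Plane) : F :=
  fderiv ℝ φ x (EuclideanSpace.single i 1)

/-- The curl `(∂φ/∂y, -∂φ/∂x)` of a smooth scalar function. -/
def curlS (φ : Plane → ℝ) (x : Plane) : Plane :=
  !₂[pderiv 1 φ x, -pderiv 0 φ x]

/-- The curl `∂Φ₂/∂x - ∂Φ₁/∂y` of a smooth vector field. -/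
def curlV (Φ : Plane → Plane) (x : Plane) : ℝ :=
  (pderiv 0 Φ x) 1 - (pderiv 1 Φ x) 0

/-- `C_c^∞(Ω; F)`. -/
def IsTest {F : Type*} [NormedAddCommGroup F] [NormedSpace ℝ F]
    (Ω : Set Plane) (φ : Plane → F) : Prop :=
  ContDiff ℝ ∞ φ ∧ HasCompactSupport φ ∧ tsupport φ ⊆ Ω

/-- `w ∈ L²(Ω)` is the weak curl of the vector field `v ∈ (L²(Ω))²`. -/
def IsWeakCurlV (Ω : Set Plane) (v : L2V Ω) (w : L2S Ω) : Prop :=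
  ∀ φ : Plane → ℝ, IsTest Ω φ →
    ∫ x in Ω, w x * φ x = ∫ x in Ω, ⟪v x, curlS φ x⟫

/-- `W ∈ (L²(Ω))²` is the weak curl of the scalar function `h ∈ L²(Ω)`. -/
def IsWeakCurlS (Ω : Set Plane) (h : L2S Ω) (W : L2V Ω) : Prop :=
  ∀ Φ : Plane → Plane, IsTest Ω Φ →
    ∫ x in Ω, ⟪W x, Φ x⟫ = ∫ x in Ω, h x * curlV Φ x

section Helpers

variable {Ω : Set Plane}

theorem continuous_pderiv {F : Type*} [NormedAddCommGroup F] [NormedSpace ℝ F]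
    {φ : Plane → F} (h : IsTest Ω φ) (i : Fin 2) : Continuous (pderiv i φ) :=
  (h.1.continuous_fderiv (by simp)).clm_apply continuous_const

theorem hasCompactSupport_pderiv {F : Type*} [NormedAddCommGroup F] [NormedSpace ℝ F]
    {φ : Plane → F} (h : IsTest Ω φ) (i : Fin 2) : HasCompactSupport (pderiv i φ) :=
  h.2.1.fderiv_apply (𝕜 := ℝ) _

theorem memLp_curlS {φ : Plane → ℝ} (h : IsTest Ω φ) :
    MemLp (curlS φ) 2 (volume.restrict Ω) := by
  have hc : Continuous (curlS φ) := by
    refine (PiLp.continuous_toLp 2 _).comp (continuous_pi fun i => ?_)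
    fin_cases i
    · exact continuous_pderiv h 1
    · exact (continuous_pderiv h 0).neg
  have hs : HasCompactSupport (curlS φ) := by
    have h0 := hasCompactSupport_pderiv h 0
    have h1 := hasCompactSupport_pderiv h 1
    refine HasCompactSupport.intro (h1.isCompact.union h0.isCompact) fun x hx => ?_
    rw [Set.mem_union, not_or] at hx
    ext i
    fin_cases i
    · simpa [curlS] using image_eq_zero_of_notMem_tsupport hx.1
    · simpa [curlS] using image_eq_zero_of_notMem_tsupport hx.2
  exact hc.memLp_of_hasCompactSupport hs

theorem memLp_curlV {Φ : Plane → Plane} (h : IsTest Ω Φ) :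
    MemLp (curlV Φ) 2 (volume.restrict Ω) := by
  have hc : Continuous (curlV Φ) := by
    have h0 := continuous_pderiv h 0
    have h1 := continuous_pderiv h 1
    unfold curlV
    fun_prop
  have hs : HasCompactSupport (curlV Φ) := by
    have h0 := hasCompactSupport_pderiv h 0
    have h1 := hasCompactSupport_pderiv h 1
    refine HasCompactSupport.intro (h0.isCompact.union h1.isCompact) fun x hx => ?_
    rw [Set.mem_union, not_or] at hx
    simp [curlV, image_eq_zero_of_notMem_tsupport hx.1, image_eq_zero_of_notMem_tsupport hx.2]
  exact hc.memLp_of_hasCompactSupport hs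

theorem memLp_test {F : Type*} [NormedAddCommGroup F] [NormedSpace ℝ F]
    {φ : Plane → F} (h : IsTest Ω φ) : MemLp φ 2 (volume.restrict Ω) :=
  h.1.continuous.memLp_of_hasCompactSupport h.2.1

theorem inner_toLp {F : Type*} [NormedAddCommGroup F] [InnerProductSpace ℝ F]
    (v : Lp F 2 (volume.restrict Ω)) {g : Plane → F} (hg : MemLp g 2 (volume.restrict Ω)) :
    ∫ x in Ω, ⟪v x, g x⟫ = ⟪v, hg.toLp g⟫ := by
  rw [L2.inner_def]
  refine integral_congr_ae ?_
  filter_upwards [hg.coeFn_toLp] with x hx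
  rw [hx]

theorem integral_mul_toLp (v : L2S Ω) {g : Plane → ℝ} (hg : MemLp g 2 (volume.restrict Ω)) :
    ∫ x in Ω, v x * g x = ⟪v, hg.toLp g⟫ := by
  rw [← inner_toLp v hg]
  refine integral_congr_ae (Filter.Eventually.of_forall fun x => ?_)
  simp [mul_comm]

theorem isWeakCurlV_iff (v : L2V Ω) (w : L2S Ω) :
    IsWeakCurlV Ω v w ↔ ∀ (φ : Plane → ℝ) (h : IsTest Ω φ),
      ⟪w, (memLp_test h).toLp φ⟫ = ⟪v, (memLp_curlS h).toLp (curlS φ)⟫ := by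
  refine forall_congr' fun φ => forall_congr' fun h => ?_
  rw [integral_mul_toLp w (memLp_test h), inner_toLp v (memLp_curlS h)]

theorem isWeakCurlS_iff (u : L2S Ω) (W : L2V Ω) :
    IsWeakCurlS Ω u W ↔ ∀ (Φ : Plane → Plane) (h : IsTest Ω Φ),
      ⟪W, (memLp_test h).toLp Φ⟫ = ⟪u, (memLp_curlV h).toLp (curlV Φ)⟫ := by
  refine forall_congr' fun Φ => forall_congr' fun h => ?_
  rw [integral_mul_toLp u (memLp_curlV h), inner_toLp W (memLp_test h)]

end Helpers

/-- `H(curl; Ω)` for vector fields. An element is a field `v ∈ (L²(Ω))²` together with its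
(unique) weak curl in `L²(Ω)`; the norm is `(‖v‖² + ‖∇ × v‖²)^{1/2}`. -/
def Hcurl (Ω : Set Plane) : Submodule ℝ (WithLp 2 (L2V Ω × L2S Ω)) where
  carrier := {p | IsWeakCurlV Ω p.fst p.snd}
  zero_mem' := by
    simp only [mem_ofPred_eq, isWeakCurlV_iff]
    intro φ h
    simp
  add_mem' := by
    intro p q hp hq
    simp only [mem_ofPred_eq, isWeakCurlV_iff] at *
    intro φ h
    simp [inner_add_left, hp φ h, hq φ h]
  smul_mem' := by
    intro r p hp
    simp only [mem_ofPred_eq, isWeakCurlV_iff] at *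
    intro φ h
    simp [real_inner_smul_left, hp φ h]

/-- `H(curl; Ω)` for scalar functions, which is `H¹(Ω)`. An element is a function `h ∈ L²(Ω)`
together with its (unique) weak curl `(∂h/∂y, -∂h/∂x) ∈ (L²(Ω))²`, with the graph norm. -/
def HcurlS (Ω : Set Plane) : Submodule ℝ (WithLp 2 (L2S Ω × L2V Ω)) where
  carrier := {p | IsWeakCurlS Ω p.fst p.snd}
  zero_mem' := by
    simp only [mem_ofPred_eq, isWeakCurlS_iff]
    intro φ h
    simp
  add_mem' := by
    intro p q hp hq
    simp only [mem_ofPred_eq, isWeakCurlS_iff] at *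
    intro φ h
    simp [inner_add_left, hp φ h, hq φ h]
  smul_mem' := by
    intro r p hp
    simp only [mem_ofPred_eq, isWeakCurlS_iff] at *
    intro φ h
    simp [real_inner_smul_left, hp φ h]

/-- `H₀(curl; Ω)`: the fields `v ∈ H(curl; Ω)` with `n × v = 0` on `∂Ω`. The tangential trace of
`v` is the functional `h ↦ (∇ × v, h) - (v, ∇ × h)` on `H¹(Ω)` (Green's formula), and it has
to vanish. -/
def H0curl (Ω : Set Plane) : Submodule ℝ (WithLp 2 (L2V Ω × L2S Ω)) where
  carrier := {p | p ∈ Hcurl Ω ∧ ∀ q ∈ HcurlS Ω, ⟪p.snd, q.fst⟫ = ⟪p.fst, q.snd⟫}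
  zero_mem' := ⟨(Hcurl Ω).zero_mem, fun q _ => by simp⟩
  add_mem' := by
    intro p q hp hq
    refine ⟨(Hcurl Ω).add_mem hp.1 hq.1, fun r hr => ?_⟩
    simp [inner_add_left, hp.2 r hr, hq.2 r hr]
  smul_mem' := by
    intro s p hp
    refine ⟨(Hcurl Ω).smul_mem s hp.1, fun r hr => ?_⟩
    simp [real_inner_smul_left, hp.2 r hr]

/-- The underlying `L²` field of an element of `H₀(curl; Ω)`. -/
def fieldV {Ω : Set Plane} (v : H0curl Ω) : L2V Ω := (v : WithLp 2 (L2V Ω × L2S Ω)).fst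

/-- `∇ × v` for `v ∈ H₀(curl; Ω)`. -/
def curlE {Ω : Set Plane} (v : H0curl Ω) : L2S Ω := (v : WithLp 2 (L2V Ω × L2S Ω)).snd

/-- The underlying `L²` function of a scalar element of `H(curl; Ω)`. -/
def funcS {Ω : Set Plane} (h : HcurlS Ω) : L2S Ω := (h : WithLp 2 (L2S Ω × L2V Ω)).fst

/-- `∇ × h` for a scalar `h ∈ H(curl; Ω)`. -/
def curlH {Ω : Set Plane} (h : HcurlS Ω) : L2V Ω := (h : WithLp 2 (L2S Ω × L2V Ω)).snd

/-- The Riemann-Liouville integral `(I^β u)(t) = Γ(β)⁻¹ ∫₀ᵗ (t - s)^{β - 1} u(s) ds`. -/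
def rlIntegral {F : Type*} [NormedAddCommGroup F] [NormedSpace ℝ F]
    (β : ℝ) (u : ℝ → F) (t : ℝ) : F :=
  (Real.Gamma β)⁻¹ • ∫ s in (0 : ℝ)..t, (t - s) ^ (β - 1) • u s

/-- The Caputo derivative `∂ₜ^α u = I^{1-α} uₜ`. -/
def caputo {F : Type*} [NormedAddCommGroup F] [NormedSpace ℝ F]
    (α : ℝ) (u : ℝ → F) (t : ℝ) : F :=
  rlIntegral (1 - α) (deriv u) t

/-- The physical parameters of the Cole-Cole medium. -/
structure Medium where
  ε₀ : ℝ
  εinf : ℝ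
  εs : ℝ
  μ₀ : ℝ
  τ₀ : ℝ
  α : ℝ
  ε₀_pos : 0 < ε₀
  εinf_pos : 0 < εinf
  εinf_lt_εs : εinf < εs
  μ₀_pos : 0 < μ₀
  τ₀_pos : 0 < τ₀
  α_pos : 0 < α
  α_lt_one : α < 1

/-- `(E, P, H)` solves the Cole-Cole system with sources `f₁, f₂, f₃` on `Ω × (0, T)`, with
`P(0) = 0`. The boundary condition `n × E = 0` is contained in `E(t) ∈ H₀(curl; Ω)`. -/
structure IsSolution (M : Medium) {Ω : Set Plane} (T : ℝ)
    (f₁ : ℝ → L2V Ω) (f₂ : ℝ → L2S Ω) (f₃ : ℝ → L2V Ω)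
    (E : ℝ → H0curl Ω) (P : ℝ → L2V Ω) (H : ℝ → HcurlS Ω) : Prop where
  init : P 0 = 0
  ampere : ∀ t ∈ Ioo 0 T,
    (M.ε₀ * M.εinf) • deriv (fun s => fieldV (E s)) t = curlH (H t) - deriv P t + f₁ t
  faraday : ∀ t ∈ Ioo 0 T,
    M.μ₀ • deriv (fun s => funcS (H s)) t = -curlE (E t) + f₂ t
  polarization : ∀ t ∈ Ioo 0 T,
    M.τ₀ ^ M.α • caputo M.α P t + P t = (M.ε₀ * (M.εs - M.εinf)) • fieldV (E t) + f₃ t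

/-- The generating function `ω(ζ) = [(1 - ζ) / ((1 + ζ)/2 + (θ/α)(1 - ζ))]^α`. -/
def omega (α θ ζ : ℝ) : ℝ :=
  ((1 - ζ) / ((1 / 2) * (1 + ζ) + (θ / α) * (1 - ζ))) ^ α

/-- The weight `ω_k`: the coefficient of `ζ^k` in the power series of `ω` at `0`. -/
def weight (α θ : ℝ) (k : ℕ) : ℝ :=
  iteratedDeriv k (omega α θ) 0 / (k.factorial : ℝ)

section Discrete

variable {F : Type*} [AddCommGroup F] [Module ℝ F]

/-- The difference quotient `(uⁿ - uⁿ⁻¹)/τ`, used for `n ≥ 1`. -/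
def dq (τ : ℝ) (u : ℕ → F) (n : ℕ) : F := τ⁻¹ • (u n - u (n - 1))

/-- The average `(1 - θ) uⁿ + θ uⁿ⁻¹`, used for `n ≥ 1`. -/
def avg (θ : ℝ) (u : ℕ → F) (n : ℕ) : F := (1 - θ) • u n + θ • u (n - 1)

/-- The shifted fractional trapezoidal rule `τ^{-α} ∑_{k=1}^n ω_{n-k} (u^k - u^0)`. -/
def fracDq (α θ τ : ℝ) (u : ℕ → F) (n : ℕ) : F :=
  τ ^ (-α) • ∑ k ∈ Finset.Icc 1 n, weight α θ (n - k) • (u k - u 0)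

end Discrete

/-- `(Eτ, Pτ, Hτ)` solves the semi-discrete SFTR-θ scheme with step `τ`, sources sampled at
`t_{n-θ} = (n - θ) τ`, and initial values `E₀, P₀, H₀`, for the steps `n = 1, …, N`. -/
structure IsSchemeSolution (M : Medium) {Ω : Set Plane} (θ τ : ℝ) (N : ℕ)
    (f₁ : ℝ → L2V Ω) (f₂ : ℝ → L2S Ω) (f₃ : ℝ → L2V Ω)
    (E₀ : H0curl Ω) (P₀ : L2V Ω) (H₀ : L2S Ω)
    (Eτ : ℕ → H0curl Ω) (Pτ : ℕ → L2V Ω) (Hτ : ℕ → L2S Ω) : Prop where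
  initE : Eτ 0 = E₀
  initP : Pτ 0 = P₀
  initH : Hτ 0 = H₀
  ampere : ∀ n, 1 ≤ n → n ≤ N → ∀ χ : H0curl Ω,
    M.ε₀ * M.εinf * ⟪fieldV (dq τ Eτ n), fieldV χ⟫ + ⟪dq τ Pτ n, fieldV χ⟫
      - ⟪avg θ Hτ n, curlE χ⟫ = ⟪f₁ ((n - θ) * τ), fieldV χ⟫
  faraday : ∀ n, 1 ≤ n → n ≤ N → ∀ φ : L2S Ω,
    M.μ₀ * ⟪dq τ Hτ n, φ⟫ + ⟪curlE (avg θ Eτ n), φ⟫ = ⟪f₂ ((n - θ) * τ), φ⟫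
  polarization : ∀ n, 1 ≤ n → n ≤ N → ∀ ψ : L2V Ω,
    M.τ₀ ^ M.α * ⟪fracDq M.α θ τ Pτ n, ψ⟫ + ⟪avg θ Pτ n, ψ⟫
      - M.ε₀ * (M.εs - M.εinf) * ⟪fieldV (avg θ Eτ n), ψ⟫ = ⟪f₃ ((n - θ) * τ), ψ⟫

/-- The convergence order: `2` for `θ = 1/2`, and `1` otherwise. -/
def order (θ : ℝ) : ℕ := if θ = 1 / 2 then 2 else 1

end ColeCole

end

/-!
The scheme is compared with the solution through a discrete comparison curve in place of `P (t n)`: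
inverting the generating function `ω` of the weights as a power series gives the curve whose
fractional difference quotients are exactly the Caputo derivatives at `t (n - θ)`. With it the
polarization law holds up to a residual of bounded variation.

Stability is an energy estimate. Ampère's law is tested with the average of the electric error,
corrected by the averaging error of `E` (of which only the field is small, not the curl), Faraday's
law with the average of the magnetic error, and the polarization law with the increments of the
polarization error. The fractional term is nonnegative because the coefficients of `ω / (1 - X)` are
mixtures `∫ (y + (1 - y) q) ^ n` over a Beta law. The residual paired with increments is summed by
parts, which is why its variation has to be controlled.

By Taylor's formula the comparison error is a superposition of the errors for the kernels `t` and
`(t - s)₊ ^ 2 / 2`. The asymptotics of the coefficients of `(1 - X) ^ (α - 1)` bound the total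
variation of these errors, uniformly in `s`, and give `O(τ ‖P' 0‖ + τ ^ 2)`. For `θ = 1 / 2` the
regularity of `f₃` forces `P' 0 = 0`: near `0` the Caputo derivative is `t ^ (1 - α) • P' 0` to
leading order, whereas the other terms of the polarization law are differentiable at `0`.
-/

noncomputable section

namespace ColeCole

open PowerSeries ProbabilityTheory

/-! ### The binomial series `(1 - x X) ^ r` -/

/-- The binomial series of `(1 - x X) ^ r`. -/
def binSer (r x : ℝ) : ℝ⟦X⟧ :=
  PowerSeries.rescale (-x) (PowerSeries.binomialSeries ℝ r)

theorem coeff_binSer (r x : ℝ) (n : ℕ) :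
    coeff n (binSer r x) = (-x) ^ n * Ring.choose r n := by
  simp [binSer, coeff_rescale]

theorem succ_mul_choose (r : ℝ) (n : ℕ) :
    ((n : ℝ) + 1) * Ring.choose r (n + 1) = (r - n) * Ring.choose r n := by
  have h := Ring.choose_smul_choose r (Nat.le_succ n)
  rw [Nat.choose_succ_self_right, show n + 1 - n = 1 by omega, Ring.choose_one_right] at h
  simp only [nsmul_eq_mul] at h
  push_cast at h
  rw [h]; ring

theorem succ_mul_choose_eq_mul_choose_sub_one (r : ℝ) (n : ℕ) :
    ((n : ℝ) + 1) * Ring.choose r (n + 1) = r * Ring.choose (r - 1) n := by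
  have h := Ring.choose_smul_choose r (show 1 ≤ n + 1 by omega)
  rw [Nat.choose_one_right, Nat.add_sub_cancel, Ring.choose_one_right] at h
  simpa [nsmul_eq_mul] using h

theorem coeff_binSer_zero (r x : ℝ) : coeff 0 (binSer r x) = 1 := by
  simp [coeff_binSer]

theorem coeff_binSer_succ (r x : ℝ) (n : ℕ) :
    coeff (n + 1) (binSer r x)
      = x * ((n - r) / (n + 1)) * coeff n (binSer r x) := by
  have h := succ_mul_choose r n
  have hn : (n : ℝ) + 1 ≠ 0 := by positivity
  have h' : Ring.choose r (n + 1) = (r - n) * Ring.choose r n / (n + 1) := by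
    rw [← h]; field_simp
  rw [coeff_binSer, coeff_binSer, h']
  field_simp
  ring

theorem binSer_add (r s x : ℝ) : binSer (r + s) x = binSer r x * binSer s x := by
  simp [binSer, PowerSeries.binomialSeries_add]

theorem binSer_zero (x : ℝ) : binSer 0 x = 1 := by
  simp [binSer]

theorem binSer_one (x : ℝ) : binSer 1 x = 1 - x • X := by
  ext n
  rw [coeff_binSer]
  match n with
  | 0 => simp
  | 1 => simp
  | n + 2 =>
    have : Ring.choose (1 : ℝ) (n + 2) = 0 := by
      have := Ring.choose_natCast (R := ℝ) 1 (n + 2)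
      rwa [Nat.choose_eq_zero_of_lt (by omega), Nat.cast_one, Nat.cast_zero] at this
    simp [this, coeff_X, coeff_one]

theorem coeff_binSer_neg_one (n : ℕ) : coeff n (binSer (-1) 1) = 1 := by
  induction n with
  | zero => exact coeff_binSer_zero _ _
  | succ n ih =>
    rw [coeff_binSer_succ, ih]
    have : (n : ℝ) + 1 ≠ 0 := by positivity
    field_simp
    ring

theorem coeff_binSer_neg_two (n : ℕ) : coeff n (binSer (-2) 1) = n + 1 := by
  induction n with
  | zero => simpa using coeff_binSer_zero _ _
  | succ n ih =>
    rw [coeff_binSer_succ, ih]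
    have : (n : ℝ) + 1 ≠ 0 := by positivity
    push_cast
    field_simp
    ring

theorem coeff_binSer_nonneg {r x : ℝ} (hr : r ≤ 0) (hx : 0 ≤ x) (n : ℕ) :
    0 ≤ coeff n (binSer r x) := by
  induction n with
  | zero => simp [coeff_binSer_zero]
  | succ n ih =>
    rw [coeff_binSer_succ]
    have : 0 ≤ (n : ℝ) - r := by linarith [n.cast_nonneg (α := ℝ)]
    positivity

theorem coeff_binSer_pos {r : ℝ} (hr : r < 0) (n : ℕ) :
    0 < coeff n (binSer r 1) := by
  induction n with
  | zero => simp [coeff_binSer_zero]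
  | succ n ih =>
    rw [coeff_binSer_succ]
    have : 0 < (n : ℝ) - r := by linarith [n.cast_nonneg (α := ℝ)]
    positivity

theorem coeff_binSer_sub_one {r : ℝ} (hr : r ≠ 0) (n : ℕ) :
    coeff n (binSer (r - 1) 1)
      = (n - r) / (-r) * coeff n (binSer r 1) := by
  have h1 := succ_mul_choose r n
  rw [succ_mul_choose_eq_mul_choose_sub_one] at h1
  rw [coeff_binSer, coeff_binSer]
  field_simp
  linear_combination h1

theorem coeff_one_sub_X_mul_succ (F : ℝ⟦X⟧) (n : ℕ) :
    coeff (n + 1) ((1 - X) * F)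
      = coeff (n + 1) F - coeff n F := by
  rw [sub_mul, one_mul, map_sub, coeff_succ_X_mul]

theorem coeff_one_sub_X_mul_zero (F : ℝ⟦X⟧) :
    coeff 0 ((1 - X) * F) = coeff 0 F := by
  simp

theorem binSer_one_one : binSer 1 1 = 1 - X := by
  simp [binSer_one]

theorem one_sub_X_mul_binSer (r : ℝ) :
    (1 - X) * binSer r 1 = binSer (r + 1) 1 := by
  rw [← binSer_one_one, ← binSer_add, add_comm]

theorem sum_range_succ_coeff_one_sub_X_mul (F : ℝ⟦X⟧) (n : ℕ) :
    ∑ k ∈ Finset.range (n + 1), coeff k ((1 - X) * F) = coeff n F := by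
  induction n with
  | zero => simp
  | succ n ih => rw [Finset.sum_range_succ, ih, coeff_one_sub_X_mul_succ]; ring

theorem sum_range_succ_coeff_binSer (r : ℝ) (n : ℕ) :
    ∑ k ∈ Finset.range (n + 1), coeff k (binSer r 1) = coeff n (binSer (r - 1) 1) := by
  rw [← sum_range_succ_coeff_one_sub_X_mul, one_sub_X_mul_binSer, sub_add_cancel]

theorem coeff_succ_binSer_nonpos {r : ℝ} (hr0 : 0 ≤ r) (hr1 : r ≤ 1) (n : ℕ) :
    coeff (n + 1) (binSer r 1) ≤ 0 := by
  induction n with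
  | zero => simpa [coeff_binSer_succ, coeff_binSer_zero] using hr0
  | succ n ih =>
    rw [coeff_binSer_succ]
    push_cast
    have : 0 ≤ (n : ℝ) + 1 - r := by linarith [n.cast_nonneg (α := ℝ)]
    exact mul_nonpos_of_nonneg_of_nonpos (by positivity) ih

theorem abs_coeff_binSer_le_abs_coeff_binSer_one (r : ℝ) {x : ℝ} (hx0 : 0 ≤ x) (hx1 : x ≤ 1)
    (n : ℕ) : |coeff n (binSer r x)| ≤ |coeff n (binSer r 1)| := by
  rw [coeff_binSer, coeff_binSer, abs_mul, abs_mul]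
  refine mul_le_mul_of_nonneg_right ?_ (abs_nonneg _)
  simpa [abs_of_nonneg hx0] using pow_le_one₀ hx0 hx1

/-! ### Power series with absolutely summable coefficients -/

/-- The coefficients of `F` have `ℓ¹` norm at most `C`. -/
def SumAbsLE (F : ℝ⟦X⟧) (C : ℝ) : Prop :=
  ∀ N : ℕ, ∑ n ∈ Finset.range N, |coeff n F| ≤ C

theorem SumAbsLE.nonneg {F : ℝ⟦X⟧} {C : ℝ} (h : SumAbsLE F C) : 0 ≤ C := by
  simpa using h 0

theorem SumAbsLE.mono {F : ℝ⟦X⟧} {C D : ℝ} (h : SumAbsLE F C) (hCD : C ≤ D) :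
    SumAbsLE F D := fun N => (h N).trans hCD

theorem SumAbsLE.add {F G : ℝ⟦X⟧} {C D : ℝ} (hF : SumAbsLE F C) (hG : SumAbsLE G D) :
    SumAbsLE (F + G) (C + D) := by
  intro N
  calc ∑ n ∈ Finset.range N, |coeff n (F + G)|
      ≤ ∑ n ∈ Finset.range N, (|coeff n F| + |coeff n G|) :=
        Finset.sum_le_sum fun n _ => by rw [map_add]; exact abs_add_le _ _
    _ ≤ C + D := by rw [Finset.sum_add_distrib]; exact add_le_add (hF N) (hG N)

theorem SumAbsLE.smul {F : ℝ⟦X⟧} {C : ℝ} (hF : SumAbsLE F C) (r : ℝ) :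
    SumAbsLE (r • F) (|r| * C) := by
  intro N
  simp only [coeff_smul, smul_eq_mul, abs_mul, ← Finset.mul_sum]
  exact mul_le_mul_of_nonneg_left (hF N) (abs_nonneg r)

theorem SumAbsLE.neg {F : ℝ⟦X⟧} {C : ℝ} (hF : SumAbsLE F C) : SumAbsLE (-F) C := by
  intro N
  simpa using hF N

theorem SumAbsLE.sub {F G : ℝ⟦X⟧} {C D : ℝ} (hF : SumAbsLE F C) (hG : SumAbsLE G D) :
    SumAbsLE (F - G) (C + D) := by
  rw [sub_eq_add_neg]
  exact hF.add hG.neg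

theorem SumAbsLE.mul {F G : ℝ⟦X⟧} {C D : ℝ} (hF : SumAbsLE F C) (hG : SumAbsLE G D) :
    SumAbsLE (F * G) (C * D) := by
  intro N
  calc ∑ n ∈ Finset.range N, |coeff n (F * G)|
      ≤ ∑ n ∈ Finset.range N, ∑ p ∈ Finset.HasAntidiagonal.antidiagonal n,
          |coeff p.1 F| * |coeff p.2 G| := by
        refine Finset.sum_le_sum fun n _ => ?_
        rw [coeff_mul]
        refine (Finset.abs_sum_le_sum_abs _ _).trans (le_of_eq ?_)
        simp only [abs_mul]
    _ = ∑ p ∈ Finset.range N ×ˢ Finset.range N with p.1 + p.2 < N,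
          |coeff p.1 F| * |coeff p.2 G| := by
        rw [← Finset.sum_fiberwise_of_maps_to (g := fun p : ℕ × ℕ => p.1 + p.2)
          (t := Finset.range N) (fun p hp => by simpa using (Finset.mem_filter.1 hp).2)]
        refine Finset.sum_congr rfl fun n hn => Finset.sum_congr ?_ fun _ _ => rfl
        ext p
        simp only [Finset.mem_range, Finset.HasAntidiagonal.mem_antidiagonal, Finset.mem_filter,
          Finset.mem_product] at hn ⊢
        omega
    _ ≤ ∑ p ∈ Finset.range N ×ˢ Finset.range N,
          |coeff p.1 F| * |coeff p.2 G| :=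
        Finset.sum_le_sum_of_subset_of_nonneg (Finset.filter_subset _ _)
          fun _ _ _ => by positivity
    _ = (∑ n ∈ Finset.range N, |coeff n F|)
          * ∑ n ∈ Finset.range N, |coeff n G| := by
        rw [Finset.sum_mul_sum, Finset.sum_product]
    _ ≤ C * D := mul_le_mul (hF N) (hG N) (Finset.sum_nonneg fun _ _ => abs_nonneg _) hF.nonneg

theorem sumAbsLE_X_pow (j : ℕ) : SumAbsLE (X ^ j) 1 := by
  intro N
  simp only [coeff_X_pow, apply_ite abs, abs_one, abs_zero, Finset.sum_ite_eq']
  split_ifs <;> norm_num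

theorem sumAbsLE_one : SumAbsLE 1 1 := by
  simpa using sumAbsLE_X_pow 0

theorem SumAbsLE.X_pow_mul {F : ℝ⟦X⟧} {C : ℝ} (hF : SumAbsLE F C) (j : ℕ) :
    SumAbsLE (X ^ j * F) C := by
  simpa using (sumAbsLE_X_pow j).mul hF

theorem sumAbsLE_one_sub_X : SumAbsLE (1 - X) 2 := by
  simpa [one_add_one_eq_two] using sumAbsLE_one.sub (sumAbsLE_X_pow 1)

theorem sumAbsLE_binSer {r x : ℝ} (hr0 : 0 ≤ r) (hr1 : r ≤ 1) (hx0 : 0 ≤ x) (hx1 : x ≤ 1) :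
    SumAbsLE (binSer r x) 2 := by
  intro N
  refine (Finset.sum_le_sum fun n _ =>
    abs_coeff_binSer_le_abs_coeff_binSer_one r hx0 hx1 n).trans ?_
  cases N with
  | zero => simp
  | succ n =>
    have hpartial : 0 ≤ ∑ k ∈ Finset.range (n + 1), coeff k (binSer r 1) := by
      rw [sum_range_succ_coeff_binSer]
      exact coeff_binSer_nonneg (by linarith) zero_le_one n
    have habs : ∑ k ∈ Finset.range n, |coeff (k + 1) (binSer r 1)|
        = -∑ k ∈ Finset.range n, coeff (k + 1) (binSer r 1) := by
      rw [← Finset.sum_neg_distrib]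
      exact Finset.sum_congr rfl fun k _ => abs_of_nonpos (coeff_succ_binSer_nonpos hr0 hr1 k)
    rw [Finset.sum_range_succ', coeff_binSer_zero] at hpartial ⊢
    rw [habs, abs_one]
    linarith

/-! ### The generating function of the weights -/

theorem hasDerivAt_one_sub_mul_rpow (r x : ℝ) {z : ℝ} (hz : 1 - x * z ≠ 0) :
    HasDerivAt (fun y : ℝ => (1 - x * y) ^ r) (-x * r * (1 - x * z) ^ (r - 1)) z := by
  have h1 : HasDerivAt (fun y : ℝ => 1 - x * y) (-x) z := by
    simpa using ((hasDerivAt_id z).const_mul x).const_sub 1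
  exact h1.rpow_const (Or.inl hz)

theorem eventually_one_sub_mul_pos (x : ℝ) : ∀ᶠ z in nhds (0 : ℝ), 0 < 1 - x * z := by
  have : ContinuousAt (fun z : ℝ => 1 - x * z) 0 := by fun_prop
  exact this.eventually (lt_mem_nhds (by simp))

theorem iteratedDeriv_one_sub_mul_rpow (x : ℝ) (n : ℕ) (r : ℝ) :
    iteratedDeriv n (fun y : ℝ => (1 - x * y) ^ r) 0 = n.factorial * coeff n (binSer r x) := by
  induction n generalizing r with
  | zero => simp [coeff_binSer_zero]
  | succ n ih =>
    rw [iteratedDeriv_succ']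
    have h : deriv (fun y : ℝ => (1 - x * y) ^ r) =ᶠ[nhds 0]
        fun y => (-x * r) * (1 - x * y) ^ (r - 1) := by
      filter_upwards [eventually_one_sub_mul_pos x] with z hz
      exact (hasDerivAt_one_sub_mul_rpow r x hz.ne').deriv
    rw [h.iteratedDeriv_eq, iteratedDeriv_const_mul_field, ih, coeff_binSer, coeff_binSer,
      Nat.factorial_succ, pow_succ]
    push_cast
    linear_combination (-(-x) ^ n * -x * n.factorial) * succ_mul_choose_eq_mul_choose_sub_one r n

theorem contDiffAt_one_sub_mul_rpow (x r : ℝ) (n : WithTop ℕ∞) :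
    ContDiffAt ℝ n (fun y : ℝ => (1 - x * y) ^ r) 0 :=
  ContDiffAt.rpow_const_of_ne (by fun_prop) (by simp)

theorem iteratedDeriv_mul_eq_factorial_mul_coeff_mul {f g : ℝ → ℝ} {F G : ℝ⟦X⟧} {x : ℝ} (n : ℕ)
    (hf : ContDiffAt ℝ n f x) (hg : ContDiffAt ℝ n g x)
    (hF : ∀ k, iteratedDeriv k f x = k.factorial * coeff k F)
    (hG : ∀ k, iteratedDeriv k g x = k.factorial * coeff k G) :
    iteratedDeriv n (fun y => f y * g y) x = n.factorial * coeff n (F * G) := by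
  rw [iteratedDeriv_fun_mul hf hg, coeff_mul,
    Finset.Nat.sum_antidiagonal_eq_sum_range_succ_mk, Finset.mul_sum]
  refine Finset.sum_congr rfl fun i hi => ?_
  have h := Nat.choose_mul_factorial_mul_factorial (Finset.mem_range_succ_iff.1 hi)
  rw [hF, hG, ← h]
  push_cast
  ring

/-- The power series of the generating function `ω`, whose denominator is
`(1 / 2 + θ / α) (1 - q ζ)` with `q = (θ / α - 1 / 2) / (1 / 2 + θ / α)`. -/
def omegaSer (α θ : ℝ) : ℝ⟦X⟧ :=
  ((1 / 2 + θ / α) ^ (-α)) •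
    (binSer α 1 * binSer (-α) ((θ / α - 1 / 2) / (1 / 2 + θ / α)))

theorem one_half_le_div {α θ : ℝ} (hα : 0 < α) (hθ : α / 2 ≤ θ) : 1 / 2 ≤ θ / α := by
  rw [le_div_iff₀ hα]
  linarith

theorem omega_eventuallyEq {α θ : ℝ} (hα : 0 < α) (hθ : α / 2 ≤ θ) :
    omega α θ =ᶠ[nhds 0] fun ζ => (1 / 2 + θ / α) ^ (-α) * ((1 - 1 * ζ) ^ α *
      (1 - (θ / α - 1 / 2) / (1 / 2 + θ / α) * ζ) ^ (-α)) := by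
  have hA : 0 < 1 / 2 + θ / α := by linarith [one_half_le_div hα hθ]
  filter_upwards [eventually_one_sub_mul_pos 1,
    eventually_one_sub_mul_pos ((θ / α - 1 / 2) / (1 / 2 + θ / α))] with ζ h1 hq
  have hden : (1 / 2) * (1 + ζ) + (θ / α) * (1 - ζ)
      = (1 / 2 + θ / α) * (1 - (θ / α - 1 / 2) / (1 / 2 + θ / α) * ζ) := by
    linear_combination ζ * mul_div_cancel₀ (θ / α - 1 / 2) hA.ne'
  rw [one_mul] at h1
  rw [omega, hden, one_mul, Real.div_rpow h1.le (by positivity), Real.mul_rpow hA.le hq.le,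
    Real.rpow_neg hA.le, Real.rpow_neg hq.le]
  field_simp

theorem weight_eq_coeff {α θ : ℝ} (hα : 0 < α) (hθ : α / 2 ≤ θ) (n : ℕ) :
    weight α θ n = coeff n (omegaSer α θ) := by
  rw [weight, (omega_eventuallyEq hα hθ).iteratedDeriv_eq, iteratedDeriv_const_mul_field,
    iteratedDeriv_mul_eq_factorial_mul_coeff_mul n (contDiffAt_one_sub_mul_rpow 1 α n)
      (contDiffAt_one_sub_mul_rpow _ (-α) n) (iteratedDeriv_one_sub_mul_rpow 1 · α)
      (iteratedDeriv_one_sub_mul_rpow _ · (-α)), omegaSer, coeff_smul, smul_eq_mul]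
  field_simp

/-! ### Positivity of the discrete fractional derivative -/

theorem measurable_betaPDF (u v : ℝ) : Measurable (betaPDF u v) :=
  (measurable_betaPDFReal u v).ennreal_ofReal

theorem ae_betaMeasure_mem_Ioo (u v : ℝ) :
    ∀ᵐ y ∂betaMeasure u v, y ∈ Ioo (0 : ℝ) 1 := by
  rw [betaMeasure, ae_withDensity_iff (measurable_betaPDF u v)]
  refine Filter.Eventually.of_forall fun y hy => ?_
  by_contra h
  rcases not_and_or.1 h with h | h
  · exact hy (betaPDF_eq_zero_of_nonpos (not_lt.1 h))
  · exact hy (betaPDF_eq_zero_of_one_le (not_lt.1 h))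

theorem integral_betaMeasure {u v : ℝ} (hu : 0 < u) (hv : 0 < v) (g : ℝ → ℝ) :
    ∫ y, g y ∂betaMeasure u v = ∫ y, betaPDFReal u v y * g y := by
  have hnonneg : ∀ y, 0 ≤ betaPDFReal u v y := by
    intro y
    by_cases h : 0 < y ∧ y < 1
    · exact (betaPDFReal_pos h.1 h.2 hu hv).le
    · rw [betaPDFReal, if_neg h]
  rw [betaMeasure, integral_withDensity_eq_integral_toReal_smul
    (measurable_betaPDF u v) (Filter.Eventually.of_forall fun _ => ENNReal.ofReal_lt_top)]
  simp only [betaPDF, ENNReal.toReal_ofReal (hnonneg _), smul_eq_mul]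

theorem integral_pow_mul_one_sub_pow_betaMeasure {u v : ℝ} (hu : 0 < u) (hv : 0 < v) (i j : ℕ) :
    ∫ y, y ^ i * (1 - y) ^ j ∂betaMeasure u v
      = beta (i + u) (j + v) / beta u v := by
  have hiu : 0 < i + u := by positivity
  have hjv : 0 < j + v := by positivity
  have hdensity : ∀ y, betaPDFReal u v y * (y ^ i * (1 - y) ^ j)
      = beta (i + u) (j + v) / beta u v
        * (betaPDFReal (i + u) (j + v) y * 1) := by
    intro y
    have hβ := (beta_pos hiu hjv).ne'
    simp only [betaPDFReal]
    split_ifs with hy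
    · rw [add_sub_assoc, add_sub_assoc, Real.rpow_add hy.1, Real.rpow_add (sub_pos.2 hy.2),
        Real.rpow_natCast, Real.rpow_natCast]
      field_simp
    · ring
  have := isProbabilityMeasureBeta hiu hjv
  rw [integral_betaMeasure hu hv]
  simp only [hdensity]
  rw [integral_const_mul, ← integral_betaMeasure hiu hjv]
  simp

theorem integrable_betaMeasure {u v : ℝ} (hu : 0 < u) (hv : 0 < v) {g : ℝ → ℝ}
    (hg : Continuous g) : Integrable g (betaMeasure u v) := by
  have := isProbabilityMeasureBeta hu hv
  obtain ⟨C, hC⟩ := (isCompact_Icc (a := (0 : ℝ)) (b := 1)).exists_bound_of_continuousOn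
    hg.continuousOn
  refine Integrable.of_bound hg.aestronglyMeasurable C ?_
  filter_upwards [ae_betaMeasure_mem_Ioo u v] with y hy
  exact hC y (Ioo_subset_Icc_self hy)

theorem coeff_binSer_neg_eq_Gamma {r : ℝ} (hr : 0 < r) (x : ℝ) (n : ℕ) :
    coeff n (binSer (-r) x) = x ^ n * (Real.Gamma (n + r) / (Real.Gamma r * n.factorial)) := by
  have hΓ : Real.Gamma r ≠ 0 := (Real.Gamma_pos_of_pos hr).ne'
  induction n with
  | zero => simp [coeff_binSer_zero, hΓ]
  | succ n ih =>
    have h : Real.Gamma ((n : ℝ) + r + 1) = (n + r) * Real.Gamma (n + r) :=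
      Real.Gamma_add_one (by positivity)
    rw [coeff_binSer_succ, ih, Nat.factorial_succ, Nat.cast_add_one, add_right_comm, h, pow_succ]
    push_cast
    field_simp
    ring

theorem coeff_binSer_mul_binSer_eq_integral {α : ℝ} (h0 : 0 < α) (h1 : α < 1) (q : ℝ) (n : ℕ) :
    coeff n (binSer (α - 1) 1 * binSer (-α) q)
      = ∫ y, (y + (1 - y) * q) ^ n ∂betaMeasure (1 - α) α := by
  have h1' : 0 < 1 - α := by linarith
  have hexpand : ∀ y : ℝ, (y + (1 - y) * q) ^ n = ∑ i ∈ Finset.range (n + 1),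
      n.choose i * q ^ (n - i) * (y ^ i * (1 - y) ^ (n - i)) := by
    intro y
    rw [add_pow]
    exact Finset.sum_congr rfl fun i _ => by rw [mul_pow]; ring
  simp only [hexpand]
  rw [integral_finsetSum _ fun i _ => integrable_betaMeasure h1' h0 (by fun_prop), coeff_mul,
    Finset.Nat.sum_antidiagonal_eq_sum_range_succ_mk]
  refine Finset.sum_congr rfl fun i hi => ?_
  have hi' : i ≤ n := Finset.mem_range_succ_iff.1 hi
  have hsum : (i : ℝ) + (1 - α) + ((n - i : ℕ) + α) = n + 1 := by
    rw [Nat.cast_sub hi']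
    ring
  have hΓ1 := (Real.Gamma_pos_of_pos h1').ne'
  have hΓ2 := (Real.Gamma_pos_of_pos h0).ne'
  have hchoose : (n.choose i : ℝ) ≠ 0 := Nat.cast_ne_zero.2 (Nat.choose_pos hi').ne'
  rw [integral_const_mul, integral_pow_mul_one_sub_pow_betaMeasure h1' h0, beta,
    beta, hsum, Real.Gamma_nat_eq_factorial, ← neg_sub 1 α,
    coeff_binSer_neg_eq_Gamma h1', coeff_binSer_neg_eq_Gamma h0, sub_add_cancel, Real.Gamma_one,
    ← Nat.choose_mul_factorial_mul_factorial hi', one_pow]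
  push_cast
  field_simp

section

variable {F : Type*} [NormedAddCommGroup F] [InnerProductSpace ℝ F]

theorem norm_sq_div_two_le_sum_inner {x : ℝ} (h0 : 0 ≤ x) (h1 : x ≤ 1) {S v : ℕ → F}
    (hS0 : S 0 = v 0) (hS : ∀ n, S (n + 1) = x • S n + v (n + 1)) (n : ℕ) :
    ‖S n‖ ^ 2 / 2 ≤ ∑ m ∈ Finset.range (n + 1), ⟪S m, v m⟫ := by
  induction n with
  | zero =>
    simp only [zero_add, Finset.range_one, Finset.sum_singleton, ← hS0, real_inner_self_eq_norm_sq]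
    linarith [sq_nonneg ‖S 0‖]
  | succ n ih =>
    rw [Finset.sum_range_succ, ← sub_eq_of_eq_add' (hS n), inner_sub_right,
      real_inner_smul_right, real_inner_self_eq_norm_sq]
    have hx : x * ⟪S (n + 1), S n⟫ ≤ ‖S (n + 1)‖ ^ 2 / 2 + ‖S n‖ ^ 2 / 2 := by
      calc x * ⟪S (n + 1), S n⟫ ≤ x * (‖S (n + 1)‖ * ‖S n‖) := by
            gcongr
            exact real_inner_le_norm _ _
        _ ≤ 1 * (‖S (n + 1)‖ * ‖S n‖) := by gcongr
        _ ≤ _ := by nlinarith [sq_nonneg (‖S (n + 1)‖ - ‖S n‖)]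
    linarith

theorem sum_pow_inner_nonneg {x : ℝ} (h0 : 0 ≤ x) (h1 : x ≤ 1) (v : ℕ → F) (N : ℕ) :
    0 ≤ ∑ n ∈ Finset.range N, ∑ k ∈ Finset.range (n + 1), x ^ (n - k) * ⟪v k, v n⟫ := by
  set S : ℕ → F := fun n => ∑ k ∈ Finset.range (n + 1), x ^ (n - k) • v k with hS
  have hstep : ∀ n, S (n + 1) = x • S n + v (n + 1) := by
    intro n
    simp only [hS, Finset.sum_range_succ _ (n + 1), Finset.smul_sum, Nat.sub_self, pow_zero,
      one_smul]
    congr 1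
    refine Finset.sum_congr rfl fun k hk => ?_
    rw [smul_smul, ← pow_succ', Nat.sub_add_comm (Finset.mem_range_succ_iff.1 hk)]
  have hinner : ∀ n, ∑ k ∈ Finset.range (n + 1), x ^ (n - k) * ⟪v k, v n⟫ = ⟪S n, v n⟫ := by
    intro n
    simp only [hS, sum_inner, real_inner_smul_left]
  simp only [hinner]
  cases N with
  | zero => simp
  | succ n =>
    have hsq : 0 ≤ ‖S n‖ ^ 2 / 2 := by positivity
    exact hsq.trans (norm_sq_div_two_le_sum_inner h0 h1 (by simp [hS]) hstep n)

theorem sum_coeff_binSer_mul_binSer_inner_nonneg {α q : ℝ} (h0 : 0 < α) (h1 : α < 1)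
    (hq0 : 0 ≤ q) (hq1 : q ≤ 1) (v : ℕ → F) (N : ℕ) :
    0 ≤ ∑ n ∈ Finset.range N, ∑ k ∈ Finset.range (n + 1),
      coeff (n - k) (binSer (α - 1) 1 * binSer (-α) q) * ⟪v k, v n⟫ := by
  have h1' : 0 < 1 - α := by linarith
  have hintegral : ∑ n ∈ Finset.range N, ∑ k ∈ Finset.range (n + 1),
      coeff (n - k) (binSer (α - 1) 1 * binSer (-α) q) * ⟪v k, v n⟫
      = ∫ y, ∑ n ∈ Finset.range N, ∑ k ∈ Finset.range (n + 1),
        (y + (1 - y) * q) ^ (n - k) * ⟪v k, v n⟫ ∂betaMeasure (1 - α) α := by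
    rw [integral_finsetSum _ fun n _ => integrable_betaMeasure h1' h0 (by fun_prop)]
    refine Finset.sum_congr rfl fun n _ => ?_
    rw [integral_finsetSum _ fun k _ => integrable_betaMeasure h1' h0 (by fun_prop)]
    exact Finset.sum_congr rfl fun k _ => by
      rw [integral_mul_const, coeff_binSer_mul_binSer_eq_integral h0 h1]
  rw [hintegral]
  refine integral_nonneg_of_ae ?_
  filter_upwards [ae_betaMeasure_mem_Ioo (1 - α) α] with y hy
  have hy1 : 0 ≤ 1 - y := by linarith [hy.2]
  exact sum_pow_inner_nonneg (add_nonneg hy.1.le (mul_nonneg hy1 hq0)) (by nlinarith) v N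

end

/-- The power series `ω / (1 - X)`, whose coefficients are the weights of the increments of `u`
in `fracDq α θ τ u`. -/
def incrSer (α θ : ℝ) : ℝ⟦X⟧ :=
  ((1 / 2 + θ / α) ^ (-α)) •
    (binSer (α - 1) 1 * binSer (-α) ((θ / α - 1 / 2) / (1 / 2 + θ / α)))

theorem one_sub_X_mul_incrSer (α θ : ℝ) : (1 - X) * incrSer α θ = omegaSer α θ := by
  rw [incrSer, omegaSer, mul_smul_comm, ← mul_assoc, one_sub_X_mul_binSer, sub_add_cancel]

section

variable {F : Type*} [AddCommGroup F] [Module ℝ F]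

theorem sum_Icc_one_smul_sub_zero (w : ℕ → ℝ) (u : ℕ → F) (n : ℕ) :
    ∑ k ∈ Finset.Icc 1 n, w (n - k) • (u k - u 0)
      = ∑ k ∈ Finset.range (n + 1), w (n - k) • (u k - u 0) := by
  refine Finset.sum_subset (fun k hk => ?_) fun k hk hk' => ?_
  · rw [Finset.mem_Icc] at hk
    exact Finset.mem_range_succ_iff.2 hk.2
  · rw [Finset.mem_range_succ_iff] at hk
    obtain rfl : k = 0 := by simpa [hk] using hk'
    rw [sub_self, smul_zero]

theorem sum_coeff_one_sub_X_mul_smul (G : ℝ⟦X⟧) (u : ℕ → F) (n : ℕ) :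
    ∑ k ∈ Finset.range (n + 1), coeff (n - k) ((1 - X) * G) • (u k - u 0)
      = ∑ k ∈ Finset.range (n + 1), coeff (n - k) G • (u k - u (k - 1)) := by
  cases n with
  | zero => simp
  | succ n =>
    have hshift : ∑ k ∈ Finset.range (n + 1), coeff (n - k) G • (u k - u 0)
        = ∑ k ∈ Finset.range (n + 2), coeff (n + 1 - k) G • (u (k - 1) - u 0) := by
      rw [Finset.sum_range_succ' _ (n + 1)]
      simp
    have hparts : ∑ k ∈ Finset.range (n + 2), coeff (n + 1 - k) G • (u k - u (k - 1))
        = ∑ k ∈ Finset.range (n + 2), coeff (n + 1 - k) G • (u k - u 0)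
          - ∑ k ∈ Finset.range (n + 1), coeff (n - k) G • (u k - u 0) := by
      rw [hshift, ← Finset.sum_sub_distrib]
      exact Finset.sum_congr rfl fun k _ => by rw [← smul_sub, sub_sub_sub_cancel_right]
    rw [hparts, Finset.sum_range_succ, Finset.sum_range_succ _ (n + 1), Nat.sub_self,
      coeff_one_sub_X_mul_zero, add_sub_right_comm, ← Finset.sum_sub_distrib]
    congr 1
    refine Finset.sum_congr rfl fun k hk => ?_
    rw [Nat.sub_add_comm (Finset.mem_range_succ_iff.1 hk), coeff_one_sub_X_mul_succ, sub_smul]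

theorem fracDq_eq_sum_coeff_omegaSer {α θ : ℝ} (hα : 0 < α) (hθ : α / 2 ≤ θ) (τ : ℝ)
    (u : ℕ → F) (n : ℕ) :
    fracDq α θ τ u n = τ ^ (-α) • ∑ k ∈ Finset.range (n + 1),
      coeff (n - k) (omegaSer α θ) • (u k - u 0) := by
  rw [fracDq, sum_Icc_one_smul_sub_zero]
  simp only [weight_eq_coeff hα hθ]

theorem fracDq_eq_sum_coeff_incrSer {α θ : ℝ} (hα : 0 < α) (hθ : α / 2 ≤ θ) (τ : ℝ)
    (u : ℕ → F) (n : ℕ) :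
    fracDq α θ τ u n = τ ^ (-α) • ∑ k ∈ Finset.range (n + 1),
      coeff (n - k) (incrSer α θ) • (u k - u (k - 1)) := by
  rw [fracDq_eq_sum_coeff_omegaSer hα hθ, ← one_sub_X_mul_incrSer, sum_coeff_one_sub_X_mul_smul]

end

theorem sum_fracDq_inner_nonneg {F : Type*} [NormedAddCommGroup F] [InnerProductSpace ℝ F]
    {α θ τ : ℝ} (h0 : 0 < α) (h1 : α < 1) (hθ : α / 2 ≤ θ) (hτ : 0 ≤ τ) (u : ℕ → F) (N : ℕ) :
    0 ≤ ∑ n ∈ Finset.range N, ⟪fracDq α θ τ u n, u n - u (n - 1)⟫ := by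
  have hθα : 1 / 2 ≤ θ / α := one_half_le_div h0 hθ
  have hA : 0 < 1 / 2 + θ / α := by linarith
  have h := sum_coeff_binSer_mul_binSer_inner_nonneg (q := (θ / α - 1 / 2) / (1 / 2 + θ / α))
    h0 h1 (div_nonneg (by linarith) hA.le) (by rw [div_le_one hA]; linarith)
    (fun k => u k - u (k - 1)) N
  refine (mul_nonneg (mul_nonneg (Real.rpow_nonneg hτ (-α)) (Real.rpow_nonneg hA.le (-α)))
    h).trans_eq ?_
  simp only [fracDq_eq_sum_coeff_incrSer h0 hθ, incrSer, coeff_smul, smul_eq_mul,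
    real_inner_smul_left, sum_inner, Finset.mul_sum, mul_assoc]

/-! ### Asymptotics of the coefficients of `(1 - X) ^ (α - 1)` -/

theorem coeff_succ_binSer_sub_one (α : ℝ) (k : ℕ) :
    coeff (k + 1) (binSer (α - 1) 1) = (1 - α / (k + 1)) * coeff k (binSer (α - 1) 1) := by
  rw [coeff_binSer_succ]
  have : (k : ℝ) + 1 ≠ 0 := by positivity
  field_simp
  ring

theorem prod_range_add_eq_coeff_binSer_mul_factorial (α : ℝ) (n : ℕ) :
    ∏ j ∈ Finset.range n, ((1 - α) + j) = coeff n (binSer (α - 1) 1) * n.factorial := by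
  induction n with
  | zero => simp [coeff_binSer_zero]
  | succ n ih =>
    rw [Finset.prod_range_succ, ih, coeff_succ_binSer_sub_one, Nat.factorial_succ]
    have : (n : ℝ) + 1 ≠ 0 := by positivity
    push_cast
    field_simp
    ring

theorem tendsto_coeff_binSer_mul_rpow {α : ℝ} (h1 : α < 1) :
    Filter.Tendsto (fun k : ℕ => coeff k (binSer (α - 1) 1) * (k : ℝ) ^ α) Filter.atTop
      (nhds (Real.Gamma (1 - α))⁻¹) := by
  have hs : 0 < 1 - α := by linarith
  have hseq := (Real.GammaSeq_tendsto_Gamma (1 - α)).inv₀ (Real.Gamma_pos_of_pos hs).ne'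
  have hone : Filter.Tendsto (fun n : ℕ => ((1 - α) * (n : ℝ)⁻¹ + 1)⁻¹) Filter.atTop
      (nhds 1) := by
    have := ((tendsto_inv_atTop_nhds_zero_nat (𝕜 := ℝ)).const_mul (1 - α)).add_const 1
    simpa using this.inv₀ (by simp)
  refine (mul_one (Real.Gamma (1 - α))⁻¹ ▸ hseq.mul hone).congr' ?_
  filter_upwards [Filter.eventually_gt_atTop 0] with n hn
  have hn' : (0 : ℝ) < n := by exact_mod_cast hn
  have hc := (coeff_binSer_pos (show α - 1 < 0 by linarith) n).ne'
  rw [Real.GammaSeq, Finset.prod_range_succ, prod_range_add_eq_coeff_binSer_mul_factorial,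
    Real.rpow_sub hn', Real.rpow_one]
  have : (n : ℝ) ^ α ≠ 0 := (Real.rpow_pos_of_pos hn' α).ne'
  have : (1 - α) + (n : ℝ) ≠ 0 := by positivity
  have : (1 - α) * (n : ℝ)⁻¹ + 1 ≠ 0 := by positivity
  field_simp

theorem one_sub_rpow_sub_sum_isBigO (β : ℝ) (n : ℕ) :
    (fun x : ℝ => (1 - x) ^ β - ∑ i ∈ Finset.range n, coeff i (binSer β 1) * x ^ i)
      =O[nhds 0] fun x => x ^ n := by
  have h := (Real.one_add_rpow_hasFPowerSeriesAt_zero (a := β)).isBigO_sub_partialSum_pow n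
  have hneg : Filter.Tendsto (fun x : ℝ => -x) (nhds 0) (nhds 0) := by
    simpa using (continuous_neg (G := ℝ)).tendsto 0
  refine ((h.comp_tendsto hneg).congr_left fun x => ?_).trans
    (Asymptotics.isBigO_of_le _ fun x => by simp)
  simp only [Function.comp_apply, zero_add, FormalMultilinearSeries.partialSum,
    binomialSeries_apply, List.ofFn_const, List.prod_replicate, smul_eq_mul, sub_eq_add_neg,
    coeff_binSer]
  congr 2
  refine Finset.sum_congr rfl fun i _ => ?_
  rw [neg_pow x, mul_comm (Ring.choose β i), mul_right_comm]

/-- The second-order coefficient of the expansion of `k ^ (-α) / (Γ(1 - α) c k)` in powers of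
`1 / k`, where `c k` is the `k`-th coefficient of `(1 - X) ^ (α - 1)`. The first-order coefficient
is `α (1 - α) / 2`. -/
def gammaRatioCoeff (α : ℝ) : ℝ := α * (1 - α) * (2 - α) * (3 * α - 1) / 24

-- The two coefficients are chosen so that the terms of order below four cancel.
theorem gammaRatio_step_isBigO (α : ℝ) :
    (fun x : ℝ => (1 + α * (1 - α) / 2 * x + gammaRatioCoeff α * x ^ 2) * (1 - α * x)
      - ((1 - x) ^ α + α * (1 - α) / 2 * x * (1 - x) ^ (α - 1)
        + gammaRatioCoeff α * x ^ 2 * (1 - x) ^ (α - 2))) =O[nhds 0] fun x => x ^ 4 := by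
  have h4 := one_sub_rpow_sub_sum_isBigO α 4
  have h3 := (Asymptotics.isBigO_refl (fun x : ℝ => x) (nhds 0)).mul
    (one_sub_rpow_sub_sum_isBigO (α - 1) 3)
  have h2 := (Asymptotics.isBigO_refl (fun x : ℝ => x ^ 2) (nhds 0)).mul
    (one_sub_rpow_sub_sum_isBigO (α - 2) 2)
  have h3' := (h3.congr_right fun x => (pow_succ' x 3).symm).const_mul_left (α * (1 - α) / 2)
  have h2' := (h2.congr_right fun x => show x ^ 2 * x ^ 2 = x ^ 4 by ring).const_mul_left
    (gammaRatioCoeff α)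
  refine ((h4.add h3').add h2').neg_left.congr_left fun x => ?_
  simp only [Finset.sum_range_succ, Finset.sum_range_zero, coeff_binSer_succ, coeff_binSer_zero,
    gammaRatioCoeff]
  push_cast
  ring

theorem eventually_abs_le_of_abs_sub_succ_le {u g : ℕ → ℝ}
    (hu : Filter.Tendsto u Filter.atTop (nhds 0)) (hg : Filter.Tendsto g Filter.atTop (nhds 0))
    (h : ∀ᶠ k in Filter.atTop, |u (k + 1) - u k| ≤ g k - g (k + 1)) :
    ∀ᶠ k in Filter.atTop, |u k| ≤ g k := by
  obtain ⟨K, hK⟩ := Filter.eventually_atTop.1 h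
  have hanti : Antitone fun j => u (j + K) + g (j + K) := antitone_nat_of_succ_le fun j => by
    have := (abs_le.1 (hK (j + K) (by omega))).2
    rw [add_right_comm j 1 K]
    linarith
  have hmono : Monotone fun j => u (j + K) - g (j + K) := monotone_nat_of_le_succ fun j => by
    have := (abs_le.1 (hK (j + K) (by omega))).1
    rw [add_right_comm j 1 K]
    linarith
  have hlim := Filter.tendsto_add_atTop_nat K
  refine Filter.eventually_atTop.2 ⟨K, fun k hk => ?_⟩
  obtain ⟨j, rfl⟩ := Nat.exists_eq_add_of_le' hk
  have hlow := hanti.le_of_tendsto ((add_zero (0 : ℝ) ▸ hu.add hg).comp hlim) j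
  have hup := hmono.ge_of_tendsto ((sub_zero (0 : ℝ) ▸ hu.sub hg).comp hlim) j
  exact abs_le.2 ⟨by linarith, by linarith⟩

theorem tendsto_gamma_mul_coeff_binSer_mul_rpow {α : ℝ} (h1 : α < 1) :
    Filter.Tendsto
      (fun k : ℕ => Real.Gamma (1 - α) * coeff k (binSer (α - 1) 1) * (k : ℝ) ^ α)
      Filter.atTop (nhds 1) := by
  have hΓ : Real.Gamma (1 - α) ≠ 0 := (Real.Gamma_pos_of_pos (by linarith)).ne'
  have := (tendsto_coeff_binSer_mul_rpow h1).const_mul (Real.Gamma (1 - α))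
  rw [mul_inv_cancel₀ hΓ] at this
  exact this.congr fun k => (mul_assoc _ _ _).symm

/-- The truncated expansion of `k ^ (-α) / (Γ(1 - α) c k)` in powers of `1 / k`, where `c k` is the
`k`-th coefficient of `(1 - X) ^ (α - 1)`. -/
def gammaRatioApprox (α : ℝ) (k : ℕ) : ℝ :=
  1 + α * (1 - α) / 2 * (k : ℝ)⁻¹ + gammaRatioCoeff α * (k : ℝ)⁻¹ ^ 2

theorem tendsto_gammaRatioApprox (α : ℝ) :
    Filter.Tendsto (gammaRatioApprox α) Filter.atTop (nhds 1) := by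
  have hi := tendsto_inv_atTop_nhds_zero_nat (𝕜 := ℝ)
  unfold gammaRatioApprox
  simpa using ((hi.const_mul (α * (1 - α) / 2)).const_add 1).add
    ((hi.pow 2).const_mul (gammaRatioCoeff α))

theorem coeff_binSer_mul_rpow_mul_gammaRatioApprox_sub (α : ℝ) {k : ℕ} (hk : 1 ≤ k) :
    coeff (k + 1) (binSer (α - 1) 1) * ((k + 1 : ℕ) : ℝ) ^ α * gammaRatioApprox α (k + 1)
        - coeff k (binSer (α - 1) 1) * (k : ℝ) ^ α * gammaRatioApprox α k
      = coeff k (binSer (α - 1) 1) * ((k : ℝ) + 1) ^ α *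
        ((1 + α * (1 - α) / 2 * ((k : ℝ) + 1)⁻¹ + gammaRatioCoeff α * ((k : ℝ) + 1)⁻¹ ^ 2)
            * (1 - α * ((k : ℝ) + 1)⁻¹)
          - ((1 - ((k : ℝ) + 1)⁻¹) ^ α
            + α * (1 - α) / 2 * ((k : ℝ) + 1)⁻¹ * (1 - ((k : ℝ) + 1)⁻¹) ^ (α - 1)
            + gammaRatioCoeff α * ((k : ℝ) + 1)⁻¹ ^ 2 * (1 - ((k : ℝ) + 1)⁻¹) ^ (α - 2))) := by
  have hk0 : (0 : ℝ) < k := by exact_mod_cast hk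
  have hk1 : (0 : ℝ) < (k : ℝ) + 1 := by positivity
  have hx : 1 - ((k : ℝ) + 1)⁻¹ = k / (k + 1) := by field_simp; ring
  have hpow : ((k : ℝ) + 1) ^ α ≠ 0 := (Real.rpow_pos_of_pos hk1 α).ne'
  rw [hx, Real.rpow_sub (by positivity), Real.rpow_sub (by positivity), Real.rpow_one,
    Real.rpow_two, Real.div_rpow hk0.le hk1.le, coeff_succ_binSer_sub_one, gammaRatioApprox,
    gammaRatioApprox]
  push_cast
  field_simp

theorem natCast_add_one_rpow_isBigO {α : ℝ} (h0 : 0 ≤ α) :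
    (fun k : ℕ => ((k : ℝ) + 1) ^ α) =O[Filter.atTop] fun k => (k : ℝ) ^ α := by
  refine Asymptotics.IsBigO.of_bound (2 ^ α) (Filter.eventually_atTop.2 ⟨1, fun k hk => ?_⟩)
  have hk' : (1 : ℝ) ≤ k := by exact_mod_cast hk
  rw [Real.norm_of_nonneg (by positivity), Real.norm_of_nonneg (by positivity),
    ← Real.mul_rpow (by norm_num) (by positivity)]
  exact Real.rpow_le_rpow (by positivity) (by linarith) h0

theorem inv_add_one_pow_four_le {x : ℝ} (hx : 0 < x) :
    (x + 1)⁻¹ ^ 4 ≤ x⁻¹ ^ 3 - (x + 1)⁻¹ ^ 3 := by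
  have h : x⁻¹ ^ 3 - (x + 1)⁻¹ ^ 3 - (x + 1)⁻¹ ^ 4
      = (2 * x ^ 3 + 6 * x ^ 2 + 4 * x + 1) / (x ^ 3 * (x + 1) ^ 4) := by
    field_simp
    ring
  have : 0 ≤ (2 * x ^ 3 + 6 * x ^ 2 + 4 * x + 1) / (x ^ 3 * (x + 1) ^ 4) := by positivity
  linarith

theorem gamma_mul_coeff_binSer_mul_rpow_mul_sub_one_isBigO {α : ℝ} (h0 : 0 ≤ α) (h1 : α < 1) :
    (fun k : ℕ => Real.Gamma (1 - α) * coeff k (binSer (α - 1) 1) * (k : ℝ) ^ α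
      * gammaRatioApprox α k - 1) =O[Filter.atTop] fun k => (k : ℝ)⁻¹ ^ 3 := by
  have hi := tendsto_inv_atTop_nhds_zero_nat (𝕜 := ℝ)
  have hlim : Filter.Tendsto (fun k : ℕ => Real.Gamma (1 - α) * coeff k (binSer (α - 1) 1)
      * (k : ℝ) ^ α * gammaRatioApprox α k - 1) Filter.atTop (nhds 0) := by
    simpa using ((tendsto_gamma_mul_coeff_binSer_mul_rpow h1).mul
      (tendsto_gammaRatioApprox α)).sub_const 1
  have hx : Filter.Tendsto (fun k : ℕ => ((k : ℝ) + 1)⁻¹) Filter.atTop (nhds 0) := by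
    simpa using (Filter.tendsto_add_atTop_iff_nat 1).2 hi
  have hbdd : (fun k : ℕ => coeff k (binSer (α - 1) 1) * ((k : ℝ) + 1) ^ α)
      =O[Filter.atTop] fun _ => (1 : ℝ) :=
    ((Asymptotics.isBigO_refl _ _).mul (natCast_add_one_rpow_isBigO h0)).trans
      ((tendsto_coeff_binSer_mul_rpow h1).isBigO_one ℝ)
  obtain ⟨C, hC0, hC⟩ := ((hbdd.mul ((gammaRatio_step_isBigO α).comp_tendsto hx)).const_mul_left
    (Real.Gamma (1 - α))).exists_nonneg
  refine Asymptotics.IsBigO.of_bound C ?_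
  have hg : Filter.Tendsto (fun k : ℕ => C * (k : ℝ)⁻¹ ^ 3) Filter.atTop (nhds 0) := by
    simpa using (hi.pow 3).const_mul C
  refine (eventually_abs_le_of_abs_sub_succ_le hlim hg ?_).mono fun k hk => ?_
  · filter_upwards [hC.bound, Filter.eventually_ge_atTop 1] with k hk hk1
    have hk0 : (0 : ℝ) < k := by exact_mod_cast hk1
    rw [Function.comp_apply, ← coeff_binSer_mul_rpow_mul_gammaRatioApprox_sub α hk1, one_mul,
      Function.comp_apply, Real.norm_eq_abs,
      Real.norm_of_nonneg (r := ((k : ℝ) + 1)⁻¹ ^ 4) (by positivity)] at hk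
    rw [← mul_sub]
    push_cast at hk ⊢
    refine le_trans (le_of_eq ?_) (hk.trans
      (mul_le_mul_of_nonneg_left (inv_add_one_pow_four_le hk0) hC0))
    congr 1
    ring
  · rwa [Real.norm_eq_abs, Real.norm_of_nonneg (by positivity)]

theorem coeff_binSer_sub_one_isBigO {α : ℝ} (h1 : α < 1) :
    (fun k : ℕ => coeff k (binSer (α - 1) 1)) =O[Filter.atTop] fun k => (k : ℝ) ^ (-α) := by
  refine ((((tendsto_coeff_binSer_mul_rpow h1).isBigO_one ℝ).mul (Asymptotics.isBigO_refl
    (fun k : ℕ => (k : ℝ) ^ (-α)) _)).congr' ?_ (.of_forall fun k => one_mul _))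
  filter_upwards [Filter.eventually_gt_atTop 0] with k hk
  rw [mul_assoc, ← Real.rpow_add (by exact_mod_cast hk), add_neg_cancel, Real.rpow_zero, mul_one]

theorem rpow_neg_sub_gamma_mul_isBigO {α : ℝ} (h0 : 0 ≤ α) (h1 : α < 1) :
    (fun k : ℕ => (k : ℝ) ^ (-α)
        - Real.Gamma (1 - α) * coeff k (binSer (α - 1) 1) * gammaRatioApprox α k)
      =O[Filter.atTop] fun k => (k : ℝ) ^ (-α) * (k : ℝ)⁻¹ ^ 3 := by
  refine ((Asymptotics.isBigO_refl (fun k : ℕ => (k : ℝ) ^ (-α)) _).mul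
    (gamma_mul_coeff_binSer_mul_rpow_mul_sub_one_isBigO h0 h1).neg_left).congr' ?_ .rfl
  filter_upwards [Filter.eventually_gt_atTop 0] with k hk
  have h : (k : ℝ) ^ (-α) * (k : ℝ) ^ α = 1 := by
    rw [← Real.rpow_add (by exact_mod_cast hk), neg_add_cancel, Real.rpow_zero]
  linear_combination -(Real.Gamma (1 - α) * coeff k (binSer (α - 1) 1) * gammaRatioApprox α k) * h

section Shift

variable {S : Set ℝ} (hS : IsCompact S)

include hS

theorem isBigO_one_of_continuous {g : ℝ × ℝ → ℝ} (hg : Continuous g) :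
    (fun p : ℕ × ℝ => g (p.2, (p.1 : ℝ)⁻¹)) =O[Filter.atTop ×ˢ Filter.principal S]
      fun _ => (1 : ℝ) := by
  obtain ⟨C, hC⟩ := (hS.prod (isCompact_Icc (a := (0 : ℝ)) (b := 1))).exists_bound_of_continuousOn
    hg.continuousOn
  refine Asymptotics.IsBigO.of_bound C (Filter.eventually_prod_principal_iff.2
    (.of_forall fun k φ hφ => ?_))
  rw [norm_one, mul_one]
  exact hC _ ⟨hφ, by positivity, Nat.cast_inv_le_one k⟩

theorem one_sub_mul_rpow_isBigO (β : ℝ) :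
    (fun p : ℕ × ℝ => (1 - p.2 * (p.1 : ℝ)⁻¹) ^ β
        - (1 - β * p.2 * (p.1 : ℝ)⁻¹ + β * (β - 1) / 2 * p.2 ^ 2 * (p.1 : ℝ)⁻¹ ^ 2))
      =O[Filter.atTop ×ˢ Filter.principal S] fun p => (p.1 : ℝ)⁻¹ ^ 3 := by
  have hφ : (fun p : ℕ × ℝ => p.2) =O[Filter.atTop ×ˢ Filter.principal S] fun _ => (1 : ℝ) :=
    isBigO_one_of_continuous hS continuous_fst
  have hφk : (fun p : ℕ × ℝ => p.2 * (p.1 : ℝ)⁻¹) =O[Filter.atTop ×ˢ Filter.principal S]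
      fun p => (p.1 : ℝ)⁻¹ :=
    (hφ.mul (Asymptotics.isBigO_refl _ _)).congr_right fun p => one_mul _
  have hlim := hφk.trans_tendsto
    ((tendsto_inv_atTop_nhds_zero_nat (𝕜 := ℝ)).comp Filter.tendsto_fst)
  refine (((one_sub_rpow_sub_sum_isBigO β 3).comp_tendsto hlim).trans (hφk.pow 3)).congr_left
    fun p => ?_
  simp only [Function.comp_apply, Finset.sum_range_succ, Finset.sum_range_zero,
    coeff_binSer_succ, coeff_binSer_zero]
  push_cast
  ring

end Shift

theorem max_sub_rpow_eq {k φ : ℝ} (hk : 0 < k) (hφ : φ ≤ k) (α : ℝ) (j : ℕ) :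
    max (k - φ) 0 ^ (j - α) = k ^ j * k ^ (-α) * (1 - φ * k⁻¹) ^ (j - α) := by
  have hfactor : max (k - φ) 0 = k * (1 - φ * k⁻¹) := by
    rw [max_eq_left (by linarith)]
    field_simp
  have hnonneg : 0 ≤ 1 - φ * k⁻¹ := by
    rw [← div_eq_mul_inv, sub_nonneg, div_le_one hk]
    exact hφ
  rw [hfactor, Real.mul_rpow hk.le hnonneg, sub_eq_add_neg, Real.rpow_add hk, Real.rpow_natCast]

/-- The coefficient of `k ^ (-2)` in the product of the expansions of `k ^ (-α) / (Γ(1 - α) c k)`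
and of `(1 - φ / k) ^ β`. -/
def shiftedRatioCoeff (α β φ : ℝ) : ℝ :=
  gammaRatioCoeff α + β * (β - 1) / 2 * φ ^ 2 - α * (1 - α) / 2 * (β * φ)

theorem rpow_neg_mul_one_sub_rpow_isBigO {α : ℝ} (h0 : 0 ≤ α) (h1 : α < 1) {S : Set ℝ}
    (hS : IsCompact S) (β : ℝ) :
    (fun p : ℕ × ℝ => (p.1 : ℝ) ^ (-α) * (1 - p.2 * (p.1 : ℝ)⁻¹) ^ β
      - Real.Gamma (1 - α) * coeff p.1 (binSer (α - 1) 1)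
        * (1 + (α * (1 - α) / 2 - β * p.2) * (p.1 : ℝ)⁻¹
          + shiftedRatioCoeff α β p.2 * (p.1 : ℝ)⁻¹ ^ 2))
      =O[Filter.atTop ×ˢ Filter.principal S] fun p => (p.1 : ℝ) ^ (-α) * (p.1 : ℝ)⁻¹ ^ 3 := by
  have hfst : Filter.Tendsto Prod.fst (Filter.atTop ×ˢ Filter.principal S)
    (Filter.atTop : Filter ℕ) := Filter.tendsto_fst
  have htaylor := (Asymptotics.isBigO_refl (fun p : ℕ × ℝ => (p.1 : ℝ) ^ (-α)) _).mul
    (one_sub_mul_rpow_isBigO hS β)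
  have hratio := ((rpow_neg_sub_gamma_mul_isBigO h0 h1).comp_tendsto hfst).mul
    (isBigO_one_of_continuous hS (g := fun q => 1 - β * q.1 * q.2
      + β * (β - 1) / 2 * q.1 ^ 2 * q.2 ^ 2) (by fun_prop))
  have hrest := (((coeff_binSer_sub_one_isBigO h1).comp_tendsto hfst).mul
    (Asymptotics.isBigO_refl (fun p : ℕ × ℝ => (p.1 : ℝ)⁻¹ ^ 3) _)).mul
    (isBigO_one_of_continuous hS (g := fun q => α * (1 - α) / 2 * (β * (β - 1) / 2 * q.1 ^ 2)
      - gammaRatioCoeff α * (β * q.1)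
      + gammaRatioCoeff α * (β * (β - 1) / 2 * q.1 ^ 2) * q.2) (by fun_prop))
  simp only [mul_one, Function.comp_apply] at hratio hrest
  refine ((htaylor.add hratio).add (hrest.const_mul_left (Real.Gamma (1 - α)))).congr_left
    fun p => ?_
  simp only [gammaRatioApprox, shiftedRatioCoeff]
  ring

theorem max_sub_rpow_div_gamma_isBigO {α : ℝ} (h0 : 0 ≤ α) (h1 : α < 1) {S : Set ℝ}
    (hS : IsCompact S) (j : ℕ) :
    (fun p : ℕ × ℝ => max ((p.1 : ℝ) - p.2) 0 ^ (j - α) / Real.Gamma (1 - α)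
      - coeff p.1 (binSer (α - 1) 1) * (p.1 : ℝ) ^ j
        * (1 + (α * (1 - α) / 2 - (j - α) * p.2) * (p.1 : ℝ)⁻¹
          + shiftedRatioCoeff α (j - α) p.2 * (p.1 : ℝ)⁻¹ ^ 2))
      =O[Filter.atTop ×ˢ Filter.principal S]
        fun p => (p.1 : ℝ) ^ j * ((p.1 : ℝ) ^ (-α) * (p.1 : ℝ)⁻¹ ^ 3) := by
  have hΓ : Real.Gamma (1 - α) ≠ 0 := (Real.Gamma_pos_of_pos (by linarith)).ne'
  obtain ⟨b, hb⟩ := hS.bddAbove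
  refine (((Asymptotics.isBigO_refl (fun p : ℕ × ℝ => (p.1 : ℝ) ^ j) _).mul
    (rpow_neg_mul_one_sub_rpow_isBigO h0 h1 hS (j - α))).const_mul_left
      (Real.Gamma (1 - α))⁻¹).congr' ?_ .rfl
  refine Filter.eventually_prod_principal_iff.2 ?_
  filter_upwards [Filter.eventually_gt_atTop 0, Filter.eventually_ge_atTop ⌈b⌉₊] with k hk hbk φ hφ
  rw [max_sub_rpow_eq (by exact_mod_cast hk) ((hb hφ).trans (Nat.ceil_le.1 hbk))]
  field_simp

theorem exists_sumAbsLE_mk_of_isBigO {S : Set ℝ} (hS : IsCompact S) {f : ℕ → ℝ → ℝ}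
    (hf : ∀ k, ContinuousOn (f k) S) {s : ℝ} (hs : 1 < s)
    (h : (fun p : ℕ × ℝ => f p.1 p.2) =O[Filter.atTop ×ˢ Filter.principal S]
      fun p => (p.1 : ℝ) ^ (-s)) :
    ∃ C, ∀ φ ∈ S, SumAbsLE (mk fun k => f k φ) C := by
  obtain ⟨D, hD⟩ := h.bound
  obtain ⟨K, hK⟩ := Filter.eventually_atTop.1 (Filter.eventually_prod_principal_iff.1 hD)
  choose B hB using fun k => hS.exists_bound_of_continuousOn (hf k)
  have hsum : Summable fun k : ℕ => |D| * ‖(k : ℝ) ^ (-s)‖ :=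
    ((Real.summable_nat_rpow.2 (by linarith)).norm).mul_left _
  have hle (k : ℕ) (φ : ℝ) (hφ : φ ∈ S) :
      |f k φ| ≤ (if k < K then |B k| else 0) + |D| * ‖(k : ℝ) ^ (-s)‖ := by
    split_ifs with hk
    · exact ((hB k φ hφ).trans (le_abs_self _)).trans (le_add_of_nonneg_right (by positivity))
    · rw [zero_add]
      exact (hK k (not_lt.1 hk) φ hφ).trans (by gcongr; exact le_abs_self D)
  have hhead : Summable fun k : ℕ => if k < K then |B k| else 0 :=
    summable_of_ne_finset_zero (s := Finset.range K) fun k hk => if_neg (by simpa using hk)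
  refine ⟨∑' k : ℕ, ((if k < K then |B k| else 0) + |D| * ‖(k : ℝ) ^ (-s)‖), fun φ hφ N => ?_⟩
  simp only [coeff_mk]
  exact (Finset.sum_le_sum fun k _ => hle k φ hφ).trans
    ((hhead.add hsum).sum_le_tsum _ fun k _ => by positivity)

/-! ### Sampled power kernels -/

/-- The truncated power `x₊ ^ γ / Γ(γ + 1)`, the kernel of the fractional integral of order
`γ + 1`. -/
def truncPow (γ x : ℝ) : ℝ := max x 0 ^ γ / Real.Gamma (γ + 1)

theorem gamma_two_sub {α : ℝ} (h1 : α < 1) :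
    Real.Gamma (2 - α) = (1 - α) * Real.Gamma (1 - α) := by
  rw [show 2 - α = (1 - α) + 1 by ring, Real.Gamma_add_one (by linarith)]

theorem gamma_three_sub {α : ℝ} (h1 : α < 1) :
    Real.Gamma (3 - α) = (2 - α) * (1 - α) * Real.Gamma (1 - α) := by
  rw [show 3 - α = (2 - α) + 1 by ring, Real.Gamma_add_one (by linarith), gamma_two_sub h1,
    mul_assoc]

theorem continuous_truncPow_sub {γ : ℝ} (hγ : 0 ≤ γ) (x : ℝ) :
    Continuous fun φ => truncPow γ (x - φ) :=
  (((continuous_const.sub continuous_id).max continuous_const).rpow_const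
    fun _ => Or.inr hγ).div_const _

theorem coeff_binSer_sub_two {α : ℝ} (h1 : α < 1) (k : ℕ) :
    coeff k (binSer (α - 2) 1) = (k + (1 - α)) / (1 - α) * coeff k (binSer (α - 1) 1) := by
  rw [show α - 2 = α - 1 - 1 by ring, coeff_binSer_sub_one (by linarith), neg_sub,
    sub_sub_eq_add_sub, add_sub_assoc]

theorem coeff_binSer_sub_three {α : ℝ} (h1 : α < 1) (k : ℕ) :
    coeff k (binSer (α - 3) 1)
      = (k + (2 - α)) * (k + (1 - α)) / ((2 - α) * (1 - α)) * coeff k (binSer (α - 1) 1) := by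
  rw [show α - 3 = α - 2 - 1 by ring, coeff_binSer_sub_one (by linarith), coeff_binSer_sub_two h1,
    neg_sub, sub_sub_eq_add_sub, add_sub_assoc, mul_div_mul_comm]
  ring

theorem rpow_neg_mul_inv {α k : ℝ} (hk : 0 < k) : k ^ (-α) * k⁻¹ = k ^ (-(1 + α)) := by
  rw [neg_add', sub_eq_add_neg, add_comm, Real.rpow_add hk, ← Real.rpow_neg_one]

/-- The coefficient of `(1 - X) ^ (α - 1)` in the expansion of the sampled quadratic kernel. -/
def quadraticKernelCoeff (α φ : ℝ) : ℝ :=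
  shiftedRatioCoeff α (2 - α) φ / ((2 - α) * (1 - α)) - 1 + ((3 - α) / 2 + φ)

theorem exists_quadratic_kernel_expansion {α : ℝ} (h0 : 0 < α) (h1 : α < 1) {S : Set ℝ}
    (hS : IsCompact S) :
    ∃ C, ∀ φ ∈ S, SumAbsLE (mk (fun k : ℕ => truncPow (2 - α) (k - φ))
      - (binSer (α - 3) 1 - ((3 - α) / 2 + φ) • binSer (α - 2) 1
        + quadraticKernelCoeff α φ • binSer (α - 1) 1)) C := by
  have hα1 : 1 - α ≠ 0 := by linarith
  have hα2 : 2 - α ≠ 0 := by linarith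
  refine (exists_sumAbsLE_mk_of_isBigO hS (f := fun k φ => truncPow (2 - α) (k - φ)
    - (coeff k (binSer (α - 3) 1) - ((3 - α) / 2 + φ) * coeff k (binSer (α - 2) 1)
      + quadraticKernelCoeff α φ * coeff k (binSer (α - 1) 1))) (fun k => ?_)
    (show 1 < 1 + α by linarith) ?_).imp fun C hC φ hφ => ?_
  · have := continuous_truncPow_sub (show 0 ≤ 2 - α by linarith) k
    unfold quadraticKernelCoeff shiftedRatioCoeff
    fun_prop
  · refine ((max_sub_rpow_div_gamma_isBigO h0.le h1 hS 2).const_mul_left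
      ((2 - α) * (1 - α))⁻¹).congr' ?_ ?_ <;>
      refine Filter.eventually_prod_principal_iff.2 ?_ <;>
      filter_upwards [Filter.eventually_gt_atTop 0] with k hk φ _
    · have hk' : (k : ℝ) ≠ 0 := by exact_mod_cast hk.ne'
      rw [truncPow, show 2 - α + 1 = 3 - α by ring, gamma_three_sub h1, coeff_binSer_sub_three h1,
        coeff_binSer_sub_two h1, quadraticKernelCoeff]
      push_cast
      field_simp
      ring
    · rw [← rpow_neg_mul_inv (by exact_mod_cast hk)]
      field_simp
  · convert hC φ hφ using 1
    ext k
    simp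

theorem max_sub_rpow_div_gamma_sub_linear_isBigO {α : ℝ} (h0 : 0 ≤ α) (h1 : α < 1) {S : Set ℝ}
    (hS : IsCompact S) :
    (fun p : ℕ × ℝ => max ((p.1 : ℝ) - p.2) 0 ^ (1 - α) / Real.Gamma (1 - α)
      - coeff p.1 (binSer (α - 1) 1) * ((p.1 : ℝ) + (1 - α) * (α / 2 - p.2)))
      =O[Filter.atTop ×ˢ Filter.principal S] fun p => (p.1 : ℝ) ^ (-(1 + α)) := by
  have hfst : Filter.Tendsto Prod.fst (Filter.atTop ×ˢ Filter.principal S)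
    (Filter.atTop : Filter ℕ) := Filter.tendsto_fst
  have hquad := (((coeff_binSer_sub_one_isBigO h1).comp_tendsto hfst).mul
    (Asymptotics.isBigO_refl (fun p : ℕ × ℝ => (p.1 : ℝ)⁻¹) _)).mul
      (isBigO_one_of_continuous hS (g := fun q => shiftedRatioCoeff α (1 - α) q.1)
        (by unfold shiftedRatioCoeff; fun_prop))
  have hinv : (fun p : ℕ × ℝ => (p.1 : ℝ) ^ 1 * ((p.1 : ℝ) ^ (-α) * (p.1 : ℝ)⁻¹ ^ 3))
      =O[Filter.atTop ×ˢ Filter.principal S] fun p => (p.1 : ℝ) ^ (-α) * (p.1 : ℝ)⁻¹ * 1 := by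
    refine ((Asymptotics.isBigO_refl _ _).mul
      (isBigO_one_of_continuous hS continuous_snd)).congr_left fun p => ?_
    rcases eq_or_ne (p.1 : ℝ) 0 with hp | hp
    · simp [hp]
    · field_simp
  refine (((max_sub_rpow_div_gamma_isBigO h0 h1 hS 1).trans hinv).add hquad).congr' ?_ ?_ <;>
    refine Filter.eventually_prod_principal_iff.2 ?_ <;>
    filter_upwards [Filter.eventually_gt_atTop 0] with k hk φ _
  · simp only [Function.comp_apply, Nat.cast_one]
    field_simp
    ring
  · rw [mul_one, rpow_neg_mul_inv (by exact_mod_cast hk)]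

/-- The coefficient of `(1 - X) ^ (α - 1)` in the expansion of the sampled linear kernel. -/
def linearKernelCoeff (α φ : ℝ) : ℝ := α / 2 - φ - 1

theorem exists_linear_kernel_expansion {α : ℝ} (h0 : 0 < α) (h1 : α < 1) {S : Set ℝ}
    (hS : IsCompact S) :
    ∃ C, ∀ φ ∈ S, SumAbsLE (mk (fun k : ℕ => truncPow (1 - α) (k - φ))
      - (binSer (α - 2) 1 + linearKernelCoeff α φ • binSer (α - 1) 1)) C := by
  have hα1 : 1 - α ≠ 0 := by linarith
  refine (exists_sumAbsLE_mk_of_isBigO hS (f := fun k φ => truncPow (1 - α) (k - φ)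
    - (coeff k (binSer (α - 2) 1) + linearKernelCoeff α φ * coeff k (binSer (α - 1) 1)))
    (fun k => ?_) (show 1 < 1 + α by linarith) ?_).imp fun C hC φ hφ => ?_
  · have := continuous_truncPow_sub (show 0 ≤ 1 - α by linarith) k
    unfold linearKernelCoeff
    fun_prop
  · refine ((max_sub_rpow_div_gamma_sub_linear_isBigO h0.le h1 hS).const_mul_left
      (1 - α)⁻¹).congr_left fun p => ?_
    rw [truncPow, show 1 - α + 1 = 2 - α by ring, gamma_two_sub h1, coeff_binSer_sub_two h1,
      linearKernelCoeff]
    field_simp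
    ring
  · convert hC φ hφ using 1
    ext k
    simp

/-! ### The factor `(1 + B (1 - X)) ^ α` of the generating function -/

theorem sumAbsLE_of_isBigO_pow {F : ℝ⟦X⟧} {r : ℝ} (hr0 : 0 ≤ r) (hr1 : r < 1)
    (hF : (fun n => coeff n F) =O[Filter.atTop] fun n => r ^ n) :
    SumAbsLE F (∑' n, |coeff n F|) := fun N =>
  (summable_of_isBigO_nat (summable_geometric_of_lt_one hr0 hr1)
    hF.norm_left).sum_le_tsum (Finset.range N) fun _ _ => abs_nonneg _

theorem exists_eq_C_add_one_sub_X_mul {F : ℝ⟦X⟧} {r s : ℝ} (hr0 : 0 ≤ r) (hr1 : r < 1)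
    (hF : (fun n => coeff n F) =O[Filter.atTop] fun n => r ^ n)
    (hs : HasSum (fun n => coeff n F) s) :
    ∃ G : ℝ⟦X⟧, F = C s + (1 - X) * G ∧
      (fun n => coeff n G) =O[Filter.atTop] fun n => r ^ n := by
  refine ⟨mk fun n => -∑' j, coeff (j + (n + 1)) F, ?_, ?_⟩
  · ext n
    rw [map_add, ← sub_eq_iff_eq_add']
    have htail (m : ℕ) : -∑' j, coeff (j + (m + 1)) F
        = ∑ j ∈ Finset.range (m + 1), coeff j F - s := by
      rw [← hs.tsum_eq, ← hs.summable.sum_add_tsum_nat_add (m + 1)]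
      ring
    cases n with
    | zero => rw [coeff_one_sub_X_mul_zero, coeff_mk, htail]; simp
    | succ n =>
      rw [coeff_one_sub_X_mul_succ, coeff_mk, coeff_mk, htail, htail,
        Finset.sum_range_succ _ (n + 1), coeff_C, if_neg n.succ_ne_zero]
      ring
  · obtain ⟨D, hD⟩ := hF.bound
    obtain ⟨K, hK⟩ := Filter.eventually_atTop.1 hD
    refine Asymptotics.IsBigO.of_bound (D * r * (1 - r)⁻¹)
      (Filter.eventually_atTop.2 ⟨K, fun n hn => ?_⟩)
    rw [coeff_mk, norm_neg]
    refine (tsum_of_norm_bounded ((hasSum_geometric_of_lt_one hr0 hr1).mul_left (D * r ^ (n + 1)))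
      fun j => (hK (j + (n + 1)) (by omega)).trans_eq ?_).trans_eq ?_
    · rw [Real.norm_of_nonneg (by positivity)]
      ring
    · rw [Real.norm_of_nonneg (by positivity)]
      ring

theorem coeff_binSer_isBigO_pow {r x : ℝ} (hr0 : 0 ≤ r) (hr1 : r ≤ 1) (hx0 : 0 ≤ x) :
    (fun n => coeff n (binSer r x)) =O[Filter.atTop] fun n => x ^ n := by
  refine Asymptotics.isBigO_of_le _ fun n => ?_
  rw [Real.norm_eq_abs, Real.norm_of_nonneg (by positivity)]
  induction n with
  | zero => simp [coeff_binSer_zero]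
  | succ n ih =>
    have hn : (0 : ℝ) < n + 1 := by positivity
    have hratio : |((n : ℝ) - r) / (n + 1)| ≤ 1 := by
      rw [abs_div, abs_of_pos hn, div_le_one hn, abs_le]
      have : (0 : ℝ) ≤ n := by positivity
      constructor <;> linarith
    rw [coeff_binSer_succ, abs_mul, abs_mul, abs_of_nonneg hx0]
    calc x * |((n : ℝ) - r) / (n + 1)| * |coeff n (binSer r x)| ≤ x * 1 * x ^ n := by gcongr
      _ = x ^ (n + 1) := by rw [pow_succ]; ring

theorem hasSum_coeff_binSer (r : ℝ) {q : ℝ} (hq : |q| < 1) :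
    HasSum (fun n => coeff n (binSer r q)) ((1 - q) ^ r) := by
  have h := (Real.one_add_rpow_hasFPowerSeriesOnBall_zero (a := r)).hasSum (y := -q) (by
    rw [← ENNReal.ofReal_one, Metric.eball_ofReal, mem_ball_zero_iff]
    simpa using hq)
  simp only [binomialSeries_apply, zero_add] at h
  rw [sub_eq_add_neg]
  refine h.congr_fun fun n => ?_
  rw [coeff_binSer]
  simp [mul_comm]

theorem succ_mul_coeff_succ_binSer (r x : ℝ) (n : ℕ) :
    ((n : ℝ) + 1) * coeff (n + 1) (binSer r x) = -(r * x) * coeff n (binSer (r - 1) x) := by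
  rw [coeff_binSer, coeff_binSer]
  linear_combination (-x) ^ (n + 1) * succ_mul_choose_eq_mul_choose_sub_one r n

theorem sum_range_succ_mul_sub (g : ℕ → ℝ) (N : ℕ) :
    ∑ n ∈ Finset.range N, ((n : ℝ) + 1) * (g (n + 1) - g n)
      = N * g N - ∑ n ∈ Finset.range N, g n := by
  induction N with
  | zero => simp
  | succ N ih =>
    rw [Finset.sum_range_succ, Finset.sum_range_succ, ih]
    push_cast
    ring

theorem hasSum_coeff_of_eq_C_add_one_sub_X_mul {F G : ℝ⟦X⟧} {c d r : ℝ} (hr0 : 0 ≤ r) (hr1 : r < 1)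
    (hG : (fun n => coeff n G) =O[Filter.atTop] fun n => r ^ n) (hFG : F = C c + (1 - X) * G)
    (hd : HasSum (fun n : ℕ => ((n : ℝ) + 1) * coeff (n + 1) F) (-d)) :
    HasSum (fun n => coeff n G) d := by
  have hsum : Summable fun n => coeff n G :=
    summable_of_isBigO_nat (summable_geometric_of_lt_one hr0 hr1) hG
  have hzero : Filter.Tendsto (fun N : ℕ => (N : ℝ) * coeff N G) Filter.atTop (nhds 0) :=
    ((Asymptotics.isBigO_refl (fun N : ℕ => (N : ℝ)) _).mul hG).trans_tendsto
      (tendsto_self_mul_const_pow_of_lt_one hr0 hr1)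
  have hcoeff (n : ℕ) : coeff (n + 1) F = coeff (n + 1) G - coeff n G := by
    rw [hFG, map_add, coeff_C, if_neg n.succ_ne_zero, zero_add, coeff_one_sub_X_mul_succ]
  have hlim : Filter.Tendsto (fun N : ℕ => N * coeff N G - ∑ n ∈ Finset.range N, coeff n G)
      Filter.atTop (nhds (-d)) := by
    refine hd.tendsto_sum_nat.congr fun N => ?_
    simp only [hcoeff]
    exact sum_range_succ_mul_sub (fun n => coeff n G) N
  have heq := tendsto_nhds_unique hlim (hzero.sub hsum.hasSum.tendsto_sum_nat)
  rw [zero_sub, neg_inj] at heq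
  exact heq ▸ hsum.hasSum

theorem exists_binSer_factor {α B : ℝ} (h0 : 0 ≤ α) (h1 : α ≤ 1) (hB : 0 ≤ B) :
    ∃ (Y : ℝ⟦X⟧) (D : ℝ), SumAbsLE Y D ∧
      ((1 + B) ^ α) • binSer α (B / (1 + B)) = 1 + (α * B) • (1 - X) + (1 - X) ^ 2 * Y := by
  set A := 1 + B with hA
  set q := B / A with hq
  have hA0 : 0 < A := by positivity
  have hq0 : 0 ≤ q := by positivity
  have hq1 : q < 1 := by rw [hq, div_lt_one hA0, hA]; linarith
  have hAq : A * (1 - q) = 1 := by rw [hq, hA]; field_simp; ring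
  have hqabs : |q| < 1 := by rwa [abs_of_nonneg hq0]
  set F : ℝ⟦X⟧ := (A ^ α) • binSer α q with hF
  have hFcoeff (n : ℕ) : coeff n F = A ^ α * coeff n (binSer α q) := by simp [hF]
  have hFsum : HasSum (fun n => coeff n F) 1 := by
    have := (hasSum_coeff_binSer α hqabs).mul_left (A ^ α)
    rw [← Real.mul_rpow hA0.le (by linarith), hAq, Real.one_rpow] at this
    simpa only [hFcoeff] using this
  have hderiv : HasSum (fun n : ℕ => ((n : ℝ) + 1) * coeff (n + 1) F) (-(α * B)) := by
    have hvalue : A ^ α * -(α * q) * (1 - q) ^ (α - 1) = -(α * B) := by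
      have hpow : A ^ (α - 1) * (1 - q) ^ (α - 1) = 1 := by
        rw [← Real.mul_rpow hA0.le (by linarith), hAq, Real.one_rpow]
      have hsplit : A ^ α = A ^ (α - 1) * A := by
        rw [← Real.rpow_add_one hA0.ne', sub_add_cancel]
      have hAqB : A * q = B := mul_div_cancel₀ _ hA0.ne'
      linear_combination -(α * q) * (1 - q) ^ (α - 1) * hsplit - α * A * q * hpow - α * hAqB
    rw [← hvalue]
    refine ((hasSum_coeff_binSer (α - 1) hqabs).mul_left (A ^ α * -(α * q))).congr_fun fun n => ?_
    rw [hFcoeff]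
    linear_combination A ^ α * succ_mul_coeff_succ_binSer α q n
  obtain ⟨G, hFG, hG⟩ := exists_eq_C_add_one_sub_X_mul hq0 hq1
    (((coeff_binSer_isBigO_pow h0 h1 hq0).const_mul_left (A ^ α)).congr_left
      fun n => (hFcoeff n).symm) hFsum
  obtain ⟨Y, hGY, hY⟩ := exists_eq_C_add_one_sub_X_mul hq0 hq1 hG
    (hasSum_coeff_of_eq_C_add_one_sub_X_mul hq0 hq1 hG hFG hderiv)
  refine ⟨Y, _, sumAbsLE_of_isBigO_pow hq0 hq1 hY, ?_⟩
  rw [hFG, hGY, smul_eq_C_mul, map_one]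
  ring

/-! ### Total variation of the quadrature error -/

/-- The generating function `(1 + (θ / α - 1 / 2) (1 - X)) ^ α`, by which the weights of the scheme
differ from those of the Grünwald-Letnikov formula. -/
def correctionSer (α θ : ℝ) : ℝ⟦X⟧ :=
  ((1 / 2 + θ / α) ^ α) • binSer α ((θ / α - 1 / 2) / (1 / 2 + θ / α))

/-- The inverse of the generating function of the weights: a discrete fractional integral. -/
def kappaSer (α θ : ℝ) : ℝ⟦X⟧ :=
  correctionSer α θ * binSer (-α) 1

/-- The error of the discrete fractional integral for the kernel `t ↦ (t - s)₊ ^ m / m!`, whose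
Caputo derivative `(t - s)₊ ^ (m - α) / Γ (m - α + 1)` is sampled at the points `k - θ`. -/
def kernelError (α θ m s : ℝ) : ℝ⟦X⟧ :=
  kappaSer α θ * mk (fun k : ℕ => truncPow (m - α) (k - s - θ))
    - mk fun k : ℕ => truncPow m (k - s)

theorem omegaSer_mul_kappaSer {α θ : ℝ} (hα : 0 < α) (hθ : α / 2 ≤ θ) :
    omegaSer α θ * kappaSer α θ = 1 := by
  have hA : 0 < 1 / 2 + θ / α := by linarith [one_half_le_div hα hθ]
  rw [omegaSer, kappaSer, correctionSer, smul_mul_assoc, smul_mul_assoc, mul_smul_comm, smul_smul,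
    ← Real.rpow_add hA, neg_add_cancel, Real.rpow_zero, one_smul,
    mul_comm (binSer α _) (binSer (-α) 1), mul_mul_mul_comm, ← binSer_add, ← binSer_add,
    neg_add_cancel, add_neg_cancel, binSer_zero, binSer_zero, one_mul]

theorem one_sub_X_mul_kappaSer (α θ : ℝ) :
    (1 - X) * kappaSer α θ = correctionSer α θ * binSer (1 - α) 1 := by
  rw [kappaSer, mul_left_comm, one_sub_X_mul_binSer, neg_add_eq_sub]

theorem exists_correctionSer_eq {α θ : ℝ} (h0 : 0 < α) (h1 : α ≤ 1) (hθ : α / 2 ≤ θ) :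
    ∃ (Y : ℝ⟦X⟧) (D : ℝ), SumAbsLE Y D ∧
      correctionSer α θ = 1 + (θ - α / 2) • (1 - X) + (1 - X) ^ 2 * Y := by
  obtain ⟨Y, D, hY, hW⟩ :=
    exists_binSer_factor h0.le h1 (sub_nonneg.2 (one_half_le_div h0 hθ))
  refine ⟨Y, D, hY, ?_⟩
  rw [show 1 + (θ / α - 1 / 2) = 1 / 2 + θ / α by ring,
    show α * (θ / α - 1 / 2) = θ - α / 2 by field_simp] at hW
  exact hW

theorem sumAbsLE_correctionSer {α θ : ℝ} (h0 : 0 < α) (h1 : α ≤ 1) (hθ : α / 2 ≤ θ) :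
    SumAbsLE (correctionSer α θ) (|(1 / 2 + θ / α) ^ α| * 2) := by
  have hθα := one_half_le_div h0 hθ
  refine (sumAbsLE_binSer h0.le h1 (div_nonneg (by linarith) (by linarith)) ?_).smul _
  rw [div_le_one (by linarith)]
  linarith

theorem truncPow_of_nonpos {γ x : ℝ} (hγ : γ ≠ 0) (hx : x ≤ 0) : truncPow γ x = 0 := by
  rw [truncPow, max_eq_right hx, Real.zero_rpow hγ, zero_div]

theorem truncPow_one (x : ℝ) : truncPow 1 x = max x 0 := by
  rw [truncPow, Real.rpow_one, one_add_one_eq_two, Real.Gamma_two, div_one]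

theorem truncPow_two (x : ℝ) : truncPow 2 x = max x 0 ^ 2 / 2 := by
  have hΓ : Real.Gamma (2 + 1) = 2 := by simpa using Real.Gamma_nat_eq_factorial 2
  rw [truncPow, hΓ, Real.rpow_two]

theorem mk_shift {f : ℝ → ℝ} (hf : ∀ x ≤ 0, f x = 0) (j : ℕ) {σ : ℝ} (hσ : 0 ≤ σ) :
    mk (fun k : ℕ => f (k - (j + σ))) = X ^ j * mk fun k : ℕ => f (k - σ) := by
  ext k
  rw [coeff_mk, coeff_X_pow_mul']
  split_ifs with h
  · rw [coeff_mk, Nat.cast_sub h, sub_add_eq_sub_sub]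
  · have : (k : ℝ) ≤ j := by exact_mod_cast (not_le.1 h).le
    exact hf _ (by linarith)

theorem kernelError_natCast_add {α θ m : ℝ} (hm : 0 < m) (hmα : α < m) (hθ : 0 ≤ θ) (j : ℕ)
    {σ : ℝ} (hσ : 0 ≤ σ) :
    kernelError α θ m (j + σ) = X ^ j * kernelError α θ m σ := by
  have hcaputo (x : ℝ) (hx : x ≤ 0) : truncPow (m - α) (x - θ) = 0 :=
    truncPow_of_nonpos (by linarith) (by linarith)
  rw [kernelError, mk_shift hcaputo j hσ,
    mk_shift (fun x hx => truncPow_of_nonpos hm.ne' hx) j hσ, kernelError]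
  ring

theorem one_sub_X_mul_mk_truncPow_one :
    (1 - X) * mk (fun k : ℕ => truncPow 1 k) = binSer (-1) 1 - 1 := by
  have hnat (k : ℕ) : truncPow 1 k = k := by rw [truncPow_one, max_eq_left k.cast_nonneg]
  ext n
  cases n with
  | zero => rw [coeff_one_sub_X_mul_zero, map_sub, coeff_binSer_neg_one]; simp [hnat]
  | succ n => simp [coeff_one_sub_X_mul_succ, coeff_binSer_neg_one, coeff_one, hnat]

theorem sumAbsLE_one_sub_X_mul_mk_truncPow_two {σ : ℝ} (h0 : 0 ≤ σ) (h1 : σ ≤ 1) :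
    SumAbsLE ((1 - X) * mk (fun k : ℕ => truncPow 2 (k - σ))
      - (binSer (-2) 1 - (3 / 2 + σ) • binSer (-1) 1)) 2 := by
  set Z := (1 - X) * mk (fun k : ℕ => truncPow 2 (k - σ))
      - (binSer (-2) 1 - (3 / 2 + σ) • binSer (-1) 1) with hZ
  have hcoeff_zero : coeff 0 Z = 1 / 2 + σ := by
    rw [hZ, map_sub, map_sub, coeff_one_sub_X_mul_zero, coeff_smul, coeff_binSer_zero,
      coeff_binSer_zero, coeff_mk, truncPow_two, Nat.cast_zero, max_eq_right (by linarith),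
      smul_eq_mul]
    ring
  have hcoeff_succ (n : ℕ) : coeff (n + 1) Z = max ((n : ℝ) + 1 - σ) 0 ^ 2 / 2
      - max ((n : ℝ) - σ) 0 ^ 2 / 2 - ((n : ℝ) + 1 + 1 - (3 / 2 + σ)) := by
    rw [hZ, map_sub, map_sub, coeff_one_sub_X_mul_succ, coeff_smul, coeff_binSer_neg_one,
      coeff_binSer_neg_two, coeff_mk, coeff_mk, truncPow_two, truncPow_two, smul_eq_mul]
    push_cast
    ring
  have hcoeff_one : coeff 1 Z = σ ^ 2 / 2 := by
    rw [hcoeff_succ 0, Nat.cast_zero, max_eq_left (by linarith), max_eq_right (by linarith)]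
    ring
  have hcoeff_add_two (n : ℕ) : coeff (n + 2) Z = 0 := by
    have : (0 : ℝ) ≤ n := n.cast_nonneg
    rw [hcoeff_succ (n + 1)]
    push_cast
    rw [max_eq_left (by linarith), max_eq_left (by linarith)]
    ring
  intro N
  refine (Finset.sum_le_sum_of_subset_of_nonneg (Finset.range_mono (by omega : N ≤ N + 2))
    fun _ _ _ => abs_nonneg _).trans ?_
  rw [Finset.sum_range_succ', Finset.sum_range_succ']
  simp only [hcoeff_add_two, zero_add, hcoeff_zero, hcoeff_one, abs_zero, Finset.sum_const_zero]
  rw [abs_of_nonneg (by positivity), abs_of_nonneg (by positivity)]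
  nlinarith

section Correction

variable {W Y : ℝ⟦X⟧} {b : ℝ}

theorem mul_binSer_neg_one (hW : W = 1 + b • (1 - X) + (1 - X) ^ 2 * Y) :
    W * binSer (-1) 1 = binSer (-1) 1 + b • 1 + (1 - X) * Y := by
  have hinv : (1 - X) * binSer (-1) 1 = 1 := by
    rw [one_sub_X_mul_binSer, neg_add_cancel, binSer_zero]
  rw [hW]
  simp only [smul_eq_C_mul]
  linear_combination (C b + (1 - X) * Y) * hinv

theorem mul_binSer_neg_two (hW : W = 1 + b • (1 - X) + (1 - X) ^ 2 * Y) :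
    W * binSer (-2) 1 = binSer (-2) 1 + b • binSer (-1) 1 + Y := by
  have hinv : (1 - X) * binSer (-1) 1 = 1 := by
    rw [one_sub_X_mul_binSer, neg_add_cancel, binSer_zero]
  have hdown : (1 - X) * binSer (-2) 1 = binSer (-1) 1 := by
    rw [one_sub_X_mul_binSer, show (-2 : ℝ) + 1 = -1 by norm_num]
  rw [hW]
  simp only [smul_eq_C_mul]
  linear_combination (C b + (1 - X) * Y) * hdown + Y * hinv

theorem sumAbsLE_mul_linear (hW : W = 1 + b • (1 - X) + (1 - X) ^ 2 * Y) {D K : ℝ}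
    (hY : SumAbsLE Y D) (hWK : SumAbsLE W K) (ρ : ℝ) :
    SumAbsLE (W * (binSer (-1) 1 + ρ • 1) - binSer (-1) 1) (|b| * 1 + 2 * D + |ρ| * K) := by
  have heq : W * (binSer (-1) 1 + ρ • 1) - binSer (-1) 1 = b • 1 + (1 - X) * Y + ρ • W := by
    rw [mul_add, mul_binSer_neg_one hW]
    simp only [smul_eq_C_mul]
    ring
  rw [heq]
  exact ((sumAbsLE_one.smul b).add (sumAbsLE_one_sub_X.mul hY)).add (hWK.smul ρ)

theorem sumAbsLE_mul_quadratic (hW : W = 1 + b • (1 - X) + (1 - X) ^ 2 * Y) {D K : ℝ}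
    (hY : SumAbsLE Y D) (hWK : SumAbsLE W K) (c ρ : ℝ) :
    SumAbsLE (W * (binSer (-2) 1 - c • binSer (-1) 1 + ρ • 1)
        - (binSer (-2) 1 - (c - b) • binSer (-1) 1))
      (D + |c| * (|b| * 1 + 2 * D) + |ρ| * K) := by
  have heq : W * (binSer (-2) 1 - c • binSer (-1) 1 + ρ • 1)
      - (binSer (-2) 1 - (c - b) • binSer (-1) 1) = Y - c • (b • 1 + (1 - X) * Y) + ρ • W := by
    rw [mul_add, mul_sub, mul_smul_comm, mul_binSer_neg_one hW, mul_binSer_neg_two hW]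
    simp only [smul_eq_C_mul, map_sub]
    ring
  rw [heq]
  exact (hY.sub (((sumAbsLE_one.smul b).add (sumAbsLE_one_sub_X.mul hY)).smul c)).add (hWK.smul ρ)

end Correction

theorem binSer_one_sub_mul_binSer_sub_one (α : ℝ) : binSer (1 - α) 1 * binSer (α - 1) 1 = 1 := by
  rw [← binSer_add, sub_add_sub_cancel', sub_self, binSer_zero]

theorem binSer_one_sub_mul_binSer_sub_two (α : ℝ) :
    binSer (1 - α) 1 * binSer (α - 2) 1 = binSer (-1) 1 := by
  rw [← binSer_add]
  ring_nf

theorem binSer_one_sub_mul_binSer_sub_three (α : ℝ) :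
    binSer (1 - α) 1 * binSer (α - 3) 1 = binSer (-2) 1 := by
  rw [← binSer_add]
  ring_nf

theorem one_sub_X_mul_kernelError_one (α θ ρ : ℝ) :
    (1 - X) * kernelError α θ 1 0
      = (correctionSer α θ * (binSer (-1) 1 + ρ • 1) - binSer (-1) 1)
        + correctionSer α θ * binSer (1 - α) 1 * (mk (fun k : ℕ => truncPow (1 - α) (k - θ))
          - (binSer (α - 2) 1 + ρ • binSer (α - 1) 1)) + 1 := by
  simp only [kernelError, sub_zero]
  rw [mul_sub, ← mul_assoc, one_sub_X_mul_kappaSer, one_sub_X_mul_mk_truncPow_one]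
  simp only [smul_eq_C_mul]
  linear_combination correctionSer α θ * (binSer_one_sub_mul_binSer_sub_two α
    + C ρ * binSer_one_sub_mul_binSer_sub_one α)

theorem one_sub_X_mul_kernelError_two (α θ σ c ρ : ℝ) :
    (1 - X) * kernelError α θ 2 σ
      = (correctionSer α θ * (binSer (-2) 1 - c • binSer (-1) 1 + ρ • 1)
          - (binSer (-2) 1 - (3 / 2 + σ) • binSer (-1) 1))
        + correctionSer α θ * binSer (1 - α) 1 * (mk (fun k : ℕ => truncPow (2 - α) (k - (σ + θ)))
          - (binSer (α - 3) 1 - c • binSer (α - 2) 1 + ρ • binSer (α - 1) 1))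
        - ((1 - X) * mk (fun k : ℕ => truncPow 2 (k - σ))
          - (binSer (-2) 1 - (3 / 2 + σ) • binSer (-1) 1)) := by
  simp only [kernelError, sub_sub]
  rw [mul_sub, ← mul_assoc, one_sub_X_mul_kappaSer]
  simp only [smul_eq_C_mul]
  linear_combination correctionSer α θ * (binSer_one_sub_mul_binSer_sub_three α
    - C c * binSer_one_sub_mul_binSer_sub_two α + C ρ * binSer_one_sub_mul_binSer_sub_one α)

theorem exists_sumAbsLE_linear_kernelError {α θ : ℝ} (h0 : 0 < α) (h1 : α < 1) (hθ : α / 2 ≤ θ) :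
    ∃ C, SumAbsLE ((1 - X) * kernelError α θ 1 0) C := by
  obtain ⟨Y, D, hY, hW⟩ := exists_correctionSer_eq h0 h1.le hθ
  obtain ⟨C, hC⟩ := exists_linear_kernel_expansion h0 h1 (isCompact_singleton (x := θ))
  have hWK := sumAbsLE_correctionSer h0 h1.le hθ
  have hbin : SumAbsLE (binSer (1 - α) 1) 2 :=
    sumAbsLE_binSer (by linarith) (by linarith) zero_le_one le_rfl
  rw [one_sub_X_mul_kernelError_one α θ (linearKernelCoeff α θ)]
  exact ⟨_, ((sumAbsLE_mul_linear hW hY hWK _).add ((hWK.mul hbin).mul (hC θ rfl))).add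
    sumAbsLE_one⟩

theorem exists_abs_quadraticKernelCoeff_le (α : ℝ) {S : Set ℝ} (hS : IsCompact S) :
    ∃ K, ∀ φ ∈ S, |quadraticKernelCoeff α φ| ≤ K := by
  suffices Continuous (quadraticKernelCoeff α) from
    hS.exists_bound_of_continuousOn this.continuousOn
  unfold quadraticKernelCoeff shiftedRatioCoeff
  fun_prop

theorem exists_sumAbsLE_quadratic_kernelError_of_le_one {α θ : ℝ} (h0 : 0 < α) (h1 : α < 1)
    (hθ : α / 2 ≤ θ) :
    ∃ C, ∀ σ ∈ Icc (0 : ℝ) 1, SumAbsLE ((1 - X) * kernelError α θ 2 σ) C := by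
  obtain ⟨Y, D, hY, hW⟩ := exists_correctionSer_eq h0 h1.le hθ
  have hS : IsCompact (Icc θ (1 + θ)) := isCompact_Icc
  obtain ⟨C, hC⟩ := exists_quadratic_kernel_expansion h0 h1 hS
  obtain ⟨M, hM⟩ := exists_abs_quadraticKernelCoeff_le α hS
  have hWK := sumAbsLE_correctionSer h0 h1.le hθ
  have hbin : SumAbsLE (binSer (1 - α) 1) 2 :=
    sumAbsLE_binSer (by linarith) (by linarith) zero_le_one le_rfl
  set K := |(1 / 2 + θ / α) ^ α| * 2
  refine ⟨D + ((3 - α) / 2 + 1 + θ) * (|θ - α / 2| * 1 + 2 * D) + M * K + K * 2 * C + 2,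
    fun σ hσ => ?_⟩
  have hφ : σ + θ ∈ Icc θ (1 + θ) := ⟨by linarith [hσ.1], by linarith [hσ.2]⟩
  set c := (3 - α) / 2 + (σ + θ) with hc
  have hc_le : |c| ≤ (3 - α) / 2 + 1 + θ := by
    rw [hc, abs_of_nonneg (by linarith [hσ.1])]
    linarith [hσ.2]
  have hleading := sumAbsLE_mul_quadratic hW hY hWK c (quadraticKernelCoeff α (σ + θ))
  rw [show c - (θ - α / 2) = 3 / 2 + σ by rw [hc]; ring] at hleading
  rw [one_sub_X_mul_kernelError_two α θ σ c (quadraticKernelCoeff α (σ + θ))]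
  refine ((hleading.add ((hWK.mul hbin).mul (hC _ hφ))).sub
    (sumAbsLE_one_sub_X_mul_mk_truncPow_two hσ.1 hσ.2)).mono ?_
  have := hY.nonneg
  have := hWK.nonneg
  gcongr
  exact hM _ hφ

theorem exists_sumAbsLE_quadratic_kernelError {α θ : ℝ} (h0 : 0 < α) (h1 : α < 1)
    (hθ : α / 2 ≤ θ) :
    ∃ C, ∀ s, 0 ≤ s → SumAbsLE ((1 - X) * kernelError α θ 2 s) C := by
  refine (exists_sumAbsLE_quadratic_kernelError_of_le_one h0 h1 hθ).imp fun C hC s hs => ?_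
  have hfract : s - ⌊s⌋₊ ∈ Icc (0 : ℝ) 1 :=
    ⟨sub_nonneg.2 (Nat.floor_le hs), by linarith [Nat.lt_floor_add_one s]⟩
  rw [← add_sub_cancel (⌊s⌋₊ : ℝ) s,
    kernelError_natCast_add two_pos (by linarith) (by linarith) _ hfract.1, mul_left_comm]
  exact (hC _ hfract).X_pow_mul _

/-! ### Consistency of the averages and difference quotients -/

section Curves

variable {F : Type*} [NormedAddCommGroup F] [NormedSpace ℝ F]

theorem exists_contDiff_extension [CompleteSpace F] {T : ℝ} (hT : 0 < T) (n : ℕ) {u : ℝ → F}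
    (hu : ContDiffOn ℝ n u (Icc 0 T)) : ∃ U : ℝ → F, ContDiff ℝ n U ∧ EqOn U u (Icc 0 T) := by
  induction n generalizing u with
  | zero =>
    refine ⟨IccExtend hT.le (Set.domRestrict (Icc 0 T) u), ?_, fun t ht => ?_⟩
    · rw [Nat.cast_zero, contDiff_zero]
      exact (continuousOn_iff_continuous_domRestrict.1 hu.continuousOn).Icc_extend'
    · rw [IccExtend_of_mem hT.le _ ht, domRestrict_apply]
  | succ n ih =>
    obtain ⟨hdiff, -, hderiv⟩ := (contDiffOn_succ_iff_derivWithin (uniqueDiffOn_Icc hT)).1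
      (by exact_mod_cast hu : ContDiffOn ℝ ((n : WithTop ℕ∞) + 1) u (Icc 0 T))
    obtain ⟨V, hV, hVu⟩ := ih hderiv
    have hprimitive (t : ℝ) : HasDerivAt (fun t => u 0 + ∫ s in (0 : ℝ)..t, V s) (V t) t :=
      (hV.continuous.integral_hasStrictDerivAt 0 t).hasDerivAt.const_add _
    refine ⟨fun t => u 0 + ∫ s in (0 : ℝ)..t, V s, ?_, fun t ht => ?_⟩
    · rw [Nat.cast_succ, contDiff_succ_iff_deriv, funext fun t => (hprimitive t).deriv]
      exact ⟨fun t => (hprimitive t).differentiableAt, by simp, hV⟩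
    · have hu' (s : ℝ) (hs : s ∈ Ioo 0 t) : HasDerivAt u (V s) s := by
        have hsT : s < T := hs.2.trans_le ht.2
        rw [hVu ⟨hs.1.le, hsT.le⟩]
        exact (hdiff s ⟨hs.1.le, hsT.le⟩).hasDerivWithinAt.hasDerivAt (Icc_mem_nhds hs.1 hsT)
      simp only [intervalIntegral.integral_eq_sub_of_hasDerivAt_of_le ht.1
        (hu.continuousOn.mono (Icc_subset_Icc_right ht.2)) hu'
        (hV.continuous.intervalIntegrable _ _), add_sub_cancel]

theorem exists_norm_sub_le {u : ℝ → F} (hu : ContDiff ℝ 1 u) (T : ℝ) :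
    ∃ M, 0 ≤ M ∧ ∀ s h, 0 ≤ s → 0 ≤ h → s + h ≤ T → ‖u (s + h) - u s‖ ≤ M * h := by
  obtain ⟨M, hM⟩ := (isCompact_Icc (a := 0) (b := T)).exists_bound_of_continuousOn
    (hu.continuous_deriv le_rfl).continuousOn
  refine ⟨|M|, abs_nonneg M, fun s h hs hh hsT => ?_⟩
  have := norm_image_sub_le_of_norm_deriv_le_segment' (a := s) (b := s + h)
    (fun t _ => (hu.differentiable one_ne_zero t).hasDerivAt.hasDerivWithinAt)
    (fun t ht => (hM t ⟨hs.trans ht.1, ht.2.le.trans hsT⟩).trans (le_abs_self M))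
    (s + h) (right_mem_Icc.2 (by linarith))
  rwa [add_sub_cancel_left] at this

theorem exists_norm_sub_linear_le {u : ℝ → F} (hu : ContDiff ℝ 2 u) (T : ℝ) :
    ∃ M, 0 ≤ M ∧ ∀ s h, 0 ≤ s → 0 ≤ h → s + h ≤ T →
      ‖u (s + h) - (u s + h • deriv u s)‖ ≤ M * h ^ 2 := by
  obtain ⟨M, hM0, hM⟩ := exists_norm_sub_le (hu.deriv' : ContDiff ℝ 1 (deriv u)) T
  refine ⟨M, hM0, fun s h hs hh hsT => ?_⟩
  have := norm_image_sub_le_of_norm_deriv_le_segment' (a := 0) (b := h) (C := M * h)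
    (f := fun x => u (s + x) - x • deriv u s) (f' := fun x => deriv u (s + x) - deriv u s)
    (fun x _ => ?_)
    (fun x hx => (hM s x hs hx.1 (by linarith [hx.2])).trans (by gcongr; exact hx.2.le))
    h (right_mem_Icc.2 hh)
  · simp only [add_zero, zero_smul, sub_zero] at this
    convert this using 1
    · congr 1; abel
    · ring
  · have := ((hu.differentiable two_ne_zero (s + x)).hasDerivAt.comp_const_add s x).fun_sub
      ((hasDerivAt_id x).smul_const (deriv u s))
    simpa using this.hasDerivWithinAt

theorem exists_norm_sub_quadratic_le {u : ℝ → F} (hu : ContDiff ℝ 3 u) (T : ℝ) :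
    ∃ M, 0 ≤ M ∧ ∀ s h, 0 ≤ s → 0 ≤ h → s + h ≤ T →
      ‖u (s + h) - (u s + h • deriv u s + (h ^ 2 / 2) • deriv (deriv u) s)‖ ≤ M * h ^ 3 := by
  obtain ⟨M, hM0, hM⟩ := exists_norm_sub_linear_le (hu.deriv' : ContDiff ℝ 2 (deriv u)) T
  refine ⟨M, hM0, fun s h hs hh hsT => ?_⟩
  have := norm_image_sub_le_of_norm_deriv_le_segment' (a := 0) (b := h) (C := M * h ^ 2)
    (f := fun x => u (s + x) - (x • deriv u s + (x ^ 2 / 2) • deriv (deriv u) s))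
    (f' := fun x => deriv u (s + x) - (deriv u s + x • deriv (deriv u) s))
    (fun x _ => ?_) (fun x hx => (hM s x hs hx.1 (by linarith [hx.2])).trans
      (by gcongr; exacts [hx.1, hx.2.le]))
    h (right_mem_Icc.2 hh)
  · simp only [add_zero, zero_smul, sub_zero, zero_pow two_ne_zero, zero_div] at this
    convert this using 1
    · congr 1; abel
    · ring
  · have := ((hu.differentiable three_ne_zero (s + x)).hasDerivAt.comp_const_add s x).fun_sub
      (((hasDerivAt_id x).smul_const (deriv u s)).fun_add
        ((((hasDerivAt_id x).pow 2).div_const 2).smul_const (deriv (deriv u) s)))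
    simpa using this.hasDerivWithinAt

/-- The error of the `θ`-average of a curve over the time step `[s, s + τ]`. -/
def avgErr {G : Type*} [AddCommGroup G] [Module ℝ G] (θ τ : ℝ) (u : ℝ → G) (s : ℝ) : G :=
  (1 - θ) • u (s + τ) + θ • u s - u (s + (1 - θ) * τ)

/-- The error of the difference quotient of a curve over the time step `[s, s + τ]`. -/
def dqErr (θ τ : ℝ) (u : ℝ → F) (s : ℝ) : F :=
  τ⁻¹ • (u (s + τ) - u s) - deriv u (s + (1 - θ) * τ)

theorem exists_norm_avgErr_le {u : ℝ → F} (hu : ContDiff ℝ 2 u) {θ : ℝ} (hθ : θ ∈ Icc (0 : ℝ) 1)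
    (T : ℝ) :
    ∃ M, 0 ≤ M ∧ ∀ τ s, 0 ≤ τ → 0 ≤ s → s + τ ≤ T → ‖avgErr θ τ u s‖ ≤ M * τ ^ 2 := by
  obtain ⟨M, hM0, hM⟩ := exists_norm_sub_linear_le hu T
  refine ⟨2 * M, by positivity, fun τ s hτ hs hsT => ?_⟩
  have hθ0 : 0 ≤ 1 - θ := sub_nonneg.2 hθ.2
  have hθτ : (1 - θ) * τ ≤ τ := mul_le_of_le_one_left hτ (by linarith [hθ.1])
  have hsplit : avgErr θ τ u s = (1 - θ) • (u (s + τ) - (u s + τ • deriv u s))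
      - (u (s + (1 - θ) * τ) - (u s + ((1 - θ) * τ) • deriv u s)) := by
    rw [avgErr]
    module
  rw [hsplit]
  refine (norm_sub_le _ _).trans ?_
  rw [norm_smul, Real.norm_of_nonneg hθ0]
  calc (1 - θ) * ‖u (s + τ) - (u s + τ • deriv u s)‖
        + ‖u (s + (1 - θ) * τ) - (u s + ((1 - θ) * τ) • deriv u s)‖
      ≤ 1 * (M * τ ^ 2) + M * ((1 - θ) * τ) ^ 2 := by
        gcongr
        · linarith [hθ.1]
        · exact hM s τ hs hτ hsT
        · exact hM s _ hs (by positivity) (by linarith)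
    _ ≤ 1 * (M * τ ^ 2) + M * τ ^ 2 := by gcongr
    _ = 2 * M * τ ^ 2 := by ring

theorem exists_norm_avgErr_sub_le {u : ℝ → F} (hu : ContDiff ℝ 3 u) {θ : ℝ}
    (hθ : θ ∈ Icc (0 : ℝ) 1) (T : ℝ) :
    ∃ M, 0 ≤ M ∧ ∀ τ s, 0 ≤ τ → 0 ≤ s → s + τ + τ ≤ T →
      ‖avgErr θ τ u (s + τ) - avgErr θ τ u s‖ ≤ M * τ ^ 3 := by
  obtain ⟨M, hM0, hM⟩ := exists_norm_avgErr_le (hu.deriv' : ContDiff ℝ 2 (deriv u)) hθ T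
  refine ⟨M, hM0, fun τ s hτ hs hsT => ?_⟩
  have hderiv (t : ℝ) : HasDerivAt u (deriv u t) t :=
    (hu.differentiable three_ne_zero t).hasDerivAt
  have := norm_image_sub_le_of_norm_deriv_le_segment' (a := s) (b := s + τ) (C := M * τ ^ 2)
    (f := avgErr θ τ u) (f' := avgErr θ τ (deriv u)) (fun t _ =>
      ((((hderiv _).comp_add_const t τ).const_smul (1 - θ)).add ((hderiv t).const_smul θ)).sub
        ((hderiv _).comp_add_const t _) |>.hasDerivWithinAt)
    (fun t ht => hM τ t hτ (hs.trans ht.1) (by linarith [ht.2])) (s + τ)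
    (right_mem_Icc.2 (by linarith))
  calc ‖avgErr θ τ u (s + τ) - avgErr θ τ u s‖ ≤ M * τ ^ 2 * (s + τ - s) := this
    _ = M * τ ^ 3 := by ring

theorem exists_norm_dqErr_le {u : ℝ → F} (hu : ContDiff ℝ 2 u) {θ : ℝ}
    (hθ : θ ∈ Icc (0 : ℝ) 1) (T : ℝ) :
    ∃ M, 0 ≤ M ∧ ∀ τ s, 0 < τ → 0 ≤ s → s + τ ≤ T → ‖dqErr θ τ u s‖ ≤ M * τ := by
  obtain ⟨M, hM0, hM⟩ := exists_norm_sub_linear_le hu T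
  obtain ⟨K, hK0, hK⟩ := exists_norm_sub_le (hu.deriv' : ContDiff ℝ 1 (deriv u)) T
  refine ⟨M + K, by positivity, fun τ s hτ hs hsT => ?_⟩
  have hθ0 : 0 ≤ 1 - θ := sub_nonneg.2 hθ.2
  have hθτ : (1 - θ) * τ ≤ τ := mul_le_of_le_one_left hτ.le (by linarith [hθ.1])
  have hsplit : dqErr θ τ u s = τ⁻¹ • (u (s + τ) - (u s + τ • deriv u s))
      - (deriv u (s + (1 - θ) * τ) - deriv u s) := by
    have := inv_smul_smul₀ hτ.ne' (deriv u s)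
    rw [dqErr, ← sub_sub, smul_sub _ _ (τ • deriv u s), this]
    abel
  rw [hsplit]
  refine (norm_sub_le _ _).trans ?_
  rw [norm_smul, Real.norm_of_nonneg (by positivity)]
  calc τ⁻¹ * ‖u (s + τ) - (u s + τ • deriv u s)‖ + ‖deriv u (s + (1 - θ) * τ) - deriv u s‖
      ≤ τ⁻¹ * (M * τ ^ 2) + K * ((1 - θ) * τ) := by
        gcongr
        · exact hM s τ hs hτ.le hsT
        · exact hK s _ hs (by positivity) (by linarith)
    _ ≤ τ⁻¹ * (M * τ ^ 2) + K * τ := by gcongr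
    _ = (M + K) * τ := by field_simp

theorem exists_norm_dqErr_half_le {u : ℝ → F} (hu : ContDiff ℝ 3 u) (T : ℝ) :
    ∃ M, 0 ≤ M ∧ ∀ τ s, 0 < τ → 0 ≤ s → s + τ ≤ T → ‖dqErr (1 / 2) τ u s‖ ≤ M * τ ^ 2 := by
  obtain ⟨M, hM0, hM⟩ := exists_norm_sub_quadratic_le hu T
  obtain ⟨K, hK0, hK⟩ := exists_norm_sub_linear_le (hu.deriv' : ContDiff ℝ 2 (deriv u)) T
  refine ⟨M + K, by positivity, fun τ s hτ hs hsT => ?_⟩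
  have hsplit : dqErr (1 / 2) τ u s
      = τ⁻¹ • (u (s + τ) - (u s + τ • deriv u s + (τ ^ 2 / 2) • deriv (deriv u) s))
        - (deriv u (s + τ / 2) - (deriv u s + (τ / 2) • deriv (deriv u) s)) := by
    have hmid : s + (1 - 1 / 2) * τ = s + τ / 2 := by ring
    have hlin := inv_smul_smul₀ hτ.ne' (deriv u s)
    have hquad : τ⁻¹ • (τ ^ 2 / 2) • deriv (deriv u) s = (τ / 2) • deriv (deriv u) s := by
      rw [smul_smul]
      congr 1
      field_simp
    rw [dqErr, hmid, ← sub_sub, ← sub_sub, smul_sub _ _ ((τ ^ 2 / 2) • _),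
      smul_sub _ _ (τ • deriv u s), hlin, hquad]
    abel
  rw [hsplit]
  refine (norm_sub_le _ _).trans ?_
  rw [norm_smul, Real.norm_of_nonneg (by positivity)]
  calc _ ≤ τ⁻¹ * (M * τ ^ 3) + K * (τ / 2) ^ 2 := by
        gcongr
        · exact hM s τ hs hτ.le hsT
        · exact hK s _ hs (by positivity) (by linarith)
    _ ≤ τ⁻¹ * (M * τ ^ 3) + K * τ ^ 2 := by gcongr; linarith
    _ = (M + K) * τ ^ 2 := by field_simp

theorem exists_norm_dqErr_le_pow_order {u : ℝ → F} (hu : ContDiff ℝ 3 u) {θ : ℝ}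
    (hθ : θ ∈ Icc (0 : ℝ) 1) (T : ℝ) :
    ∃ M, 0 ≤ M ∧ ∀ τ s, 0 < τ → 0 ≤ s → s + τ ≤ T → ‖dqErr θ τ u s‖ ≤ M * τ ^ order θ := by
  unfold order
  split_ifs with h
  · exact h ▸ exists_norm_dqErr_half_le hu T
  · simpa only [pow_one] using exists_norm_dqErr_le (hu.of_le (by norm_num)) hθ T

end Curves

/-! ### Peano form of Riemann-Liouville integrals -/

section Peano

variable {F : Type*} [NormedAddCommGroup F] [NormedSpace ℝ F]

theorem truncPow_mul {γ r : ℝ} (hr : 0 ≤ r) (x : ℝ) :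
    truncPow γ (r * x) = r ^ γ * truncPow γ x := by
  rw [truncPow, truncPow, ← mul_div_assoc, ← Real.mul_rpow hr (le_max_right x 0),
    mul_max_of_nonneg _ _ hr, mul_zero]

theorem rlIntegral_one_deriv [CompleteSpace F] {u : ℝ → F} (hu : ContDiff ℝ 1 u) (t : ℝ) :
    rlIntegral 1 (deriv u) t = u t - u 0 := by
  simp only [rlIntegral, Real.Gamma_one, inv_one, one_smul, sub_self, Real.rpow_zero]
  exact intervalIntegral.integral_deriv_eq_sub (fun s _ => hu.differentiable one_ne_zero s)
    ((hu.continuous_deriv le_rfl).intervalIntegrable _ _)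

theorem intervalIntegrable_sub_rpow {γ : ℝ} (hγ : -1 < γ) (t : ℝ) :
    IntervalIntegrable (fun s : ℝ => (t - s) ^ γ) volume 0 t := by
  have h := (intervalIntegral.intervalIntegrable_rpow' (a := 0) (b := t) hγ).comp_sub_left t
  simpa only [sub_zero, sub_self] using h.symm

theorem integral_sub_rpow_smul [CompleteSpace F] {β : ℝ} (hβ : 0 < β) {V : ℝ → F}
    (hV : ContDiff ℝ 1 V) {t : ℝ} (ht : 0 ≤ t) :
    ∫ s in (0 : ℝ)..t, (t - s) ^ (β - 1) • V s
      = (t ^ β / β) • V 0 + ∫ s in (0 : ℝ)..t, ((t - s) ^ β / β) • deriv V s := by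
  have hweight : Continuous fun s : ℝ => (t - s) ^ β / β :=
    ((continuous_const.sub continuous_id).rpow_const fun _ => Or.inr hβ.le).div_const _
  have hleft : IntervalIntegrable (fun s => (t - s) ^ (β - 1) • V s) volume 0 t :=
    (intervalIntegrable_sub_rpow (by linarith) t).smul_continuousOn hV.continuous.continuousOn
  have hright : IntervalIntegrable (fun s => ((t - s) ^ β / β) • deriv V s) volume 0 t :=
    (hweight.smul (hV.continuous_deriv le_rfl)).intervalIntegrable _ _
  have hprimitive (s : ℝ) (hs : s ∈ Ioo 0 t) :
      HasDerivAt (fun s => -(((t - s) ^ β / β) • V s))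
        ((t - s) ^ (β - 1) • V s - ((t - s) ^ β / β) • deriv V s) s := by
    have hpow : HasDerivAt (fun s : ℝ => (t - s) ^ β / β) (-(t - s) ^ (β - 1)) s := by
      refine ((((hasDerivAt_id s).const_sub t).rpow_const (p := β)
        (Or.inl (sub_pos.2 hs.2).ne')).div_const β).congr_deriv ?_
      simp only [id_eq]
      field_simp
    refine (hpow.smul (hV.differentiable one_ne_zero s).hasDerivAt).neg.congr_deriv ?_
    module
  have key := intervalIntegral.integral_eq_sub_of_hasDerivAt_of_le
    (f := fun s => -(((t - s) ^ β / β) • V s)) ht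
    (hweight.smul hV.continuous).neg.continuousOn hprimitive (hleft.sub hright)
  rw [intervalIntegral.integral_sub hleft hright] at key
  simp only [sub_self, Real.zero_rpow hβ.ne', zero_div, zero_smul, neg_zero, sub_zero, zero_sub,
    neg_neg] at key
  rwa [← sub_eq_iff_eq_add]

theorem rlIntegral_eq_truncPow_smul_add [CompleteSpace F] {β : ℝ} (hβ : 0 < β) {V : ℝ → F}
    (hV : ContDiff ℝ 1 V) {t : ℝ} (ht : 0 ≤ t) :
    rlIntegral β V t = truncPow β t • V 0 + rlIntegral (β + 1) (deriv V) t := by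
  have hΓ : (Real.Gamma β)⁻¹ * β⁻¹ = (Real.Gamma (β + 1))⁻¹ := by
    rw [Real.Gamma_add_one hβ.ne', mul_inv, mul_comm]
  rw [rlIntegral, integral_sub_rpow_smul hβ hV ht, rlIntegral, truncPow, max_eq_left ht,
    add_sub_cancel_right]
  simp only [div_eq_inv_mul, mul_smul, intervalIntegral.integral_smul]
  rw [smul_add, smul_smul _ _ (V 0), smul_smul, smul_smul, ← mul_assoc, hΓ, mul_smul]

theorem rlIntegral_eq_integral_truncPow {γ : ℝ} (hγ : 0 < γ) {V : ℝ → F} (hV : Continuous V)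
    {t T : ℝ} (ht : 0 ≤ t) (htT : t ≤ T) :
    rlIntegral (γ + 1) V t = ∫ s in (0 : ℝ)..T, truncPow γ (t - s) • V s := by
  have hcont : Continuous fun s => truncPow γ (t - s) • V s :=
    (continuous_truncPow_sub hγ.le t).smul hV
  have htail : ∫ s in t..T, truncPow γ (t - s) • V s = ∫ _ in t..T, (0 : F) := by
    refine intervalIntegral.integral_congr fun s hs => ?_
    rw [uIcc_of_le htT] at hs
    simp only [truncPow_of_nonpos hγ.ne' (sub_nonpos.2 hs.1), zero_smul]
  rw [← intervalIntegral.integral_add_adjacent_intervals (hcont.intervalIntegrable 0 t)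
    (hcont.intervalIntegrable t T), htail, intervalIntegral.integral_zero, add_zero, rlIntegral,
    ← intervalIntegral.integral_smul]
  refine intervalIntegral.integral_congr fun s hs => ?_
  rw [uIcc_of_le ht] at hs
  simp only [truncPow, max_eq_left (sub_nonneg.2 hs.2), smul_smul, add_sub_cancel_right,
    inv_mul_eq_div]

/-- The functional `(a, c) ↦ τ a u'(0) + τ² c(0) u''(0) + τ² ∫₀ᵀ c(s/τ) u'''(s) ds`. Quantities
attached to `u` and the step `τ` are values of it on explicit kernels `(a, c)`, so that comparing
them reduces to comparing scalar kernels. -/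
def peanoForm (u : ℝ → F) (T τ a : ℝ) (c : ℝ → ℝ) : F :=
  (τ * a) • deriv u 0 + (τ ^ 2 * c 0) • deriv (deriv u) 0
    + ∫ s in (0 : ℝ)..T, (τ ^ 2 * c (s / τ)) • deriv (deriv (deriv u)) s

theorem continuous_deriv_three {u : ℝ → F} (hu : ContDiff ℝ 3 u) :
    Continuous (deriv (deriv (deriv u))) :=
  ((hu.deriv' : ContDiff ℝ 2 (deriv u)).deriv' : ContDiff ℝ 1 (deriv (deriv u))).continuous_deriv
    le_rfl

theorem intervalIntegrable_peanoForm {u : ℝ → F} (hu : ContDiff ℝ 3 u) (T τ : ℝ) {c : ℝ → ℝ}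
    (hc : Continuous c) :
    IntervalIntegrable (fun s => (τ ^ 2 * c (s / τ)) • deriv (deriv (deriv u)) s) volume 0 T :=
  ((continuous_const.mul (hc.comp (continuous_id.div_const τ))).smul
    (continuous_deriv_three hu)).intervalIntegrable _ _

theorem peanoForm_sub {u : ℝ → F} (hu : ContDiff ℝ 3 u) (T τ a b : ℝ) {c d : ℝ → ℝ}
    (hc : Continuous c) (hd : Continuous d) :
    peanoForm u T τ (a - b) (fun s => c s - d s) = peanoForm u T τ a c - peanoForm u T τ b d := by
  simp only [peanoForm, mul_sub, sub_smul]
  rw [intervalIntegral.integral_sub (intervalIntegrable_peanoForm hu T τ hc)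
    (intervalIntegrable_peanoForm hu T τ hd)]
  abel

theorem peanoForm_sum_smul {ι : Type*} {u : ℝ → F} (hu : ContDiff ℝ 3 u) (T τ : ℝ) (S : Finset ι)
    (w a : ι → ℝ) {c : ι → ℝ → ℝ} (hc : ∀ k, Continuous (c k)) :
    peanoForm u T τ (∑ k ∈ S, w k * a k) (fun s => ∑ k ∈ S, w k * c k s)
      = ∑ k ∈ S, w k • peanoForm u T τ (a k) (c k) := by
  have hint (k : ι) : IntervalIntegrable
      (fun s => (τ ^ 2 * (w k * c k (s / τ))) • deriv (deriv (deriv u)) s) volume 0 T :=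
    intervalIntegrable_peanoForm hu T τ (continuous_const.mul (hc k))
  simp only [peanoForm, Finset.mul_sum, Finset.sum_smul]
  rw [intervalIntegral.integral_finsetSum fun k _ => hint k, ← Finset.sum_add_distrib,
    ← Finset.sum_add_distrib]
  refine Finset.sum_congr rfl fun k _ => ?_
  simp only [mul_left_comm _ (w k), mul_smul (w k), intervalIntegral.integral_smul, smul_add]

theorem rpow_smul_rlIntegral_deriv [CompleteSpace F] {u : ℝ → F} (hu : ContDiff ℝ 3 u) {β : ℝ}
    (hβ : 0 < β) {T τ x : ℝ} (hτ : 0 < τ) (hx : 0 ≤ x) (hxT : x * τ ≤ T) :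
    τ ^ (1 - β) • rlIntegral β (deriv u) (x * τ)
      = peanoForm u T τ (truncPow β x) fun s => truncPow (β + 1) (x - s) := by
  have hu' : ContDiff ℝ 2 (deriv u) := hu.deriv'
  have hu'' : ContDiff ℝ 1 (deriv (deriv u)) := hu'.deriv'
  have ht : 0 ≤ x * τ := by positivity
  have hτ1 : τ ^ (1 - β) * τ ^ β = τ := by
    rw [← Real.rpow_add hτ, sub_add_cancel, Real.rpow_one]
  have hτ2 : τ ^ (1 - β) * τ ^ (β + 1) = τ ^ 2 := by
    rw [← Real.rpow_add hτ, ← Real.rpow_two]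
    congr 1
    ring
  have hshift (s : ℝ) : τ * x - s = τ * (x - s / τ) := by field_simp
  rw [rlIntegral_eq_truncPow_smul_add hβ (hu'.of_le one_le_two) ht,
    rlIntegral_eq_truncPow_smul_add (by positivity) hu'' ht,
    rlIntegral_eq_integral_truncPow (by positivity) (continuous_deriv_three hu) ht hxT]
  simp only [mul_comm x τ, hshift, truncPow_mul hτ.le, peanoForm, sub_zero, ← add_assoc, smul_add,
    smul_smul, ← intervalIntegral.integral_smul, ← mul_assoc, hτ1, hτ2]

theorem peanoForm_truncPow_of_nonpos (u : ℝ → F) {β : ℝ} (hβ : 0 < β) {T τ x : ℝ} (hT : 0 ≤ T)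
    (hτ : 0 ≤ τ) (hx : x ≤ 0) :
    peanoForm u T τ (truncPow β x) (fun s => truncPow (β + 1) (x - s)) = 0 := by
  have hkernel (s : ℝ) (hs : 0 ≤ s) : truncPow (β + 1) (x - s) = 0 :=
    truncPow_of_nonpos (by positivity) (by linarith)
  have hint : ∫ s in (0 : ℝ)..T, (τ ^ 2 * truncPow (β + 1) (x - s / τ)) • deriv (deriv (deriv u)) s
      = ∫ _ in (0 : ℝ)..T, (0 : F) := by
    refine intervalIntegral.integral_congr fun s hs => ?_
    rw [uIcc_of_le hT] at hs
    simp only [hkernel _ (div_nonneg hs.1 hτ), mul_zero, zero_smul]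
  rw [peanoForm, hint, intervalIntegral.integral_zero, hkernel 0 le_rfl,
    truncPow_of_nonpos hβ.ne' hx]
  simp only [mul_zero, zero_smul, add_zero]

theorem norm_peanoForm_le (u : ℝ → F) {T τ M : ℝ} (hT : 0 ≤ T) (hτ : 0 ≤ τ) (a : ℝ) {c : ℝ → ℝ}
    (hc : Continuous c) (hM : ∀ s ∈ Icc 0 T, ‖deriv (deriv (deriv u)) s‖ ≤ M) :
    ‖peanoForm u T τ a c‖ ≤ τ * |a| * ‖deriv u 0‖ + τ ^ 2 * |c 0| * ‖deriv (deriv u) 0‖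
      + τ ^ 2 * M * ∫ s in (0 : ℝ)..T, |c (s / τ)| := by
  have hc' : Continuous fun s => |c (s / τ)| := (hc.comp (continuous_id.div_const τ)).abs
  have hnorm (r v : ℝ) (hr : 0 ≤ r) (x : F) : ‖(r * v) • x‖ = r * |v| * ‖x‖ := by
    rw [norm_smul, norm_mul, Real.norm_of_nonneg hr, Real.norm_eq_abs]
  rw [peanoForm]
  refine norm_add₃_le.trans (add_le_add (add_le_add (hnorm _ _ hτ _).le
    (hnorm _ _ (by positivity) _).le) ?_)
  rw [← intervalIntegral.integral_const_mul]
  refine intervalIntegral.norm_integral_le_of_norm_le hT (.of_forall fun s hs => ?_)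
    ((continuous_const.mul hc').intervalIntegrable _ _)
  rw [hnorm _ _ (by positivity), mul_right_comm]
  gcongr
  exact hM s ⟨hs.1.le, hs.2⟩

theorem sum_norm_peanoForm_le (u : ℝ → F) {T τ M : ℝ} (hT : 0 ≤ T) (hτ : 0 ≤ τ) {C₁ C₂ : ℝ}
    {a : ℕ → ℝ} {c : ℕ → ℝ → ℝ} (hc : ∀ n, Continuous (c n))
    (hM : ∀ s ∈ Icc 0 T, ‖deriv (deriv (deriv u)) s‖ ≤ M) (N : ℕ)
    (hC₁ : ∑ n ∈ Finset.range N, |a n| ≤ C₁)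
    (hC₂ : ∀ s, 0 ≤ s → ∑ n ∈ Finset.range N, |c n s| ≤ C₂) :
    ∑ n ∈ Finset.range N, ‖peanoForm u T τ (a n) (c n)‖
      ≤ τ * C₁ * ‖deriv u 0‖ + τ ^ 2 * C₂ * ‖deriv (deriv u) 0‖ + τ ^ 2 * M * (C₂ * T) := by
  have hM0 : 0 ≤ M := (norm_nonneg _).trans (hM 0 (left_mem_Icc.2 hT))
  have hc' (n : ℕ) : Continuous fun s => |c n (s / τ)| :=
    ((hc n).comp (continuous_id.div_const τ)).abs
  have hintegral : ∑ n ∈ Finset.range N, ∫ s in (0 : ℝ)..T, |c n (s / τ)| ≤ C₂ * T := by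
    rw [← intervalIntegral.integral_finsetSum fun n _ => (hc' n).intervalIntegrable _ _]
    refine (intervalIntegral.integral_mono_on hT
      ((continuous_finsetSum _ fun n _ => hc' n).intervalIntegrable _ _)
      (continuous_const.intervalIntegrable _ _) fun s hs => hC₂ _ (div_nonneg hs.1 hτ)).trans_eq ?_
    rw [intervalIntegral.integral_const, sub_zero, smul_eq_mul, mul_comm]
  refine (Finset.sum_le_sum fun n _ => norm_peanoForm_le u hT hτ (a n) (hc n) hM).trans ?_
  simp only [Finset.sum_add_distrib, ← Finset.sum_mul, ← Finset.mul_sum]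
  gcongr
  exact hC₂ 0 le_rfl

end Peano

/-! ### Discrete curves with exact fractional differences -/

section DiscreteComparison

variable {F : Type*} [NormedAddCommGroup F] [NormedSpace ℝ F]

theorem sum_coeff_smul_sum_coeff_smul (P Q : ℝ⟦X⟧) (g : ℕ → F) (n : ℕ) :
    ∑ k ∈ Finset.range (n + 1), coeff (n - k) P •
        ∑ j ∈ Finset.range (k + 1), coeff (k - j) Q • g j
      = ∑ j ∈ Finset.range (n + 1), coeff (n - j) (P * Q) • g j := by
  simp only [Finset.smul_sum, smul_smul]
  rw [Finset.sum_comm' (t' := Finset.range (n + 1)) (s' := fun j => Finset.Ico j (n + 1))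
    (fun k j => by simp only [Finset.mem_range, Finset.mem_Ico]; omega)]
  refine Finset.sum_congr rfl fun j hj => ?_
  have hjn : n + 1 - j = (n - j).succ := by have := Finset.mem_range.1 hj; omega
  rw [mul_comm P Q, coeff_mul, Finset.Nat.sum_antidiagonal_eq_sum_range_succ_mk, Finset.sum_smul,
    Finset.sum_Ico_eq_sum_range, hjn]
  refine Finset.sum_congr rfl fun i _ => ?_
  rw [add_tsub_cancel_left, Nat.sub_sub, mul_comm]

theorem coeff_mul_mk (P : ℝ⟦X⟧) (f : ℕ → ℝ) (n : ℕ) :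
    coeff n (P * mk f) = ∑ k ∈ Finset.range (n + 1), coeff (n - k) P * f k := by
  rw [mul_comm, coeff_mul, Finset.Nat.sum_antidiagonal_eq_sum_range_succ_mk]
  exact Finset.sum_congr rfl fun k _ => by rw [coeff_mk, mul_comm]

theorem fracDq_sum_coeff_kappaSer {α θ : ℝ} (hα : 0 < α) (hθ : α / 2 ≤ θ) (τ : ℝ) {g : ℕ → F}
    (hg : g 0 = 0) (n : ℕ) :
    fracDq α θ τ (fun n => ∑ k ∈ Finset.range (n + 1), coeff (n - k) (kappaSer α θ) • g k) n
      = τ ^ (-α) • g n := by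
  simp only [fracDq_eq_sum_coeff_omegaSer hα hθ, zero_add, Finset.sum_range_one, hg, smul_zero,
    sub_zero]
  rw [sum_coeff_smul_sum_coeff_smul, omegaSer_mul_kappaSer hα hθ, Finset.sum_range_succ,
    tsub_self, coeff_zero_one, one_smul, Finset.sum_eq_zero, zero_add]
  intro j hj
  rw [coeff_one, if_neg (Nat.sub_pos_of_lt (Finset.mem_range.1 hj)).ne', zero_smul]

theorem coeff_kernelError (α θ m s : ℝ) (n : ℕ) :
    coeff n (kernelError α θ m s) = ∑ k ∈ Finset.range (n + 1),
      coeff (n - k) (kappaSer α θ) * truncPow (m - α) (k - θ - s) - truncPow m (n - s) := by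
  rw [kernelError, map_sub, coeff_mul_mk, coeff_mk]
  simp only [sub_right_comm _ s θ]

theorem continuous_coeff_kernelError {α θ m : ℝ} (hm : 0 ≤ m) (hmα : α ≤ m) (n : ℕ) :
    Continuous fun s => coeff n (kernelError α θ m s) := by
  simp only [coeff_kernelError]
  exact (continuous_finsetSum _ fun k _ => continuous_const.mul
    (continuous_truncPow_sub (sub_nonneg.2 hmα) _)).sub (continuous_truncPow_sub hm _)

theorem SumAbsLE.sum_abs_coeff_succ_sub_le {G : ℝ⟦X⟧} {C : ℝ} (h : SumAbsLE ((1 - X) * G) C)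
    (N : ℕ) : ∑ n ∈ Finset.range N, |coeff (n + 1) G - coeff n G| ≤ C := by
  have hN := h (N + 1)
  rw [Finset.sum_range_succ'] at hN
  simp only [coeff_one_sub_X_mul_succ] at hN
  exact (le_add_of_nonneg_right (abs_nonneg _)).trans hN

/-- The discrete curve whose fractional difference quotients are the exact Caputo derivatives of
`u` at the points `t_{n-θ}`: the inverse quadrature `κ = 1/ω` applied to the Peano form of the
Caputo derivative. -/
def discreteComparison (α θ : ℝ) (u : ℝ → F) (T τ : ℝ) (n : ℕ) : F :=
  ∑ k ∈ Finset.range (n + 1), coeff (n - k) (kappaSer α θ) •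
    peanoForm u T τ (truncPow (1 - α) (k - θ)) fun s => truncPow (1 - α + 1) (k - θ - s)

theorem peanoForm_zero_eq_zero (u : ℝ → F) {α θ T τ : ℝ} (h1 : α < 1) (hθ : 0 ≤ θ) (hT : 0 ≤ T)
    (hτ : 0 ≤ τ) :
    peanoForm u T τ (truncPow (1 - α) ((0 : ℕ) - θ))
      (fun s => truncPow (1 - α + 1) ((0 : ℕ) - θ - s)) = 0 :=
  peanoForm_truncPow_of_nonpos u (sub_pos.2 h1) hT hτ (by simpa)

theorem discreteComparison_zero (u : ℝ → F) {α θ T τ : ℝ} (h1 : α < 1) (hθ : 0 ≤ θ) (hT : 0 ≤ T)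
    (hτ : 0 ≤ τ) : discreteComparison α θ u T τ 0 = 0 := by
  rw [discreteComparison, zero_add, Finset.sum_range_one, peanoForm_zero_eq_zero u h1 hθ hT hτ,
    smul_zero]

theorem fracDq_discreteComparison [CompleteSpace F] {u : ℝ → F} (hu : ContDiff ℝ 3 u)
    {α θ T τ : ℝ} (h0 : 0 < α) (h1 : α < 1) (hθ : θ ∈ Icc (α / 2) 1) (hτ : 0 < τ)
    {n : ℕ} (hn : 1 ≤ n) (hnT : n * τ ≤ T) :
    fracDq α θ τ (discreteComparison α θ u T τ) n = caputo α u ((n - θ) * τ) := by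
  have hn' : (1 : ℝ) ≤ n := by exact_mod_cast hn
  have hθ0 : 0 ≤ θ := by linarith [hθ.1]
  have hT : 0 ≤ T := le_trans (by positivity) hnT
  have hpeano := rpow_smul_rlIntegral_deriv hu (sub_pos.2 h1) hτ (x := n - θ) (T := T)
    (by linarith [hθ.2]) (le_trans (by gcongr; linarith) hnT)
  rw [sub_sub_cancel] at hpeano
  have hexact := fracDq_sum_coeff_kappaSer h0 hθ.1 τ
    (g := fun k : ℕ => peanoForm u T τ (truncPow (1 - α) (k - θ))
      fun s => truncPow (1 - α + 1) (k - θ - s))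
    (peanoForm_zero_eq_zero u h1 hθ0 hT hτ.le) n
  refine hexact.trans ?_
  rw [caputo, ← hpeano, smul_smul, ← Real.rpow_add hτ, neg_add_cancel, Real.rpow_zero, one_smul]

theorem discreteComparison_sub [CompleteSpace F] {u : ℝ → F} (hu : ContDiff ℝ 3 u) (hu0 : u 0 = 0)
    {α T τ : ℝ} (h1 : α < 1) (θ : ℝ) (hτ : 0 < τ) {n : ℕ} (hnT : n * τ ≤ T) :
    discreteComparison α θ u T τ n - u (n * τ)
      = peanoForm u T τ (coeff n (kernelError α θ 1 0)) fun s => coeff n (kernelError α θ 2 s) := by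
  have hexact : u (n * τ) = peanoForm u T τ (truncPow 1 n) fun s => truncPow 2 (n - s) := by
    have := rpow_smul_rlIntegral_deriv hu one_pos hτ n.cast_nonneg hnT
    rwa [sub_self, Real.rpow_zero, one_smul, rlIntegral_one_deriv (hu.of_le (by norm_num)), hu0,
      sub_zero, one_add_one_eq_two] at this
  have hα : 1 - α + 1 = 2 - α := by ring
  have hcont (x : ℝ) : Continuous fun s => truncPow (2 - α) (x - s) :=
    continuous_truncPow_sub (by linarith) x
  simp only [coeff_kernelError, sub_zero]
  rw [hexact, discreteComparison, hα, ← peanoForm_sum_smul hu _ _ _ _ _ fun _ => hcont _,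
    ← peanoForm_sub hu]
  · exact continuous_finsetSum _ fun k _ => continuous_const.mul (hcont _)
  · exact continuous_truncPow_sub zero_le_two _

theorem exists_sum_norm_discreteComparison_sub_le [CompleteSpace F] {u : ℝ → F}
    (hu : ContDiff ℝ 3 u) (hu0 : u 0 = 0) {α θ T : ℝ} (h0 : 0 < α) (h1 : α < 1) (hθ : α / 2 ≤ θ)
    (hT : 0 ≤ T) :
    ∃ C, 0 ≤ C ∧ ∀ (N : ℕ) (τ : ℝ), 0 < τ → N * τ ≤ T →
      ∑ n ∈ Finset.range N, ‖(discreteComparison α θ u T τ (n + 1) - u ((n + 1 : ℕ) * τ))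
        - (discreteComparison α θ u T τ n - u (n * τ))‖ ≤ C * (τ * ‖deriv u 0‖ + τ ^ 2) := by
  obtain ⟨C₁, hC₁⟩ := exists_sumAbsLE_linear_kernelError h0 h1 hθ
  obtain ⟨C₂, hC₂⟩ := exists_sumAbsLE_quadratic_kernelError h0 h1 hθ
  obtain ⟨M, hM⟩ := (isCompact_Icc (a := (0 : ℝ)) (b := T)).exists_bound_of_continuousOn
    (continuous_deriv_three hu).continuousOn
  have hM0 : 0 ≤ M := (norm_nonneg _).trans (hM 0 (left_mem_Icc.2 hT))
  have hC₁0 := hC₁.nonneg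
  have hC₂0 := (hC₂ 0 le_rfl).nonneg
  have hcont (n : ℕ) : Continuous fun s => coeff n (kernelError α θ 2 s) :=
    continuous_coeff_kernelError zero_le_two (by linarith) n
  set K := C₂ * ‖deriv (deriv u) 0‖ + M * (C₂ * T)
  refine ⟨C₁ + K, by positivity, fun N τ hτ hN => ?_⟩
  have hincr (n : ℕ) (hn : n ∈ Finset.range N) :
      (discreteComparison α θ u T τ (n + 1) - u ((n + 1 : ℕ) * τ))
        - (discreteComparison α θ u T τ n - u (n * τ))
      = peanoForm u T τ (coeff (n + 1) (kernelError α θ 1 0) - coeff n (kernelError α θ 1 0))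
        fun s => coeff (n + 1) (kernelError α θ 2 s) - coeff n (kernelError α θ 2 s) := by
    have hn1 : ((n + 1 : ℕ) : ℝ) * τ ≤ T :=
      le_trans (by gcongr; exact Finset.mem_range.1 hn) hN
    have hn0 : (n : ℝ) * τ ≤ T := le_trans (by gcongr; exact n.le_succ) hn1
    rw [discreteComparison_sub hu hu0 h1 θ hτ hn1, discreteComparison_sub hu hu0 h1 θ hτ hn0,
      ← peanoForm_sub hu _ _ _ _ (hcont _) (hcont _)]
  rw [Finset.sum_congr rfl fun n hn => congrArg norm (hincr n hn)]
  refine (sum_norm_peanoForm_le u hT hτ.le (fun n => (hcont (n + 1)).sub (hcont n)) hM N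
    (hC₁.sum_abs_coeff_succ_sub_le N) fun s hs => (hC₂ s hs).sum_abs_coeff_succ_sub_le N).trans ?_
  calc τ * C₁ * ‖deriv u 0‖ + τ ^ 2 * C₂ * ‖deriv (deriv u) 0‖ + τ ^ 2 * M * (C₂ * T)
      = C₁ * (τ * ‖deriv u 0‖) + K * τ ^ 2 := by ring
    _ ≤ (C₁ + K) * (τ * ‖deriv u 0‖) + (C₁ + K) * τ ^ 2 := by
      gcongr
      · exact le_add_of_nonneg_right (by positivity)
      · exact le_add_of_nonneg_left hC₁0
    _ = (C₁ + K) * (τ * ‖deriv u 0‖ + τ ^ 2) := by ring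

end DiscreteComparison

/-! ### Stability of the scheme -/

section Differences

variable {F G : Type*} [AddCommGroup F] [Module ℝ F] [AddCommGroup G] [Module ℝ G]

theorem smul_dq_succ {τ : ℝ} (hτ : τ ≠ 0) (u : ℕ → F) (n : ℕ) :
    τ • dq τ u (n + 1) = u (n + 1) - u n := by
  rw [dq, smul_inv_smul₀ hτ, add_tsub_cancel_right]

theorem avg_succ (θ : ℝ) (u : ℕ → F) (n : ℕ) :
    avg θ u (n + 1) = (1 - θ) • u (n + 1) + θ • u n := by
  rw [avg, add_tsub_cancel_right]

theorem dq_sub (τ : ℝ) (u v : ℕ → F) (n : ℕ) : dq τ (u - v) n = dq τ u n - dq τ v n := by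
  simp only [dq, Pi.sub_apply]
  module

theorem avg_sub (θ : ℝ) (u v : ℕ → F) (n : ℕ) : avg θ (u - v) n = avg θ u n - avg θ v n := by
  simp only [avg, Pi.sub_apply]
  module

theorem fracDq_sub (α θ τ : ℝ) (u v : ℕ → F) (n : ℕ) :
    fracDq α θ τ (u - v) n = fracDq α θ τ u n - fracDq α θ τ v n := by
  simp only [fracDq, Pi.sub_apply, ← smul_sub, ← Finset.sum_sub_distrib]
  simp only [sub_sub_sub_comm]

theorem map_avg (f : F →ₗ[ℝ] G) (θ : ℝ) (u : ℕ → F) (n : ℕ) :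
    f (avg θ u n) = avg θ (fun n => f (u n)) n := by
  rw [avg, map_add, map_smul, map_smul, avg]

end Differences

theorem norm_avg_succ_le {F : Type*} [NormedAddCommGroup F] [NormedSpace ℝ F] {θ B : ℝ}
    (hθ : θ ∈ Icc 0 1) {u : ℕ → F} {n : ℕ}
    (h : ‖u n‖ ≤ B) (h' : ‖u (n + 1)‖ ≤ B) : ‖avg θ u (n + 1)‖ ≤ B := by
  rw [avg_succ, ← mem_closedBall_zero_iff]
  rw [← mem_closedBall_zero_iff] at h h'
  exact convex_closedBall 0 B h' h (sub_nonneg.2 hθ.2) hθ.1 (sub_add_cancel 1 θ)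

/-- The values `r 0, …, r (N - 1)` and their total variation are bounded by `K`. -/
structure VariationLE {F : Type*} [NormedAddCommGroup F] (r : ℕ → F) (N : ℕ) (K : ℝ) :
    Prop where
  norm_le : ∀ n < N, ‖r n‖ ≤ K
  sum_le : ∑ n ∈ Finset.range (N - 1), ‖r (n + 1) - r n‖ ≤ K

theorem VariationLE.nonneg {F : Type*} [NormedAddCommGroup F] {r : ℕ → F} {N : ℕ} {K : ℝ}
    (hr : VariationLE r N K) : 0 ≤ K :=
  (Finset.sum_nonneg fun _ _ => norm_nonneg _).trans hr.sum_le

section InnerProduct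

variable {F : Type*} [NormedAddCommGroup F] [InnerProductSpace ℝ F]

theorem norm_sq_sub_norm_sq_le_inner_avg {θ : ℝ} (hθ : θ ≤ 1 / 2) (u : ℕ → F) (n : ℕ) :
    (‖u (n + 1)‖ ^ 2 - ‖u n‖ ^ 2) / 2 ≤ ⟪u (n + 1) - u n, avg θ u (n + 1)⟫ := by
  have hsplit : avg θ u (n + 1)
      = (1 / 2 : ℝ) • (u (n + 1) + u n) + (1 / 2 - θ) • (u (n + 1) - u n) := by
    rw [avg_succ]
    module
  rw [hsplit, inner_add_right, real_inner_smul_right, real_inner_smul_right,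
    real_inner_self_eq_norm_sq, inner_sub_left, inner_add_right, inner_add_right,
    real_inner_self_eq_norm_sq, real_inner_self_eq_norm_sq, real_inner_comm (u n)]
  nlinarith [mul_nonneg (sub_nonneg.2 hθ) (sq_nonneg ‖u (n + 1) - u n‖)]

theorem sum_inner_sub_eq {u : ℕ → F} (hu : u 0 = 0) (r : ℕ → F) (m : ℕ) :
    ∑ n ∈ Finset.range (m + 1), ⟪u (n + 1) - u n, r n⟫
      = ⟪u (m + 1), r m⟫ - ∑ n ∈ Finset.range m, ⟪u (n + 1), r (n + 1) - r n⟫ := by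
  induction m with
  | zero => simp [hu]
  | succ m ih =>
    rw [Finset.sum_range_succ, ih, Finset.sum_range_succ _ m]
    simp only [inner_sub_left, inner_sub_right]
    ring

theorem VariationLE.sum_inner_sub_le {u r : ℕ → F} {B K : ℝ} {N m : ℕ} (hr : VariationLE r N K)
    (hu : u 0 = 0) (hB : ∀ n ≤ N, ‖u n‖ ≤ B) (hm : m ≤ N) :
    ∑ n ∈ Finset.range m, ⟪u (n + 1) - u n, r n⟫ ≤ 2 * (B * K) := by
  have hB0 : 0 ≤ B := (norm_nonneg _).trans (hB 0 N.zero_le)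
  have hK0 : 0 ≤ K := hr.nonneg
  cases m with
  | zero => simpa only [Finset.range_zero, Finset.sum_empty] using by positivity
  | succ m =>
    have hboundary : ⟪u (m + 1), r m⟫ ≤ B * K := (real_inner_le_norm _ _).trans
      (mul_le_mul (hB _ hm) (hr.norm_le _ hm) (norm_nonneg _) hB0)
    have hvariation : -∑ n ∈ Finset.range m, ⟪u (n + 1), r (n + 1) - r n⟫ ≤ B * K := by
      calc -∑ n ∈ Finset.range m, ⟪u (n + 1), r (n + 1) - r n⟫
          ≤ ∑ n ∈ Finset.range m, B * ‖r (n + 1) - r n‖ := by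
            rw [← Finset.sum_neg_distrib]
            refine Finset.sum_le_sum fun n hn => (neg_le_abs _).trans ?_
            have hn' : n < m := Finset.mem_range.1 hn
            exact (abs_real_inner_le_norm _ _).trans (by gcongr; exact hB _ (by lia))
        _ ≤ ∑ n ∈ Finset.range (N - 1), B * ‖r (n + 1) - r n‖ :=
            Finset.sum_le_sum_of_subset_of_nonneg (Finset.range_mono (by lia))
              fun _ _ _ => by positivity
        _ ≤ B * K := by
            rw [← Finset.mul_sum]
            exact mul_le_mul_of_nonneg_left hr.sum_le hB0
    rw [sum_inner_sub_eq hu]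
    linarith

end InnerProduct

theorem le_of_sq_le_mul_add {a b B K : ℝ} (ha : 0 ≤ a) (hb : 0 ≤ b) (hB : 0 ≤ B) (hK : 0 ≤ K)
    (h : B ^ 2 ≤ a * K * B + b * K ^ 2) : B ≤ (a + b + 1) * K := by
  by_contra! hlt
  have hKB : K ≤ B := by nlinarith [mul_nonneg ha hK, mul_nonneg hb hK]
  have hBpos : 0 < B := lt_of_le_of_lt (by positivity) hlt
  have hKK : b * K ^ 2 ≤ b * (K * B) := by rw [sq]; gcongr
  have hstrict : (a + b + 1) * K * B < B * B := mul_lt_mul_of_pos_right hlt hBpos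
  nlinarith [mul_nonneg hK hB]

namespace Medium

variable (M : Medium)

/-- The coefficient `ε₀ ε_∞` of `∂ₜE` in Ampère's law. -/
def permittivity : ℝ := M.ε₀ * M.εinf

/-- The coefficient `ε₀ (ε_s - ε_∞)` of `E` in the polarization law. -/
def susceptibility : ℝ := M.ε₀ * (M.εs - M.εinf)

theorem permittivity_pos : 0 < M.permittivity := mul_pos M.ε₀_pos M.εinf_pos

theorem susceptibility_pos : 0 < M.susceptibility := mul_pos M.ε₀_pos (sub_pos.2 M.εinf_lt_εs)

/-- The smallest coefficient of `2 energy`. -/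
def coercivity : ℝ :=
  min (min (M.susceptibility * M.permittivity) (M.susceptibility * M.μ₀)) 1

theorem coercivity_pos : 0 < M.coercivity :=
  lt_min (lt_min (mul_pos M.susceptibility_pos M.permittivity_pos)
    (mul_pos M.susceptibility_pos M.μ₀_pos)) one_pos

/-- The factor between the residuals and the solution of the discrete system. -/
def stabilityConst : ℝ :=
  6 / M.coercivity * (4 * M.susceptibility + 2 * (M.susceptibility * M.permittivity) + 2)
    + 6 / M.coercivity * M.susceptibility + 1

theorem stabilityConst_pos : 0 < M.stabilityConst := by
  have := M.coercivity_pos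
  have := M.susceptibility_pos
  have := M.permittivity_pos
  unfold stabilityConst
  positivity

end Medium

section Energy

variable {V S : Type*} [NormedAddCommGroup V] [NormedAddCommGroup S]

/-- The energy `(c ε ‖x‖² + c μ₀ ‖h‖² + ‖p‖²) / 2` with `ε = ε₀ ε_∞` and `c = ε₀ (ε_s - ε_∞)`: the
weight `c` makes the coupling terms of Ampère's law and of the polarization law cancel. -/
def energy (M : Medium) (x p : V) (h : S) : ℝ :=
  (M.susceptibility * M.permittivity * ‖x‖ ^ 2 + M.susceptibility * M.μ₀ * ‖h‖ ^ 2 + ‖p‖ ^ 2) / 2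

theorem add_norm_sq_le_energy (M : Medium) (x p : V) (h : S) :
    (‖x‖ + ‖p‖ + ‖h‖) ^ 2 ≤ 6 / M.coercivity * energy M x p h := by
  have hx : M.coercivity * ‖x‖ ^ 2 ≤ M.susceptibility * M.permittivity * ‖x‖ ^ 2 := by
    gcongr; exact (min_le_left _ _).trans (min_le_left _ _)
  have hh : M.coercivity * ‖h‖ ^ 2 ≤ M.susceptibility * M.μ₀ * ‖h‖ ^ 2 := by
    gcongr; exact (min_le_left _ _).trans (min_le_right _ _)
  have hp : M.coercivity * ‖p‖ ^ 2 ≤ 1 * ‖p‖ ^ 2 := by gcongr; exact min_le_right _ _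
  rw [div_mul_eq_mul_div, le_div_iff₀ M.coercivity_pos, energy]
  calc (‖x‖ + ‖p‖ + ‖h‖) ^ 2 * M.coercivity
      ≤ 3 * (‖x‖ ^ 2 + ‖p‖ ^ 2 + ‖h‖ ^ 2) * M.coercivity := by
        refine mul_le_mul_of_nonneg_right ?_ M.coercivity_pos.le
        linarith [sq_nonneg (‖x‖ - ‖p‖), sq_nonneg (‖x‖ - ‖h‖), sq_nonneg (‖p‖ - ‖h‖)]
    _ ≤ _ := by linarith

end Energy

section Stability

variable {V S D : Type*} [NormedAddCommGroup V] [InnerProductSpace ℝ V]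
  [NormedAddCommGroup S] [InnerProductSpace ℝ S] [AddCommGroup D] [Module ℝ D]

/-- The scheme on an abstract space `D` of electric fields with `L²` embedding `ι` and curl `cu`,
for the steps `n + 1 = 1, …, N`; `g₁ n, g₂ n, g₃ n` are the right-hand sides of step `n + 1`. -/
structure IsDiscreteSolution (M : Medium) (ι : D →ₗ[ℝ] V) (cu : D →ₗ[ℝ] S) (θ τ : ℝ) (N : ℕ)
    (E : ℕ → D) (P : ℕ → V) (H : ℕ → S) (g₁ : ℕ → V) (g₂ : ℕ → S) (g₃ : ℕ → V) : Prop where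
  ampere : ∀ n < N, ∀ χ : D, M.permittivity * ⟪ι (dq τ E (n + 1)), ι χ⟫
    + ⟪dq τ P (n + 1), ι χ⟫ - ⟪avg θ H (n + 1), cu χ⟫ = ⟪g₁ n, ι χ⟫
  faraday : ∀ n < N, M.μ₀ • dq τ H (n + 1) + cu (avg θ E (n + 1)) = g₂ n
  polarization : ∀ n < N, M.τ₀ ^ M.α • fracDq M.α θ τ P (n + 1) + avg θ P (n + 1)
    - M.susceptibility • ι (avg θ E (n + 1)) = g₃ n

theorem energy_succ_sub_le (M : Medium) {θ : ℝ} (hθ : θ ≤ 1 / 2) (x p : ℕ → V) (h : ℕ → S)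
    (n : ℕ) :
    energy M (x (n + 1)) (p (n + 1)) (h (n + 1)) - energy M (x n) (p n) (h n)
      ≤ M.susceptibility * M.permittivity * ⟪x (n + 1) - x n, avg θ x (n + 1)⟫
        + M.susceptibility * M.μ₀ * ⟪h (n + 1) - h n, avg θ h (n + 1)⟫
        + ⟪p (n + 1) - p n, avg θ p (n + 1)⟫ := by
  have hx := mul_le_mul_of_nonneg_left (norm_sq_sub_norm_sq_le_inner_avg hθ x n)
    (mul_pos M.susceptibility_pos M.permittivity_pos).le
  have hh := mul_le_mul_of_nonneg_left (norm_sq_sub_norm_sq_le_inner_avg hθ h n)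
    (mul_pos M.susceptibility_pos M.μ₀_pos).le
  have hp := norm_sq_sub_norm_sq_le_inner_avg hθ p n
  unfold energy
  linarith

/-- The sizes of the residuals that enter the energy estimate: `L¹` in time for the residuals `R₁`,
`R₂`, and bounded variation for `ρ` and `R₃`, which are paired with increments of the solution. -/
structure ResidualLE (ι : D →ₗ[ℝ] V) (τ : ℝ) (N : ℕ) (R₁ : ℕ → V) (R₂ : ℕ → S) (ρ : ℕ → D)
    (R₃ : ℕ → V) (K : ℝ) : Prop where
  ampere : τ * ∑ n ∈ Finset.range N, ‖R₁ n‖ ≤ K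
  faraday : τ * ∑ n ∈ Finset.range N, ‖R₂ n‖ ≤ K
  field : VariationLE (fun n => ι (ρ n)) N K
  polarization : VariationLE R₃ N K

namespace IsDiscreteSolution

variable {M : Medium} {ι : D →ₗ[ℝ] V} {cu : D →ₗ[ℝ] S} {θ τ : ℝ} {N : ℕ} {E E' ρ : ℕ → D}
  {P P' g₁ g₁' g₃ g₃' : ℕ → V} {H H' g₂ g₂' : ℕ → S}

theorem sub (h : IsDiscreteSolution M ι cu θ τ N E P H g₁ g₂ g₃)
    (h' : IsDiscreteSolution M ι cu θ τ N E' P' H' g₁' g₂' g₃') :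
    IsDiscreteSolution M ι cu θ τ N (E - E') (P - P') (H - H') (g₁ - g₁') (g₂ - g₂')
      (g₃ - g₃') where
  ampere n hn χ := by
    simp only [dq_sub, avg_sub, map_sub, inner_sub_left, Pi.sub_apply, ← h.ampere n hn χ,
      ← h'.ampere n hn χ]
    ring
  faraday n hn := by
    simp only [dq_sub, avg_sub, map_sub, Pi.sub_apply, ← h.faraday n hn, ← h'.faraday n hn]
    module
  polarization n hn := by
    simp only [fracDq_sub, avg_sub, map_sub, Pi.sub_apply, ← h.polarization n hn,
      ← h'.polarization n hn]
    module

-- Only the embedded field of `ρ` is controlled, not its curl: testing Ampère's law with the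
-- average of `E` minus `ρ` trades `cu ρ` for increments of `E` and `P`.
theorem energy_identity (h : IsDiscreteSolution M ι cu θ τ N E P H g₁ (fun n => g₂ n + cu (ρ n)) g₃)
    (hτ : τ ≠ 0) {n : ℕ} (hn : n < N) :
    M.susceptibility * M.permittivity * ⟪ι (E (n + 1)) - ι (E n), ι (avg θ E (n + 1))⟫
        + M.susceptibility * M.μ₀ * ⟪H (n + 1) - H n, avg θ H (n + 1)⟫
        + ⟪P (n + 1) - P n, avg θ P (n + 1)⟫
        + M.τ₀ ^ M.α * ⟪fracDq M.α θ τ P (n + 1), P (n + 1) - P n⟫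
      = τ * M.susceptibility * (⟪g₁ n, ι (avg θ E (n + 1)) - ι (ρ n)⟫ + ⟪g₂ n, avg θ H (n + 1)⟫)
        + M.susceptibility * M.permittivity * ⟪ι (E (n + 1)) - ι (E n), ι (ρ n)⟫
        + M.susceptibility * ⟪P (n + 1) - P n, ι (ρ n)⟫ + ⟪P (n + 1) - P n, g₃ n⟫ := by
  have hE : ι (E (n + 1)) - ι (E n) = τ • ι (dq τ E (n + 1)) := by
    rw [← map_sub, ← smul_dq_succ hτ, map_smul]
  have hampere := h.ampere n hn (avg θ E (n + 1) - ρ n)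
  have hfaraday := congrArg (⟪·, avg θ H (n + 1)⟫) (h.faraday n hn)
  have hpolarization := congrArg (⟪dq τ P (n + 1), ·⟫) (h.polarization n hn)
  rw [hE, ← smul_dq_succ hτ H, ← smul_dq_succ hτ P, real_inner_comm (τ • dq τ P (n + 1))]
  simp only [map_sub, inner_sub_right, inner_add_right, inner_add_left, real_inner_smul_left,
    real_inner_smul_right, real_inner_comm (avg θ H (n + 1)) (cu _)] at *
  linear_combination τ * M.susceptibility * (hampere + hfaraday) + τ * hpolarization

theorem energy_step_le
    (h : IsDiscreteSolution M ι cu θ τ N E P H g₁ (fun n => g₂ n + cu (ρ n)) g₃)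
    (hθ : θ ∈ Icc 0 (1 / 2)) (hτ : 0 < τ) {B K : ℝ} (hE : ∀ n ≤ N, ‖ι (E n)‖ ≤ B)
    (hH : ∀ n ≤ N, ‖H n‖ ≤ B) {n : ℕ} (hn : n < N) (hρ : ‖ι (ρ n)‖ ≤ K) :
    energy M (ι (E (n + 1))) (P (n + 1)) (H (n + 1)) - energy M (ι (E n)) (P n) (H n)
        + M.τ₀ ^ M.α * ⟪fracDq M.α θ τ P (n + 1), P (n + 1) - P n⟫
      ≤ τ * M.susceptibility * (‖g₁ n‖ * (B + K) + ‖g₂ n‖ * B)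
        + M.susceptibility * M.permittivity * ⟪ι (E (n + 1)) - ι (E n), ι (ρ n)⟫
        + M.susceptibility * ⟪P (n + 1) - P n, ι (ρ n)⟫ + ⟪P (n + 1) - P n, g₃ n⟫ := by
  have hθ' : θ ∈ Icc (0 : ℝ) 1 := ⟨hθ.1, hθ.2.trans one_half_lt_one.le⟩
  have hc := M.susceptibility_pos
  have hEB : ‖ι (avg θ E (n + 1))‖ ≤ B := by
    rw [map_avg]
    exact norm_avg_succ_le hθ' (hE n hn.le) (hE (n + 1) hn)
  have hHB : ‖avg θ H (n + 1)‖ ≤ B := norm_avg_succ_le hθ' (hH n hn.le) (hH (n + 1) hn)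
  have hsources : ⟪g₁ n, ι (avg θ E (n + 1)) - ι (ρ n)⟫ + ⟪g₂ n, avg θ H (n + 1)⟫
      ≤ ‖g₁ n‖ * (B + K) + ‖g₂ n‖ * B := by
    refine add_le_add ((real_inner_le_norm _ _).trans ?_) ((real_inner_le_norm _ _).trans ?_)
    · gcongr
      exact (norm_sub_le _ _).trans (add_le_add hEB hρ)
    · gcongr
  have hsources' := mul_le_mul_of_nonneg_left hsources (mul_pos hτ hc).le
  have hincr := energy_succ_sub_le M hθ.2 (fun n => ι (E n)) P H n
  rw [← map_avg] at hincr
  linarith [h.energy_identity hτ.ne' hn]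

theorem energy_le (h : IsDiscreteSolution M ι cu θ τ N E P H g₁ (fun n => g₂ n + cu (ρ n)) g₃)
    (hθ : θ ∈ Icc (M.α / 2) (1 / 2)) (hτ : 0 < τ) {B K : ℝ} (hR : ResidualLE ι τ N g₁ g₂ ρ g₃ K)
    (hE0 : ι (E 0) = 0) (hP0 : P 0 = 0) (hH0 : H 0 = 0) (hE : ∀ n ≤ N, ‖ι (E n)‖ ≤ B)
    (hP : ∀ n ≤ N, ‖P n‖ ≤ B) (hH : ∀ n ≤ N, ‖H n‖ ≤ B) {m : ℕ} (hm : m ≤ N) :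
    energy M (ι (E m)) (P m) (H m)
      ≤ (4 * M.susceptibility + 2 * (M.susceptibility * M.permittivity) + 2) * K * B
        + M.susceptibility * K ^ 2 := by
  have hc := M.susceptibility_pos
  have hε := M.permittivity_pos
  have hB0 : 0 ≤ B := (norm_nonneg _).trans (hE 0 N.zero_le)
  have hK0 : 0 ≤ K := hR.field.nonneg
  have hθ0 : 0 ≤ θ := (half_pos M.α_pos).le.trans hθ.1
  have hsum := Finset.sum_le_sum fun n (hn : n ∈ Finset.range m) =>
    have hnN := (Finset.mem_range.1 hn).trans_le hm
    h.energy_step_le ⟨hθ0, hθ.2⟩ hτ hE hH hnN (hR.field.norm_le n hnN)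
  have henergy0 : energy M (ι (E 0)) (P 0) (H 0) = 0 := by simp [energy, hE0, hP0, hH0]
  have hmemory : 0 ≤ M.τ₀ ^ M.α *
      ∑ n ∈ Finset.range m, ⟪fracDq M.α θ τ P (n + 1), P (n + 1) - P n⟫ := by
    have := sum_fracDq_inner_nonneg M.α_pos M.α_lt_one hθ.1 hτ.le P (m + 1)
    rw [Finset.sum_range_succ'] at this
    refine mul_nonneg (Real.rpow_nonneg M.τ₀_pos.le _) ?_
    simpa only [add_tsub_cancel_right, zero_tsub, sub_self, inner_zero_right, add_zero] using this
  have hampere := mul_le_mul_of_nonneg_left (le_trans (by gcongr) hR.ampere :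
    τ * ∑ n ∈ Finset.range m, ‖g₁ n‖ ≤ K) (mul_nonneg hc.le (add_nonneg hB0 hK0))
  have hfaraday := mul_le_mul_of_nonneg_left (le_trans (by gcongr) hR.faraday :
    τ * ∑ n ∈ Finset.range m, ‖g₂ n‖ ≤ K) (mul_nonneg hc.le hB0)
  have hfieldE := mul_le_mul_of_nonneg_left
    (hR.field.sum_inner_sub_le (u := fun n => ι (E n)) hE0 hE hm) (mul_pos hc hε).le
  have hfieldP := mul_le_mul_of_nonneg_left (hR.field.sum_inner_sub_le hP0 hP hm) hc.le
  have hpolarization := hR.polarization.sum_inner_sub_le hP0 hP hm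
  simp only [Finset.sum_add_distrib, ← Finset.mul_sum, ← Finset.sum_mul, Finset.sum_range_sub
    (fun n => energy M (ι (E n)) (P n) (H n)), henergy0] at hsum
  linarith

theorem norm_le (h : IsDiscreteSolution M ι cu θ τ N E P H g₁ (fun n => g₂ n + cu (ρ n)) g₃)
    (hθ : θ ∈ Icc (M.α / 2) (1 / 2)) (hτ : 0 < τ) {K : ℝ} (hR : ResidualLE ι τ N g₁ g₂ ρ g₃ K)
    (hE0 : ι (E 0) = 0) (hP0 : P 0 = 0) (hH0 : H 0 = 0) {n : ℕ} (hn : n ≤ N) :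
    ‖ι (E n)‖ + ‖P n‖ + ‖H n‖ ≤ M.stabilityConst * K := by
  have hc := M.susceptibility_pos
  have hε := M.permittivity_pos
  have hc₀ := M.coercivity_pos
  have hK0 : 0 ≤ K := hR.field.nonneg
  obtain ⟨m, hm, hmax⟩ := Finset.exists_max_image (Finset.range (N + 1))
    (fun n => ‖ι (E n)‖ + ‖P n‖ + ‖H n‖) ⟨0, Finset.mem_range.2 N.succ_pos⟩
  set B := ‖ι (E m)‖ + ‖P m‖ + ‖H m‖
  have hle (k : ℕ) (hk : k ≤ N) : ‖ι (E k)‖ + ‖P k‖ + ‖H k‖ ≤ B :=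
    hmax k (Finset.mem_range.2 (Nat.lt_succ_of_le hk))
  have henergy := h.energy_le hθ hτ hR hE0 hP0 hH0 (B := B)
    (fun k hk => by linarith [hle k hk, norm_nonneg (P k), norm_nonneg (H k)])
    (fun k hk => by linarith [hle k hk, norm_nonneg (ι (E k)), norm_nonneg (H k)])
    (fun k hk => by linarith [hle k hk, norm_nonneg (ι (E k)), norm_nonneg (P k)])
    (Nat.lt_succ_iff.1 (Finset.mem_range.1 hm))
  refine (hle n hn).trans (le_of_sq_le_mul_add (by positivity) (by positivity)
    (by positivity) hK0 ?_)
  calc B ^ 2 ≤ 6 / M.coercivity * energy M (ι (E m)) (P m) (H m) := add_norm_sq_le_energy M _ _ _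
    _ ≤ 6 / M.coercivity * ((4 * M.susceptibility + 2 * (M.susceptibility * M.permittivity) + 2)
        * K * B + M.susceptibility * K ^ 2) := by gcongr
    _ = _ := by ring

end IsDiscreteSolution

end Stability

/-! ### The Caputo derivative near the initial time -/

section CaputoInitial

open Filter Asymptotics Topology

variable {F : Type*} [NormedAddCommGroup F] [NormedSpace ℝ F] {α T : ℝ} {u U : ℝ → F}

theorem deriv_eqOn_Ioo_of_eqOn_Icc (h : EqOn U u (Icc 0 T)) :
    EqOn (deriv U) (deriv u) (Ioo 0 T) :=
  (h.mono Ioo_subset_Icc_self).deriv isOpen_Ioo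

theorem caputo_eqOn_Ioo_of_eqOn_Icc (h : EqOn U u (Icc 0 T)) :
    EqOn (caputo α U) (caputo α u) (Ioo 0 T) := by
  intro t ht
  refine congrArg (_ • ·) (intervalIntegral.integral_congr_ae (.of_forall fun s hs => ?_))
  rw [uIoc_of_le ht.1.le] at hs
  simp only [deriv_eqOn_Ioo_of_eqOn_Icc h ⟨hs.1, hs.2.trans_lt ht.2⟩]

theorem tendsto_rpow_smul_nhdsGT_zero {f : ℝ → F} {β γ : ℝ} (hf : f =O[𝓝[>] 0] fun t => t ^ β)
    (h : 0 < γ + β) : Tendsto (fun t => t ^ γ • f t) (𝓝[>] 0) (𝓝 0) := by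
  have hpow : Tendsto (fun t : ℝ => t ^ (γ + β)) (𝓝[>] 0) (𝓝 0) := by
    have := (Real.continuousAt_rpow_const 0 (γ + β) (.inr h.le)).tendsto
    rw [Real.zero_rpow h.ne'] at this
    exact this.mono_left nhdsWithin_le_nhds
  refine IsBigO.trans_tendsto ?_ hpow
  refine ((isBigO_refl (fun t : ℝ => t ^ γ) _).smul hf).congr' .rfl ?_
  filter_upwards [self_mem_nhdsWithin] with t ht
  exact (Real.rpow_add ht γ β).symm

theorem rlIntegral_isBigO {β : ℝ} (hβ : 1 ≤ β) {V : ℝ → F} (hV : Continuous V) :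
    rlIntegral β V =O[𝓝[>] 0] fun t => t ^ β := by
  obtain ⟨M, hM⟩ :=
    (isCompact_Icc (a := (0 : ℝ)) (b := 1)).exists_bound_of_continuousOn hV.continuousOn
  refine IsBigO.const_smul_left (.of_bound M ?_) _
  filter_upwards [Ioo_mem_nhdsGT one_pos] with t ht
  have hbound : ∀ s ∈ uIoc 0 t, ‖(t - s) ^ (β - 1) • V s‖ ≤ t ^ (β - 1) * M := by
    intro s hs
    rw [uIoc_of_le ht.1.le] at hs
    have hs' : 0 ≤ t - s := sub_nonneg.2 hs.2
    rw [norm_smul, Real.norm_of_nonneg (Real.rpow_nonneg hs' _)]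
    exact mul_le_mul (Real.rpow_le_rpow hs' (sub_le_self _ hs.1.le) (sub_nonneg.2 hβ))
      (hM s ⟨hs.1.le, hs.2.trans ht.2.le⟩) (norm_nonneg _) (Real.rpow_nonneg ht.1.le _)
  calc ‖∫ s in (0 : ℝ)..t, (t - s) ^ (β - 1) • V s‖
      ≤ t ^ (β - 1) * M * |t - 0| := intervalIntegral.norm_integral_le_of_norm_le_const hbound
    _ = M * (t ^ (β - 1) * t ^ (1 : ℝ)) := by
      rw [sub_zero, abs_of_pos ht.1, Real.rpow_one]; ring
    _ = M * ‖t ^ β‖ := by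
      rw [← Real.rpow_add ht.1, sub_add_cancel, Real.norm_of_nonneg (Real.rpow_nonneg ht.1.le _)]

theorem tendsto_rpow_smul_caputo [CompleteSpace F] (hu : ContDiff ℝ 2 u) (h1 : α < 1) :
    Tendsto (fun t => t ^ (α - 1) • caputo α u t) (𝓝[>] 0)
      (𝓝 ((Real.Gamma (1 - α + 1))⁻¹ • deriv u 0)) := by
  have hu' : ContDiff ℝ 1 (deriv u) := hu.deriv'
  have hrest := tendsto_rpow_smul_nhdsGT_zero (γ := α - 1)
    (rlIntegral_isBigO (by linarith : 1 ≤ 1 - α + 1) (hu'.continuous_deriv le_rfl)) (by linarith)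
  have hlim := hrest.const_add ((Real.Gamma (1 - α + 1))⁻¹ • deriv u 0)
  rw [add_zero] at hlim
  refine hlim.congr' ?_
  filter_upwards [self_mem_nhdsWithin] with t ht
  have ht0 : 0 < t := ht
  have hcancel : t ^ (α - 1) * t ^ (1 - α) = 1 := by
    rw [← Real.rpow_add ht0, sub_add_sub_cancel, sub_self, Real.rpow_zero]
  rw [caputo, rlIntegral_eq_truncPow_smul_add (sub_pos.2 h1) hu' ht0.le, smul_add, smul_smul,
    truncPow, max_eq_left ht0.le, ← mul_div_assoc, hcancel, one_div]

/-- Near `0` the Caputo derivative behaves like `t ^ (1 - α) • u'(0)`, which is not differentiable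
at `0` unless `u'(0) = 0`. -/
theorem deriv_zero_eq_zero_of_caputo_eventuallyEq [CompleteSpace F] (hu : ContDiff ℝ 2 u)
    (h0 : 0 < α) (h1 : α < 1) {R : ℝ → F} (hR : DifferentiableWithinAt ℝ R (Ioi 0) 0)
    (h : caputo α u =ᶠ[𝓝[>] 0] R) : deriv u 0 = 0 := by
  have hlim := tendsto_rpow_smul_caputo hu h1
  have hcaputo : Tendsto (caputo α u) (𝓝[>] 0) (𝓝 0) := by
    have := tendsto_rpow_smul_nhdsGT_zero (β := 0) (γ := 1 - α)
      (by simpa using hlim.isBigO_one ℝ) (by linarith)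
    refine this.congr' ?_
    filter_upwards [self_mem_nhdsWithin] with t ht
    rw [smul_smul, ← Real.rpow_add ht, sub_add_sub_cancel, sub_self, Real.rpow_zero, one_smul]
  have hR0 : R 0 = 0 :=
    tendsto_nhds_unique hR.continuousWithinAt (hcaputo.congr' h)
  have hRO : R =O[𝓝[>] 0] fun t => t ^ (1 : ℝ) := by
    simpa [hR0] using hR.isBigO_sub
  have hlim' := tendsto_rpow_smul_nhdsGT_zero (γ := α - 1) hRO (by linarith)
  have hzero := tendsto_nhds_unique (hlim.congr' (h.mono fun t ht => by rw [ht])) hlim'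
  exact (smul_eq_zero.1 hzero).resolve_left
    (inv_ne_zero (Real.Gamma_pos_of_pos (by linarith)).ne')

end CaputoInitial

/-! ### Consistency of the scheme -/

section GridValues

variable {F : Type*} {θ τ T : ℝ} {N n : ℕ}

/-- The values `u(t_n)` of a curve at the nodes `t_n = n τ`. -/
def nodeValues (τ : ℝ) (u : ℝ → F) (n : ℕ) : F := u (n * τ)

/-- The values of a curve at the shifted nodes. The value at `t_{n+1-θ}` has index `n`, as the
right-hand sides of `IsDiscreteSolution`. -/
def shiftedValues (θ τ : ℝ) (u : ℝ → F) (n : ℕ) : F := u (((n + 1 : ℕ) - θ) * τ)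

theorem node_succ (τ : ℝ) (n : ℕ) : ((n + 1 : ℕ) : ℝ) * τ = n * τ + τ := by
  push_cast
  ring

theorem shifted_node_succ (θ τ : ℝ) (n : ℕ) :
    (((n + 1 : ℕ) : ℝ) - θ) * τ = n * τ + (1 - θ) * τ := by
  push_cast
  ring

theorem node_mem_Icc (hτ : 0 ≤ τ) (hNT : N * τ ≤ T) (hn : n ≤ N) : (n : ℝ) * τ ∈ Icc 0 T :=
  ⟨by positivity, le_trans (by gcongr) hNT⟩

theorem node_add_mem_Icc (hτ : 0 ≤ τ) (hNT : N * τ ≤ T) (hn : n < N) :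
    (n : ℝ) * τ + τ ∈ Icc 0 T :=
  node_succ τ n ▸ node_mem_Icc hτ hNT hn

theorem shifted_node_mem_Ioo (hθ : θ ∈ Ioo 0 1) (hτ : 0 < τ) (hNT : N * τ ≤ T) (hn : n < N) :
    (((n + 1 : ℕ) : ℝ) - θ) * τ ∈ Ioo 0 T := by
  have hlt : (1 - θ) * τ < τ := mul_lt_of_lt_one_left hτ (by linarith [hθ.1])
  have hpos : 0 < (1 - θ) * τ := mul_pos (sub_pos.2 hθ.2) hτ
  have hnode : 0 ≤ (n : ℝ) * τ := by positivity
  rw [shifted_node_succ]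
  exact ⟨by linarith, by linarith [(node_add_mem_Icc hτ.le hNT hn).2]⟩

variable [NormedAddCommGroup F]

theorem mul_sum_norm_le {r : ℕ → F} {K : ℝ} (hτ : 0 ≤ τ) (hNT : N * τ ≤ T) (hK : 0 ≤ K)
    (hr : ∀ n < N, ‖r n‖ ≤ K) : τ * ∑ n ∈ Finset.range N, ‖r n‖ ≤ T * K :=
  calc τ * ∑ n ∈ Finset.range N, ‖r n‖
      ≤ τ * ∑ _n ∈ Finset.range N, K := by
        gcongr with n hn
        exact hr n (Finset.mem_range.1 hn)
    _ = N * τ * K := by rw [Finset.sum_const, Finset.card_range, nsmul_eq_mul]; ring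
    _ ≤ T * K := by gcongr

variable [NormedSpace ℝ F]

theorem dq_nodeValues_succ (θ τ : ℝ) (u : ℝ → F) (n : ℕ) :
    dq τ (nodeValues τ u) (n + 1) = shiftedValues θ τ (deriv u) n + dqErr θ τ u (n * τ) := by
  rw [dq, dqErr, nodeValues, nodeValues, shiftedValues, shifted_node_succ, node_succ,
    add_tsub_cancel_right]
  abel

theorem mul_sum_norm_dq_succ (hτ : 0 < τ) (u : ℕ → F) (N : ℕ) :
    τ * ∑ n ∈ Finset.range N, ‖dq τ u (n + 1)‖ = ∑ n ∈ Finset.range N, ‖u (n + 1) - u n‖ := by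
  rw [Finset.mul_sum]
  refine Finset.sum_congr rfl fun n _ => ?_
  rw [← smul_dq_succ hτ.ne', norm_smul, Real.norm_of_nonneg hτ.le]

end GridValues

theorem avg_nodeValues_succ {F : Type*} [AddCommGroup F] [Module ℝ F] (θ τ : ℝ) (u : ℝ → F)
    (n : ℕ) :
    avg θ (nodeValues τ u) (n + 1) = shiftedValues θ τ u n + avgErr θ τ u (n * τ) := by
  rw [avg_succ, avgErr, nodeValues, nodeValues, shiftedValues, shifted_node_succ, node_succ]
  abel

theorem sq_le_mul_pow_order {τ T : ℝ} (hτ : 0 ≤ τ) (hτT : τ ≤ T) (θ : ℝ) :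
    τ ^ 2 ≤ (1 + T) * τ ^ order θ := by
  unfold order
  split_ifs
  · nlinarith [sq_nonneg τ]
  · rw [pow_one]; nlinarith

section VariationBounds

variable {F : Type*} [NormedAddCommGroup F] {r r' : ℕ → F} {N : ℕ} {K K' : ℝ}

theorem VariationLE.mono (h : VariationLE r N K) (hK : K ≤ K') : VariationLE r N K' :=
  ⟨fun n hn => (h.norm_le n hn).trans hK, h.sum_le.trans hK⟩

theorem VariationLE.congr (h : VariationLE r N K) (hr : ∀ n < N, r' n = r n) :
    VariationLE r' N K where
  norm_le n hn := hr n hn ▸ h.norm_le n hn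
  sum_le := by
    refine (Finset.sum_congr rfl fun n hn => ?_).trans_le h.sum_le
    have hn' := Finset.mem_range.1 hn
    rw [hr n (by lia), hr (n + 1) (by lia)]

theorem VariationLE.add (h : VariationLE r N K) (h' : VariationLE r' N K') :
    VariationLE (r + r') N (K + K') where
  norm_le n hn := (norm_add_le _ _).trans (add_le_add (h.norm_le n hn) (h'.norm_le n hn))
  sum_le := by
    refine le_trans ?_ (add_le_add h.sum_le h'.sum_le)
    rw [← Finset.sum_add_distrib]
    refine Finset.sum_le_sum fun n _ => ?_
    rw [Pi.add_apply, Pi.add_apply, add_sub_add_comm]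
    exact norm_add_le _ _

theorem norm_le_sum_norm_sub {δ : ℕ → F} (h0 : δ 0 = 0) {n : ℕ} (hn : n ≤ N) :
    ‖δ n‖ ≤ ∑ k ∈ Finset.range N, ‖δ (k + 1) - δ k‖ := by
  rw [← sub_zero (δ n), ← h0, ← Finset.sum_range_sub]
  exact (norm_sum_le _ _).trans
    (Finset.sum_le_sum_of_subset_of_nonneg (Finset.range_mono hn) fun _ _ _ => norm_nonneg _)

theorem variationLE_avg_succ [NormedSpace ℝ F] {θ : ℝ} (hθ : θ ∈ Icc 0 1) {δ : ℕ → F}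
    (h0 : δ 0 = 0) (hδ : ∑ n ∈ Finset.range N, ‖δ (n + 1) - δ n‖ ≤ K) :
    VariationLE (fun n => avg θ δ (n + 1)) N K where
  norm_le n hn := norm_avg_succ_le hθ ((norm_le_sum_norm_sub h0 hn.le).trans hδ)
    ((norm_le_sum_norm_sub h0 hn).trans hδ)
  sum_le := by
    have hθ1 : 0 ≤ 1 - θ := sub_nonneg.2 hθ.2
    have hterm (n : ℕ) : ‖avg θ δ (n + 1 + 1) - avg θ δ (n + 1)‖
        ≤ (1 - θ) * ‖δ (n + 1 + 1) - δ (n + 1)‖ + θ * ‖δ (n + 1) - δ n‖ := by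
      rw [avg_succ, avg_succ, add_sub_add_comm, ← smul_sub, ← smul_sub]
      refine (norm_add_le _ _).trans_eq ?_
      rw [norm_smul, norm_smul, Real.norm_of_nonneg hθ1, Real.norm_of_nonneg hθ.1]
    have hshift : ∑ n ∈ Finset.range (N - 1), ‖δ (n + 1 + 1) - δ (n + 1)‖ ≤ K := by
      refine le_trans ?_ hδ
      cases N with
      | zero => rfl
      | succ N =>
        rw [Finset.sum_range_succ' _ N, add_tsub_cancel_right]
        exact le_add_of_nonneg_right (norm_nonneg _)
    have hinit : ∑ n ∈ Finset.range (N - 1), ‖δ (n + 1) - δ n‖ ≤ K :=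
      (Finset.sum_le_sum_of_subset_of_nonneg (Finset.range_mono (N.sub_le 1))
        fun _ _ _ => norm_nonneg _).trans hδ
    calc _ ≤ (1 - θ) * ∑ n ∈ Finset.range (N - 1), ‖δ (n + 1 + 1) - δ (n + 1)‖
          + θ * ∑ n ∈ Finset.range (N - 1), ‖δ (n + 1) - δ n‖ := by
          rw [Finset.mul_sum, Finset.mul_sum, ← Finset.sum_add_distrib]
          exact Finset.sum_le_sum fun n _ => hterm n
      _ ≤ (1 - θ) * K + θ * K := add_le_add (mul_le_mul_of_nonneg_left hshift hθ1)
          (mul_le_mul_of_nonneg_left hinit hθ.1)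
      _ = K := by ring

theorem exists_variationLE_avgErr [NormedSpace ℝ F] {u : ℝ → F} (hu : ContDiff ℝ 3 u)
    {θ T : ℝ} (hθ : θ ∈ Icc 0 1) (hT : 0 ≤ T) :
    ∃ C, 0 ≤ C ∧ ∀ (N : ℕ) (τ : ℝ), 0 < τ → τ ≤ T → N * τ ≤ T →
      VariationLE (fun n => avgErr θ τ u (n * τ)) N (C * τ ^ order θ) := by
  obtain ⟨M, hM0, hM⟩ := exists_norm_avgErr_le (hu.of_le (by norm_num)) hθ T
  obtain ⟨L, hL0, hL⟩ := exists_norm_avgErr_sub_le hu hθ T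
  refine ⟨(M + T * L) * (1 + T), by positivity, fun N τ hτ hτT hNT => ?_⟩
  suffices VariationLE (fun n => avgErr θ τ u (n * τ)) N ((M + T * L) * τ ^ 2) by
    refine this.mono ?_
    rw [mul_assoc]
    gcongr
    exact sq_le_mul_pow_order hτ.le hτT θ
  have hTL : 0 ≤ T * L := mul_nonneg hT hL0
  constructor
  · intro n hn
    refine (hM τ _ hτ.le (by positivity) (node_add_mem_Icc hτ.le hNT hn).2).trans ?_
    gcongr
    exact le_add_of_nonneg_right hTL
  · have hstep (n : ℕ) (hn : n ∈ Finset.range (N - 1)) :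
        ‖avgErr θ τ u ((n + 1 : ℕ) * τ) - avgErr θ τ u (n * τ)‖ ≤ L * τ ^ 3 := by
      have hn' : n + 1 < N := by have := Finset.mem_range.1 hn; lia
      have := (node_add_mem_Icc hτ.le hNT hn').2
      rw [node_succ] at this ⊢
      exact hL τ _ hτ.le (by positivity) this
    calc _ ≤ ∑ _n ∈ Finset.range (N - 1), L * τ ^ 3 := Finset.sum_le_sum hstep
      _ = (N - 1 : ℕ) * τ * (L * τ ^ 2) := by
        rw [Finset.sum_const, Finset.card_range, nsmul_eq_mul]
        ring
      _ ≤ (M + T * L) * τ ^ 2 := by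
        have := mul_le_mul_of_nonneg_right (node_mem_Icc hτ.le hNT (N.sub_le 1)).2
          (by positivity : 0 ≤ L * τ ^ 2)
        linarith [mul_nonneg hM0 (sq_nonneg τ)]

end VariationBounds

section ComparisonError

variable {F : Type*} [NormedAddCommGroup F] [NormedSpace ℝ F]

/-- The distance of the discrete comparison curve from the values of `u` at the nodes. -/
def comparisonErr (α θ : ℝ) (u : ℝ → F) (T τ : ℝ) : ℕ → F :=
  discreteComparison α θ u T τ - nodeValues τ u

theorem comparisonErr_zero {u : ℝ → F} (hu0 : u 0 = 0) {α θ T τ : ℝ} (h1 : α < 1) (hθ : 0 ≤ θ)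
    (hT : 0 ≤ T) (hτ : 0 ≤ τ) : comparisonErr α θ u T τ 0 = 0 := by
  rw [comparisonErr, Pi.sub_apply, discreteComparison_zero u h1 hθ hT hτ, nodeValues, Nat.cast_zero,
    zero_mul, hu0, sub_zero]

theorem exists_sum_norm_comparisonErr_sub_le [CompleteSpace F] {u : ℝ → F} (hu : ContDiff ℝ 3 u)
    (hu0 : u 0 = 0) {α θ T : ℝ} (h0 : 0 < α) (h1 : α < 1) (hθ : α / 2 ≤ θ) (hT : 0 ≤ T)
    (hu' : θ = 1 / 2 → deriv u 0 = 0) :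
    ∃ C, 0 ≤ C ∧ ∀ (N : ℕ) (τ : ℝ), 0 < τ → τ ≤ T → N * τ ≤ T →
      ∑ n ∈ Finset.range N, ‖comparisonErr α θ u T τ (n + 1) - comparisonErr α θ u T τ n‖
        ≤ C * τ ^ order θ := by
  obtain ⟨C, hC0, hC⟩ := exists_sum_norm_discreteComparison_sub_le hu hu0 h0 h1 hθ hT
  refine ⟨C * (‖deriv u 0‖ + (1 + T)), by positivity, fun N τ hτ hτT hNT => ?_⟩
  have hlinear : τ * ‖deriv u 0‖ ≤ ‖deriv u 0‖ * τ ^ order θ := by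
    by_cases h : θ = 1 / 2
    · rw [hu' h, norm_zero, mul_zero, zero_mul]
    · rw [order, if_neg h, pow_one, mul_comm]
  calc _ ≤ C * (τ * ‖deriv u 0‖ + τ ^ 2) := hC N τ hτ hNT
    _ ≤ C * (‖deriv u 0‖ * τ ^ order θ + (1 + T) * τ ^ order θ) := by
      gcongr
      exact sq_le_mul_pow_order hτ.le hτT θ
    _ = C * (‖deriv u 0‖ + (1 + T)) * τ ^ order θ := by ring

end ComparisonError

theorem exists_mul_sum_norm_dqErr_le {F : Type*} [NormedAddCommGroup F] [NormedSpace ℝ F]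
    {u : ℝ → F} (hu : ContDiff ℝ 3 u) {θ T : ℝ} (hθ : θ ∈ Icc 0 1) (hT : 0 ≤ T) :
    ∃ C, 0 ≤ C ∧ ∀ (N : ℕ) (τ : ℝ), 0 < τ → N * τ ≤ T →
      τ * ∑ n ∈ Finset.range N, ‖dqErr θ τ u (n * τ)‖ ≤ C * τ ^ order θ := by
  obtain ⟨M, hM0, hM⟩ := exists_norm_dqErr_le_pow_order hu hθ T
  refine ⟨T * M, by positivity, fun N τ hτ hNT => ?_⟩
  rw [mul_assoc]
  exact mul_sum_norm_le hτ.le hNT (by positivity) fun n hn =>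
    hM τ _ hτ (by positivity) (node_add_mem_Icc hτ.le hNT hn).2

section Residuals

variable {V : Type*} [NormedAddCommGroup V] [NormedSpace ℝ V] {e p k : ℝ → V} {θ T : ℝ}

/-- The residual of Ampère's law for the node values of `e`, the discrete comparison curve of `p`,
and a magnetic field with curl `k`. -/
def ampereResidual (M : Medium) (θ T τ : ℝ) (e p k : ℝ → V) (n : ℕ) : V :=
  dqErr θ τ (M.permittivity • e + p) (n * τ) + dq τ (comparisonErr M.α θ p T τ) (n + 1)
    - avgErr θ τ k (n * τ)

/-- The residual of the polarization law for the node values of `e` and the discrete comparison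
curve of `p`. -/
def polarizationResidual (M : Medium) (θ T τ : ℝ) (e p : ℝ → V) (n : ℕ) : V :=
  avg θ (comparisonErr M.α θ p T τ) (n + 1)
    + avgErr θ τ (p - M.susceptibility • e) (n * τ)

theorem Medium.mem_Ioo_of_mem_Icc {M : Medium} (hθ : θ ∈ Icc (M.α / 2) (1 / 2)) : θ ∈ Ioo 0 1 :=
  ⟨(half_pos M.α_pos).trans_le hθ.1, hθ.2.trans_lt one_half_lt_one⟩

theorem exists_mul_sum_norm_ampereResidual_le [CompleteSpace V] {M : Medium}
    (he : ContDiff ℝ 3 e) (hp : ContDiff ℝ 3 p) (hk : ContDiff ℝ 3 k) (hp0 : p 0 = 0)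
    (hp' : θ = 1 / 2 → deriv p 0 = 0) (hθ : θ ∈ Icc (M.α / 2) 1) (hT : 0 ≤ T) :
    ∃ C, 0 ≤ C ∧ ∀ (N : ℕ) (τ : ℝ), 0 < τ → τ ≤ T → N * τ ≤ T →
      τ * ∑ n ∈ Finset.range N, ‖ampereResidual M θ T τ e p k n‖ ≤ C * τ ^ order θ := by
  have hθ' : θ ∈ Icc (0 : ℝ) 1 := ⟨(half_pos M.α_pos).le.trans hθ.1, hθ.2⟩
  obtain ⟨C₁, hC₁0, hC₁⟩ :=
    exists_mul_sum_norm_dqErr_le (u := M.permittivity • e + p)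
      ((he.const_smul M.permittivity).add hp) hθ' hT
  obtain ⟨C₂, hC₂0, hC₂⟩ :=
    exists_sum_norm_comparisonErr_sub_le hp hp0 M.α_pos M.α_lt_one hθ.1 hT hp'
  obtain ⟨C₃, hC₃0, hC₃⟩ := exists_variationLE_avgErr hk hθ' hT
  refine ⟨C₁ + C₂ + T * C₃, by positivity, fun N τ hτ hτT hNT => ?_⟩
  have hdq := hC₁ N τ hτ hNT
  have hcomparison := hC₂ N τ hτ hτT hNT
  have havg := mul_sum_norm_le hτ.le hNT (by positivity) (hC₃ N τ hτ hτT hNT).norm_le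
  rw [← mul_sum_norm_dq_succ hτ] at hcomparison
  calc _ ≤ τ * ∑ n ∈ Finset.range N, (‖dqErr θ τ (M.permittivity • e + p) (n * τ)‖
          + ‖dq τ (comparisonErr M.α θ p T τ) (n + 1)‖ + ‖avgErr θ τ k (n * τ)‖) := by
        gcongr
        exact (norm_sub_le _ _).trans (add_le_add_left (norm_add_le _ _) _)
    _ ≤ _ := by
        rw [Finset.sum_add_distrib, Finset.sum_add_distrib]
        linarith

theorem exists_variationLE_polarizationResidual [CompleteSpace V] {M : Medium}
    (he : ContDiff ℝ 3 e) (hp : ContDiff ℝ 3 p) (hp0 : p 0 = 0)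
    (hp' : θ = 1 / 2 → deriv p 0 = 0) (hθ : θ ∈ Icc (M.α / 2) 1) (hT : 0 ≤ T) :
    ∃ C, 0 ≤ C ∧ ∀ (N : ℕ) (τ : ℝ), 0 < τ → τ ≤ T → N * τ ≤ T →
      VariationLE (polarizationResidual M θ T τ e p) N (C * τ ^ order θ) := by
  have hθ' : θ ∈ Icc (0 : ℝ) 1 := ⟨(half_pos M.α_pos).le.trans hθ.1, hθ.2⟩
  obtain ⟨C₁, hC₁0, hC₁⟩ :=
    exists_sum_norm_comparisonErr_sub_le hp hp0 M.α_pos M.α_lt_one hθ.1 hT hp'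
  obtain ⟨C₂, hC₂0, hC₂⟩ :=
    exists_variationLE_avgErr (hp.sub (he.const_smul M.susceptibility)) hθ' hT
  refine ⟨C₁ + C₂, by positivity, fun N τ hτ hτT hNT => ?_⟩
  rw [add_mul]
  exact (variationLE_avg_succ hθ' (comparisonErr_zero hp0 M.α_lt_one hθ'.1 hT hτ.le)
    (hC₁ N τ hτ hτT hNT)).add (hC₂ N τ hτ hτT hNT)

end Residuals

section SmoothSolution

variable {V S D : Type*} [NormedAddCommGroup V] [InnerProductSpace ℝ V]
  [NormedAddCommGroup S] [InnerProductSpace ℝ S] [AddCommGroup D] [Module ℝ D]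

/-- A smooth solution of the Cole-Cole system on an abstract space `D` of electric fields with `L²`
embedding `ι` and curl `cu`. The curves `e`, `p`, `h` and `k` stand for the electric field, the
polarization, the magnetic field and its curl, extended from `[0, T]` to `ℝ`; `green` says in weak
form that `k` is the curl of `h`. -/
structure IsSmoothSolution (M : Medium) (ι : D →ₗ[ℝ] V) (cu : D →ₗ[ℝ] S) (T : ℝ)
    (f₁ : ℝ → V) (f₂ : ℝ → S) (f₃ : ℝ → V) (E : ℝ → D) (e p k : ℝ → V) (h : ℝ → S) : Prop where
  contDiff_e : ContDiff ℝ 3 e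
  contDiff_p : ContDiff ℝ 3 p
  contDiff_k : ContDiff ℝ 3 k
  contDiff_h : ContDiff ℝ 3 h
  embed : ∀ t ∈ Icc 0 T, ι (E t) = e t
  green : ∀ t ∈ Icc 0 T, ∀ χ : D, ⟪h t, cu χ⟫ = ⟪k t, ι χ⟫
  init : p 0 = 0
  ampere : ∀ t ∈ Ioo 0 T, M.permittivity • deriv e t = k t - deriv p t + f₁ t
  faraday : ∀ t ∈ Ioo 0 T, M.μ₀ • deriv h t = -cu (E t) + f₂ t
  polarization : ∀ t ∈ Ioo 0 T,
    M.τ₀ ^ M.α • caputo M.α p t + p t = M.susceptibility • e t + f₃ t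

namespace IsSmoothSolution

variable {M : Medium} {ι : D →ₗ[ℝ] V} {cu : D →ₗ[ℝ] S} {θ T τ : ℝ} {N n : ℕ} {f₁ f₃ : ℝ → V}
  {f₂ : ℝ → S} {E : ℝ → D} {e p k : ℝ → V} {h : ℝ → S}

theorem map_dq_nodeValues (hs : IsSmoothSolution M ι cu T f₁ f₂ f₃ E e p k h) (hτ : 0 ≤ τ)
    (hNT : N * τ ≤ T) (hn : n < N) :
    ι (dq τ (nodeValues τ E) (n + 1)) = dq τ (nodeValues τ e) (n + 1) := by
  simp only [dq, nodeValues, add_tsub_cancel_right, map_smul, map_sub,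
    hs.embed _ (node_mem_Icc hτ hNT hn.le), hs.embed _ (node_mem_Icc hτ hNT hn)]

theorem map_avg_nodeValues (hs : IsSmoothSolution M ι cu T f₁ f₂ f₃ E e p k h) (hτ : 0 ≤ τ)
    (hNT : N * τ ≤ T) (hn : n < N) :
    ι (avg θ (nodeValues τ E) (n + 1)) = avg θ (nodeValues τ e) (n + 1) := by
  simp only [avg, nodeValues, add_tsub_cancel_right, map_add, map_smul,
    hs.embed _ (node_mem_Icc hτ hNT hn.le), hs.embed _ (node_mem_Icc hτ hNT hn)]

theorem map_avgErr (hs : IsSmoothSolution M ι cu T f₁ f₂ f₃ E e p k h) (hθ : θ ∈ Ioo 0 1)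
    (hτ : 0 < τ) (hNT : N * τ ≤ T) (hn : n < N) :
    ι (avgErr θ τ E (n * τ)) = avgErr θ τ e (n * τ) := by
  have hmid := Ioo_subset_Icc_self (shifted_node_mem_Ioo hθ hτ hNT hn)
  rw [shifted_node_succ] at hmid
  simp only [avgErr, map_add, map_sub, map_smul, hs.embed _ hmid,
    hs.embed _ (node_mem_Icc hτ.le hNT hn.le), hs.embed _ (node_add_mem_Icc hτ.le hNT hn)]

theorem ampere_nodeValues (hs : IsSmoothSolution M ι cu T f₁ f₂ f₃ E e p k h)
    (hθ : θ ∈ Ioo 0 1) (hτ : 0 < τ) (hNT : N * τ ≤ T) (hn : n < N) (χ : D) :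
    M.permittivity * ⟪ι (dq τ (nodeValues τ E) (n + 1)), ι χ⟫
        + ⟪dq τ (discreteComparison M.α θ p T τ) (n + 1), ι χ⟫
        - ⟪avg θ (nodeValues τ h) (n + 1), cu χ⟫
      = ⟪(shiftedValues θ τ f₁ + ampereResidual M θ T τ e p k) n, ι χ⟫ := by
  have hcurl : ⟪avg θ (nodeValues τ h) (n + 1), cu χ⟫ = ⟪avg θ (nodeValues τ k) (n + 1), ι χ⟫ := by
    simp only [avg, nodeValues, add_tsub_cancel_right, inner_add_left, real_inner_smul_left,
      hs.green _ (node_mem_Icc hτ.le hNT hn.le), hs.green _ (node_mem_Icc hτ.le hNT hn)]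
  have hderiv (t : ℝ) :
      deriv (M.permittivity • e + p) t = M.permittivity • deriv e t + deriv p t := by
    have he := hs.contDiff_e.differentiable three_ne_zero t
    rw [deriv_add (he.const_smul _) (hs.contDiff_p.differentiable three_ne_zero t),
      deriv_const_smul _ he]
  have hsum : M.permittivity • dq τ (nodeValues τ e) (n + 1)
        + dq τ (discreteComparison M.α θ p T τ) (n + 1)
      = dq τ (nodeValues τ (M.permittivity • e + p)) (n + 1)
        + dq τ (comparisonErr M.α θ p T τ) (n + 1) := by
    rw [comparisonErr, dq_sub]
    simp only [dq, nodeValues, Pi.add_apply, Pi.smul_apply]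
    module
  rw [hcurl, hs.map_dq_nodeValues hτ.le hNT hn, ← real_inner_smul_left, ← inner_add_left,
    ← inner_sub_left, hsum, dq_nodeValues_succ θ, avg_nodeValues_succ]
  congr 1
  simp only [ampereResidual, shiftedValues, Pi.add_apply, hderiv,
    hs.ampere _ (shifted_node_mem_Ioo hθ hτ hNT hn)]
  abel

theorem faraday_nodeValues (hs : IsSmoothSolution M ι cu T f₁ f₂ f₃ E e p k h)
    (hθ : θ ∈ Ioo 0 1) (hτ : 0 < τ) (hNT : N * τ ≤ T) (hn : n < N) :
    M.μ₀ • dq τ (nodeValues τ h) (n + 1) + cu (avg θ (nodeValues τ E) (n + 1))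
      = (shiftedValues θ τ f₂
        + fun n : ℕ => dqErr θ τ (M.μ₀ • h) (n * τ) + cu (avgErr θ τ E (n * τ))) n := by
  have hsmul : M.μ₀ • dq τ (nodeValues τ h) (n + 1) = dq τ (nodeValues τ (M.μ₀ • h)) (n + 1) := by
    simp only [dq, nodeValues, Pi.smul_apply]
    module
  rw [hsmul, dq_nodeValues_succ θ, avg_nodeValues_succ, map_add]
  simp only [shiftedValues, Pi.add_apply,
    deriv_const_smul _ (hs.contDiff_h.differentiable three_ne_zero _),
    hs.faraday _ (shifted_node_mem_Ioo hθ hτ hNT hn)]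
  abel

theorem polarization_nodeValues [CompleteSpace V]
    (hs : IsSmoothSolution M ι cu T f₁ f₂ f₃ E e p k h) (hθ : θ ∈ Icc (M.α / 2) (1 / 2))
    (hτ : 0 < τ) (hNT : N * τ ≤ T) (hn : n < N) :
    M.τ₀ ^ M.α • fracDq M.α θ τ (discreteComparison M.α θ p T τ) (n + 1)
        + avg θ (discreteComparison M.α θ p T τ) (n + 1)
        - M.susceptibility • ι (avg θ (nodeValues τ E) (n + 1))
      = (shiftedValues θ τ f₃ + polarizationResidual M θ T τ e p) n := by
  have hθ' := Medium.mem_Ioo_of_mem_Icc hθ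
  have hnode := node_mem_Icc hτ.le hNT hn
  have hpde := hs.polarization _ (shifted_node_mem_Ioo hθ' hτ hNT hn)
  have hsum : avg θ (discreteComparison M.α θ p T τ) (n + 1)
        - M.susceptibility • avg θ (nodeValues τ e) (n + 1)
      = avg θ (comparisonErr M.α θ p T τ) (n + 1)
        + avg θ (nodeValues τ (p - M.susceptibility • e)) (n + 1) := by
    rw [comparisonErr, avg_sub]
    simp only [avg, nodeValues, Pi.sub_apply, Pi.smul_apply]
    module
  rw [hs.map_avg_nodeValues hτ.le hNT hn, add_sub_assoc, hsum, avg_nodeValues_succ,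
    fracDq_discreteComparison hs.contDiff_p M.α_pos M.α_lt_one ⟨hθ.1, hθ'.2.le⟩ hτ n.succ_pos
      hnode.2]
  simp only [polarizationResidual, shiftedValues, Pi.add_apply, Pi.sub_apply, Pi.smul_apply,
    ← sub_eq_iff_eq_add'.2 hpde]
  abel

theorem isDiscreteSolution [CompleteSpace V] (hs : IsSmoothSolution M ι cu T f₁ f₂ f₃ E e p k h)
    (hθ : θ ∈ Icc (M.α / 2) (1 / 2)) (hτ : 0 < τ) (hNT : N * τ ≤ T) :
    IsDiscreteSolution M ι cu θ τ N (nodeValues τ E) (discreteComparison M.α θ p T τ)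
      (nodeValues τ h) (shiftedValues θ τ f₁ + ampereResidual M θ T τ e p k)
      (shiftedValues θ τ f₂
        + fun n : ℕ => dqErr θ τ (M.μ₀ • h) (n * τ) + cu (avgErr θ τ E (n * τ)))
      (shiftedValues θ τ f₃ + polarizationResidual M θ T τ e p) where
  ampere _ hn := hs.ampere_nodeValues (Medium.mem_Ioo_of_mem_Icc hθ) hτ hNT hn
  faraday _ hn := hs.faraday_nodeValues (Medium.mem_Ioo_of_mem_Icc hθ) hτ hNT hn
  polarization _ hn := hs.polarization_nodeValues hθ hτ hNT hn

theorem exists_residualLE [CompleteSpace V] (hs : IsSmoothSolution M ι cu T f₁ f₂ f₃ E e p k h)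
    (hθ : θ ∈ Icc (M.α / 2) (1 / 2)) (hT : 0 ≤ T) (hp' : θ = 1 / 2 → deriv p 0 = 0) :
    ∃ C, 0 ≤ C ∧ ∀ (N : ℕ) (τ : ℝ), 0 < τ → τ ≤ T → N * τ ≤ T →
      ResidualLE ι τ N (ampereResidual M θ T τ e p k) (fun n => dqErr θ τ (M.μ₀ • h) (n * τ))
        (fun n => avgErr θ τ E (n * τ)) (polarizationResidual M θ T τ e p) (C * τ ^ order θ) := by
  have hθI := Medium.mem_Ioo_of_mem_Icc hθ
  have hθα : θ ∈ Icc (M.α / 2) 1 := ⟨hθ.1, hθI.2.le⟩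
  have hθ' := Ioo_subset_Icc_self hθI
  obtain ⟨C₁, hC₁0, hC₁⟩ := exists_mul_sum_norm_ampereResidual_le hs.contDiff_e hs.contDiff_p
    hs.contDiff_k hs.init hp' hθα hT
  obtain ⟨C₂, hC₂0, hC₂⟩ := exists_mul_sum_norm_dqErr_le (hs.contDiff_h.const_smul M.μ₀) hθ' hT
  obtain ⟨C₃, hC₃0, hC₃⟩ := exists_variationLE_avgErr hs.contDiff_e hθ' hT
  obtain ⟨C₄, hC₄0, hC₄⟩ := exists_variationLE_polarizationResidual hs.contDiff_e hs.contDiff_p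
    hs.init hp' hθα hT
  refine ⟨C₁ + C₂ + C₃ + C₄, by positivity, fun N τ hτ hτT hNT => ?_⟩
  have hle (C : ℝ) (hC : C ≤ C₁ + C₂ + C₃ + C₄) :
      C * τ ^ order θ ≤ (C₁ + C₂ + C₃ + C₄) * τ ^ order θ := by gcongr
  exact
    { ampere := (hC₁ N τ hτ hτT hNT).trans (hle _ (by linarith))
      faraday := (hC₂ N τ hτ hNT).trans (hle _ (by linarith))
      field := ((hC₃ N τ hτ hτT hNT).congr fun n hn => hs.map_avgErr hθI hτ hNT hn).mono
        (hle _ (by linarith))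
      polarization := (hC₄ N τ hτ hτT hNT).mono (hle _ (by linarith)) }

theorem exists_error_le [CompleteSpace V] (hs : IsSmoothSolution M ι cu T f₁ f₂ f₃ E e p k h)
    (hθ : θ ∈ Icc (M.α / 2) (1 / 2)) (hT : 0 ≤ T) (hp' : θ = 1 / 2 → deriv p 0 = 0) :
    ∃ C > 0, ∀ (N : ℕ) (τ : ℝ), 0 < τ → τ ≤ T → N * τ ≤ T →
      ∀ (Eτ : ℕ → D) (Pτ : ℕ → V) (Hτ : ℕ → S), Eτ 0 = E 0 → Pτ 0 = 0 → Hτ 0 = h 0 →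
      IsDiscreteSolution M ι cu θ τ N Eτ Pτ Hτ (shiftedValues θ τ f₁) (shiftedValues θ τ f₂)
        (shiftedValues θ τ f₃) →
      ∀ n ≤ N, ‖e (n * τ) - ι (Eτ n)‖ + ‖p (n * τ) - Pτ n‖ + ‖h (n * τ) - Hτ n‖
        ≤ C * τ ^ order θ := by
  have hθ0 := (Medium.mem_Ioo_of_mem_Icc hθ).1.le
  obtain ⟨K, hK0, hK⟩ := hs.exists_residualLE hθ hT hp'
  obtain ⟨L, hL0, hL⟩ := exists_sum_norm_comparisonErr_sub_le hs.contDiff_p hs.init M.α_pos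
    M.α_lt_one hθ.1 hT hp'
  have hstab := M.stabilityConst_pos
  refine ⟨M.stabilityConst * K + L + 1, by positivity, ?_⟩
  intro N τ hτ hτT hNT Eτ Pτ Hτ hE0 hP0 hH0 hscheme n hn
  have herror := (hs.isDiscreteSolution hθ hτ hNT).sub hscheme
  simp only [add_sub_cancel_left] at herror
  have hdiff := herror.norm_le hθ hτ (hK N τ hτ hτT hNT) (by simp [nodeValues, hE0])
    (by simp [hP0, discreteComparison_zero p M.α_lt_one hθ0 hT hτ.le])
    (by simp [nodeValues, hH0]) hn
  have hcomparison : ‖comparisonErr M.α θ p T τ n‖ ≤ L * τ ^ order θ :=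
    (norm_le_sum_norm_sub (comparisonErr_zero hs.init M.α_lt_one hθ0 hT hτ.le) hn).trans
      (hL N τ hτ hτT hNT)
  have hE : ι ((nodeValues τ E - Eτ) n) = e (n * τ) - ι (Eτ n) := by
    rw [Pi.sub_apply, map_sub, nodeValues, hs.embed _ (node_mem_Icc hτ.le hNT hn)]
  have hP : ‖p (n * τ) - Pτ n‖
      ≤ ‖(discreteComparison M.α θ p T τ - Pτ) n‖ + ‖comparisonErr M.α θ p T τ n‖ := by
    refine le_trans (le_of_eq (congrArg norm ?_)) (norm_sub_le _ _)
    simp only [comparisonErr, nodeValues, Pi.sub_apply]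
    abel
  rw [hE] at hdiff
  calc _ ≤ M.stabilityConst * (K * τ ^ order θ) + L * τ ^ order θ := by
        rw [Pi.sub_apply (nodeValues τ h), nodeValues] at hdiff
        linarith
    _ ≤ (M.stabilityConst * K + L + 1) * τ ^ order θ := by
        linarith [pow_nonneg hτ.le (order θ)]

end IsSmoothSolution

end SmoothSolution

/-! ### Application to the function spaces -/

section FunctionSpaces

variable {Ω : Set Plane}

/-- The embedding `fieldV` of `H₀(curl; Ω)` into `(L²(Ω))²` as a linear map. -/
def fieldVₗ (Ω : Set Plane) : H0curl Ω →ₗ[ℝ] L2V Ω where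
  toFun := fieldV
  map_add' _ _ := rfl
  map_smul' _ _ := rfl

/-- The curl `curlE` on `H₀(curl; Ω)` as a linear map. -/
def curlEₗ (Ω : Set Plane) : H0curl Ω →ₗ[ℝ] L2S Ω where
  toFun := curlE
  map_add' _ _ := rfl
  map_smul' _ _ := rfl

theorem inner_funcS_curlE (h : HcurlS Ω) (χ : H0curl Ω) :
    ⟪funcS h, curlE χ⟫ = ⟪curlH h, fieldV χ⟫ := by
  rw [real_inner_comm, real_inner_comm _ (curlH h)]
  exact χ.2.2 h h.2

theorem contDiffOn_funcS {m : WithTop ℕ∞} {H : ℝ → HcurlS Ω} {s : Set ℝ}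
    (hH : ContDiffOn ℝ m H s) : ContDiffOn ℝ m (fun t => funcS (H t)) s :=
  ((WithLp.fstL 2 ℝ (L2S Ω) (L2V Ω)).comp (HcurlS Ω).subtypeL).contDiff.comp_contDiffOn hH

theorem contDiffOn_curlH {m : WithTop ℕ∞} {H : ℝ → HcurlS Ω} {s : Set ℝ}
    (hH : ContDiffOn ℝ m H s) : ContDiffOn ℝ m (fun t => curlH (H t)) s :=
  ((WithLp.sndL 2 ℝ (L2S Ω) (L2V Ω)).comp (HcurlS Ω).subtypeL).contDiff.comp_contDiffOn hH

theorem IsSchemeSolution.isDiscreteSolution {M : Medium} {θ τ : ℝ} {N : ℕ} {f₁ f₃ : ℝ → L2V Ω}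
    {f₂ : ℝ → L2S Ω} {E₀ : H0curl Ω} {P₀ : L2V Ω} {H₀ : L2S Ω} {Eτ : ℕ → H0curl Ω}
    {Pτ : ℕ → L2V Ω} {Hτ : ℕ → L2S Ω}
    (h : IsSchemeSolution M θ τ N f₁ f₂ f₃ E₀ P₀ H₀ Eτ Pτ Hτ) :
    IsDiscreteSolution M (fieldVₗ Ω) (curlEₗ Ω) θ τ N Eτ Pτ Hτ (shiftedValues θ τ f₁)
      (shiftedValues θ τ f₂) (shiftedValues θ τ f₃) where
  ampere n hn := h.ampere (n + 1) n.succ_pos hn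
  faraday n hn := ext_inner_right ℝ fun φ => by
    rw [inner_add_left, real_inner_smul_left]
    exact h.faraday (n + 1) n.succ_pos hn φ
  polarization n hn := ext_inner_right ℝ fun ψ => by
    rw [inner_sub_left, inner_add_left, real_inner_smul_left, real_inner_smul_left]
    exact h.polarization (n + 1) n.succ_pos hn ψ

variable {M : Medium} {T : ℝ} {f₁ f₃ : ℝ → L2V Ω} {f₂ : ℝ → L2S Ω} {E : ℝ → H0curl Ω}
  {P : ℝ → L2V Ω} {H : ℝ → HcurlS Ω} {e p k : ℝ → L2V Ω} {h : ℝ → L2S Ω}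

theorem IsSolution.isSmoothSolution (hsol : IsSolution M T f₁ f₂ f₃ E P H) (hT : 0 ≤ T)
    (he : ContDiff ℝ 3 e) (hp : ContDiff ℝ 3 p) (hk : ContDiff ℝ 3 k) (hh : ContDiff ℝ 3 h)
    (hE : EqOn e (fun t => fieldV (E t)) (Icc 0 T)) (hP : EqOn p P (Icc 0 T))
    (hK : EqOn k (fun t => curlH (H t)) (Icc 0 T))
    (hH : EqOn h (fun t => funcS (H t)) (Icc 0 T)) :
    IsSmoothSolution M (fieldVₗ Ω) (curlEₗ Ω) T f₁ f₂ f₃ E e p k h where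
  contDiff_e := he
  contDiff_p := hp
  contDiff_k := hk
  contDiff_h := hh
  embed t ht := (hE ht).symm
  green t ht χ := by
    rw [hH ht, hK ht]
    exact inner_funcS_curlE (H t) χ
  init := (hP (left_mem_Icc.2 hT)).trans hsol.init
  ampere t ht := by
    rw [deriv_eqOn_Ioo_of_eqOn_Icc hE ht, deriv_eqOn_Ioo_of_eqOn_Icc hP ht,
      hK (Ioo_subset_Icc_self ht)]
    exact hsol.ampere t ht
  faraday t ht := by
    rw [deriv_eqOn_Ioo_of_eqOn_Icc hH ht]
    exact hsol.faraday t ht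
  polarization t ht := by
    rw [caputo_eqOn_Ioo_of_eqOn_Icc hP ht, hP (Ioo_subset_Icc_self ht),
      hE (Ioo_subset_Icc_self ht)]
    exact hsol.polarization t ht

end FunctionSpaces

theorem IsSmoothSolution.deriv_zero_eq_zero {V S D : Type*} [NormedAddCommGroup V]
    [InnerProductSpace ℝ V] [CompleteSpace V] [NormedAddCommGroup S] [InnerProductSpace ℝ S]
    [AddCommGroup D] [Module ℝ D] {M : Medium} {ι : D →ₗ[ℝ] V} {cu : D →ₗ[ℝ] S} {T : ℝ}
    {f₁ f₃ : ℝ → V} {f₂ : ℝ → S} {E : ℝ → D} {e p k : ℝ → V} {h : ℝ → S}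
    (hs : IsSmoothSolution M ι cu T f₁ f₂ f₃ E e p k h) (hT : 0 < T)
    (hf₃ : DifferentiableWithinAt ℝ f₃ (Ioi 0) 0) : deriv p 0 = 0 := by
  have hκ : M.τ₀ ^ M.α ≠ 0 := (Real.rpow_pos_of_pos M.τ₀_pos _).ne'
  have he := (hs.contDiff_e.differentiable three_ne_zero 0).differentiableWithinAt (s := Ioi 0)
  have hp := (hs.contDiff_p.differentiable three_ne_zero 0).differentiableWithinAt (s := Ioi 0)
  refine deriv_zero_eq_zero_of_caputo_eventuallyEq (hs.contDiff_p.of_le (by norm_num)) M.α_pos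
    M.α_lt_one ((((he.const_smul M.susceptibility).add hf₃).sub hp).const_smul (M.τ₀ ^ M.α)⁻¹) ?_
  filter_upwards [Ioo_mem_nhdsGT hT] with t ht
  exact (eq_inv_smul_iff₀ hκ).2 (eq_sub_of_add_eq (hs.polarization t ht))

end ColeCole

end

open ColeCole in
theorem theorem2_general {M : Medium} {Ω : Set Plane} {θ T : ℝ}
    (hθ : θ ∈ Icc (M.α / 2) (1 / 2)) (hT : 0 < T) {f₁ f₃ : ℝ → L2V Ω} {f₂ : ℝ → L2S Ω}
    {E : ℝ → H0curl Ω} {P : ℝ → L2V Ω} {H : ℝ → HcurlS Ω}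
    (hE : ContDiffOn ℝ 3 (fun t => fieldV (E t)) (Icc 0 T)) (hP : ContDiffOn ℝ 3 P (Icc 0 T))
    (hH : ContDiffOn ℝ 3 H (Icc 0 T)) (hf₃ : θ = 1 / 2 → DifferentiableWithinAt ℝ f₃ (Ioi 0) 0)
    (hsol : IsSolution M T f₁ f₂ f₃ E P H) :
    ∃ C > 0, ∀ (N : ℕ) (τ : ℝ), 1 ≤ N → τ = T / N →
      ∀ (Eτ : ℕ → H0curl Ω) (Pτ : ℕ → L2V Ω) (Hτ : ℕ → L2S Ω),
        IsSchemeSolution M θ τ N f₁ f₂ f₃ (E 0) (P 0) (funcS (H 0)) Eτ Pτ Hτ →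
        ∀ n ≤ N, ‖fieldV (E (n * τ)) - fieldV (Eτ n)‖ + ‖P (n * τ) - Pτ n‖
          + ‖funcS (H (n * τ)) - Hτ n‖ ≤ C * τ ^ order θ := by
  obtain ⟨e, he, hEe⟩ := exists_contDiff_extension hT 3 hE
  obtain ⟨p, hp, hPp⟩ := exists_contDiff_extension hT 3 hP
  obtain ⟨k, hk, hKk⟩ := exists_contDiff_extension hT 3 (contDiffOn_curlH hH)
  obtain ⟨h, hh, hHh⟩ := exists_contDiff_extension hT 3 (contDiffOn_funcS hH)
  have hs := hsol.isSmoothSolution hT.le he hp hk hh hEe hPp hKk hHh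
  obtain ⟨C, hC0, hC⟩ := hs.exists_error_le hθ hT.le fun hθ2 => hs.deriv_zero_eq_zero hT (hf₃ hθ2)
  refine ⟨C, hC0, fun N τ hN hτ Eτ Pτ Hτ hscheme n hn => ?_⟩
  have hN1 : (1 : ℝ) ≤ N := Nat.one_le_cast.2 hN
  have hN0 : (0 : ℝ) < N := one_pos.trans_le hN1
  have hτ0 : 0 < τ := hτ ▸ div_pos hT hN0
  have hNT : N * τ ≤ T := (hτ ▸ mul_div_cancel₀ T hN0.ne').le
  have hmem := node_mem_Icc hτ0.le hNT hn
  have hbound := hC N τ hτ0 (hτ ▸ div_le_self hT.le hN1) hNT Eτ Pτ Hτ hscheme.initE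
    (hscheme.initP.trans hsol.init) (hscheme.initH.trans (hHh (left_mem_Icc.2 hT.le)).symm)
    hscheme.isDiscreteSolution n hn
  rw [hEe hmem, hPp hmem, hHh hmem] at hbound
  exact hbound

theorem theorem2 (M : ColeCole.Medium) (θ : ℝ) (hθ : θ ∈ Set.Icc (M.α / 2) (1 / 2))
    (a b c d : ℝ) (hab : a < b) (hcd : c < d) (T : ℝ) (hT : 0 < T)
    (f₁ : ℝ → ColeCole.L2V (ColeCole.rect a b c d))
    (f₂ : ℝ → ColeCole.L2S (ColeCole.rect a b c d))
    (f₃ : ℝ → ColeCole.L2V (ColeCole.rect a b c d))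
    (E : ℝ → ColeCole.H0curl (ColeCole.rect a b c d))
    (P : ℝ → ColeCole.L2V (ColeCole.rect a b c d))
    (H : ℝ → ColeCole.HcurlS (ColeCole.rect a b c d))
    (hE : ContinuousOn E (Set.Icc 0 T))
    (hE3 : ContDiffOn ℝ 3 (fun t => ColeCole.fieldV (E t)) (Set.Icc 0 T))
    (hP3 : ContDiffOn ℝ 3 P (Set.Icc 0 T))
    (hH3 : ContDiffOn ℝ 3 H (Set.Icc 0 T))
    (hf₃ : θ = 1 / 2 → ContDiffOn ℝ 1 f₃ (Set.Icc 0 T))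
    (hsol : ColeCole.IsSolution M T f₁ f₂ f₃ E P H) :
    ∃ C > 0, ∃ τmax > 0, ∀ (N : ℕ) (τ : ℝ), 1 ≤ N → τ = T / N → τ ≤ τmax →
      ∀ (Eτ : ℕ → ColeCole.H0curl (ColeCole.rect a b c d))
        (Pτ : ℕ → ColeCole.L2V (ColeCole.rect a b c d))
        (Hτ : ℕ → ColeCole.L2S (ColeCole.rect a b c d)),
        ColeCole.IsSchemeSolution M θ τ N f₁ f₂ f₃ (E 0) (P 0) (ColeCole.funcS (H 0)) Eτ Pτ Hτ →
        ∀ n : ℕ, 1 ≤ n → n ≤ N →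
          ‖ColeCole.fieldV (E (n * τ)) - ColeCole.fieldV (Eτ n)‖ + ‖P (n * τ) - Pτ n‖
            + ‖ColeCole.funcS (H (n * τ)) - Hτ n‖ ≤ C * τ ^ ColeCole.order θ := by
  obtain ⟨C, hC, h⟩ := theorem2_general hθ hT hE3 hP3 hH3 (fun hθ2 =>
    ((hf₃ hθ2).differentiableOn one_ne_zero 0 (left_mem_Icc.2 hT.le)).mono_of_mem_nhdsWithin
      (Icc_mem_nhdsGT hT)) hsol
  exact ⟨C, hC, 1, one_pos, fun N τ hN hτ _ Eτ Pτ Hτ hs n _ hn => h N τ hN hτ Eτ Pτ Hτ hs n hn⟩
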